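/- **Setting.** Parameters: integers $\kappa,\lambda\ge 0$, $k\ge 0$, $\omega\ge 1$; a degree $d\mid 256$ (in applications $d=128$); a prime $q$; $l\mid d$ and a primitive $2l$-th root of unity $\zeta\in\mathbb Z_q$ such that every $X^{d/l}-\zeta^{2j+1}$ ($0\le j<l$) is irreducible over $\mathbb Z_q$; $0<p<1$; a distribution $\chi$ on $\{-1,0,1\}$; an integer, written $\sqrt q$ below, at distance less than $1$ from the real square root of $q$. Put $n=\kappa+\lambda+3$, $\mathcal R=\mathbb Z[X]/(X^d+1)$, $\mathcal R_q=\mathbb Z_q[X]/(X^d+1)$. Norms on $\mathcal R_q$ are taken of the coefficients in $(-q/2,q/2]$, $\vec{\cdot}$ denotes coefficient vectors, and $\sigma_{-1}$ is the automorphism $X\mapsto X^{-1}$. $D_{\mathfrak s}$ is the centred discrete Gaussian on $\mathbb Z$. $\mathrm{Bin}_1$ takes the values $-1,0,1$ with probabilities $\frac14,\frac12,\frac14$. The challenge distribution $\mathcal C$ is that of a polynomial $c$ with independent coefficients, equal to $0$ with probability $p$ and to $\pm1$ with probability $\frac{1-p}2$ each, conditioned on $\|c\|_1\le\omega$ (no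 condition if $\omega\ge d$). Let $\mathfrak s_1=\mathfrak s_2=11\omega\sqrt{nd}$, $\mathfrak s_3=11\sqrt{337}\sqrt{nd}$, $\beta_1=\mathfrak s_1\sqrt{2nd}$, $\beta_2=\mathfrak s_2\sqrt{2nd}$, $\beta_3=\sqrt{2k}\,\mathfrak s_3$. $\mathrm{Rej}(z,v,\mathfrak s)$ lets $z$ pass with probability $\min\bigl(1,\frac13\exp\frac{-2\langle z,v\rangle+\|v\|^2}{2\mathfrak s^2}\bigr)$, and otherwise the prover aborts. **Statement and commitments.** A key $(A,pk_1,pk_2,B)\in\mathcal R_q^{\kappa\times n}\times(\mathcal R_q^n)^3$ and a commitment $com=\mathrm{Com}((m_1,m_2,m_3),r)=(Ar,\;pk_1^Tr+m_1,\;pk_2^Tr+m_2,\;B^Tr+m_3)$. Public auxiliary key: $A_1,A_2\in\mathcal R_q^{\kappa\times n}$, $B_1,B_c''\in\mathcal R_q^{1\times n}$, $B_c'\in\mathcal R_q^{(256/d)\times n}$. An honest prover has $r$ with coefficients in $\{-1,0,1\}$ and $v\in\mathbb Z_q$ with $com=\mathrm{Com}((v,\sqrt q\,v,v),r)$. **Protocol**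 (Proof of Consistency). 1. The prover samples $s\leftarrow\chi^{nd}$, uniform $g\in\mathcal R_q$ with constant coefficient $0$, $y_1\leftarrow D_{\mathfrak s_1}^{nd}$, $y_2\leftarrow D_{\mathfrak s_2}^{nd}$, $y_3\leftarrow D_{\mathfrak s_3}^{256}$ and sends $f=(f_0,f_1)=(A_1r+A_2s,\,B_1s+v)$, $u_1=B_c's+y_3$, $u_2=B_c''s+g$. 2. The verifier sends $R\leftarrow\mathrm{Bin}_1^{256\times nd}$, with rows $\vec r_j$. The prover applies $\mathrm{Rej}(\vec z_3,R\vec r,\mathfrak s_3)$ to $\vec z_3=\vec y_3+R\vec r$ and sends $z_3$. 3. The verifier sends uniform $d_{1,j}\in\mathbb Z_q$ ($1\le j\le256$) and $d_{2,j-1}\in\mathbb Z_q$ ($2\le j\le d$). With $e_j\in\mathcal R_q^{256/d}$ the $j$-th coefficient unit vector and $e_j'=X^{j-1}$, the prover sends $h=g+\sum_jd_{1,j}\bigl(\sigma_{-1}(r_j)^Tr+\sigma_{-1}(e_j)^T(y_3-z_3)\bigr)+\sum_{j\ge2}d_{2,j-1}\sigma_{-1}(e_j')v$, $w=A_1y_1+A_2y_2$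 and $\mathbf v=T(y_1,-B_1y_2,-B_c'y_2,-B_c''y_2)$, where $T(a,b,y,t)$ is the vector $\bigl(Aa,\;pk_1^Ta+b,\;pk_2^Ta+\sqrt q\,b,\;B^Ta+b,\;\sum_jd_{1,j}\sigma_{-1}(r_j)^Ta+\sum_{j\ge2}d_{2,j-1}\sigma_{-1}(e'_j)b+\sum_jd_{1,j}\sigma_{-1}(e_j)^Ty+t\bigr)$. 4. The verifier sends $c\leftarrow\mathcal C$. The prover applies $\mathrm{Rej}(z_1,cr,\mathfrak s_1)$ and $\mathrm{Rej}(z_2,cs,\mathfrak s_2)$ to $z_1=y_1+cr$, $z_2=y_2+cs$ and sends both. 5. The verifier accepts iff $\|z_1\|\le\beta_1$, $\|z_2\|\le\beta_2$, $\|z_3\|_\infty\le\beta_3$, $h$ has constant coefficient $0$, $A_1z_1+A_2z_2=w+cf_0$, and $\mathbf v=T(z_1,\,cf_1-B_1z_2,\,cu_1-B_c'z_2,\,cu_2-B_c''z_2)-c\,\bigl(com,\;h+\sum_jd_{1,j}\sigma_{-1}(e_j)^Tz_3\bigr)$. All messages are sent modulo $q$. Algorithms are probabilistic arithmetic circuits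 over $\mathbb Z_q$; constants, additions, multiplications, an inversion in $\mathcal R_q$, a sample from one of the distributions above (one coefficient in $\mathbb Z_q$, or one challenge $c$), and an oracle call each cost one gate. **Theorem.** There are constants $D\ge1$ and $a$ such that, for all parameters, with $N=a(\kappa+\lambda+d)^a$: *Completeness.* For all keys and every honest input, the prover does not abort with probability at least $\bigl(\frac{1-2^{-100}}3\bigr)^3$, and conditioned on not aborting the verifier accepts with probability at least $1-\bigl(2\cdot2^{-nd/8}+256\cdot2e^{-k}+2^{-100}\bigr)$. *Knowledge soundness.* There is an oracle circuit $\mathcal E$ of size at most $N$ (depending on the parameters only), given the keys, $com$ and resettable black-box access to the prover, such that the following holds for all keys, all $com$ and every (computationally unbounded, randomised) prover $\mathcal P^*$ whose acceptance probability is $\varepsilon$. Let $M=\frac1q+\frac1q\sum_{j\in\mathbb Z_q^\times}\prod_{i=0}^{l-1}\bigl|p+(1-p)\cos(2\pi j\zeta^i/q)\bigr|$, let $K$ be any real number with $(qM)^{d/l}\le K\cdot\Pr[\|c\|_1\le\omega]$ (here $c$ has independent coefficients as above, before conditioning), and let $$\mathrm{err}=K\,\frac{l}{q^{d/l}}+\frac1q+\frac1{2^{256}}.$$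 If $\varepsilon>\mathrm{err}$, then with probability at least $(\varepsilon-\mathrm{err})^D/N$ the output of $\mathcal E$ contains either * $(\bar c,r^*,s^*,m^*)$ with $\bar c$ invertible, $\|\bar c\|_1\le2\omega$, $\|\bar cr^*\|\le2\beta_1$, $\|\bar cs^*\|\le2\beta_2$, $\|r^*\|_\infty\le2\beta_3$, $f_0=A_1r^*+A_2s^*$, $f_1=B_1s^*+m^*_1$ for the $f$ that $\mathcal P^*$ sends, $com=\mathrm{Com}(m^*,r^*)$, and $m^*=(v^*,\sqrt q\,v^*,v^*)$ with $v^*\in\mathbb Z_q$; or * a solution of $\mathrm{MSIS}_{\kappa,2n,\beta}$ for $[A_1\,|\,A_2]$ with $\beta=8\omega\sqrt{\beta_1^2+\beta_2^2}$, that is, $z\in\mathcal R_q^{2n}$ with $[A_1|A_2]z=0$ and $0<\|z\|\le\beta$. *Honest-verifier zero-knowledge.* There are a simulator $\mathcal S$ (given the keys and $com$) and a reduction $\mathcal B$, circuits of size at most $N$ that depend on the parameters only, such that the following holds for every statement with an honest input $(r,v)$, every $A_1$ and every distinguisher $\mathcal D$ (given the auxiliary key and a transcript). Let $G=[A_2;B_1;B_c';B_c'']$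 be uniform. Then the advantage of $\mathcal D$ in distinguishing the honest transcript, conditioned on the prover not aborting, from the output of $\mathcal S$ is at most $2^{-100}$ plus the advantage of $\mathcal D\circ\mathcal B$, where $\mathcal B$ is given $G$, the remaining keys, $com$, $r$, $v$ and $t$, in distinguishing $(G,t=Gs)$ with $s\leftarrow\chi^{nd}$ from $(G,t)$ with $t$ uniform (the dual, or knapsack, module-LWE problem with $\kappa+2+256/d$ rows and $n$ columns). -/

import Mathlib

open Polynomial

namespace PoC

noncomputable section

/-! ### Discrete probability -/

/-- `Pr μ s` is the probability of the event `s` as a real number. -/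
def Pr {α : Type} (μ : PMF α) (s : Set α) : ℝ := (μ.toOuterMeasure s).toReal

open Classical in
/-- The conditional distribution of `μ` given `s` (and `μ` itself if `s` has probability zero). -/
def condOn {α : Type} (μ : PMF α) (s : Set α) : PMF α :=
  if h : ∃ a ∈ s, a ∈ μ.support then μ.filter s h else μ

/-- A coin that shows `true` with probability `min 1 t` (and `0` for negative `t`). -/
def coin (t : ℝ) : PMF Bool :=
  PMF.ofFintype (fun b => cond b (min 1 (ENNReal.ofReal t)) (1 - min 1 (ENNReal.ofReal t)))
    (by simp)

/-- `n` independent samples. -/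
def iidFin {α : Type} (μ : PMF α) : (n : ℕ) → PMF (Fin n → α)
  | 0 => PMF.pure Fin.elim0
  | n + 1 => μ.bind fun a => (iidFin μ n).bind fun v => PMF.pure (Fin.cons a v)

/-- A family of independent samples with an arbitrary finite index type. -/
def iid (ι : Type) [Fintype ι] {α : Type} (μ : PMF α) : PMF (ι → α) :=
  (iidFin μ (Fintype.card ι)).map fun v i => v (Fintype.equivFin ι i)

/-- The distribution on `{-1, 0, 1}` with mass `p` at `0` and `(1 - p) / 2` at `1` and `-1`. -/
def ternary (p : ℝ) : PMF ℤ :=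
  (coin p).bind fun b => if b then PMF.pure 0 else
    (coin (1 / 2)).bind fun b' => PMF.pure (if b' then 1 else -1)

/-- The centred binomial distribution: `-1, 0, 1` with probabilities `1/4, 1/2, 1/4`. -/
def bin1 : PMF ℤ := ternary (1 / 2)

def gaussWeight (σ : ℝ) (x : ℤ) : ENNReal :=
  ENNReal.ofReal (Real.exp (-(x : ℝ) ^ 2 / (2 * σ ^ 2)))

theorem gaussWeight_ne_zero (σ : ℝ) : (∑' x, gaussWeight σ x) ≠ 0 := by
  intro h
  have h0 := ENNReal.tsum_eq_zero.1 h 0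
  simp [gaussWeight] at h0

theorem gaussWeight_ne_top {σ : ℝ} (hσ : 0 < σ) : (∑' x, gaussWeight σ x) ≠ ⊤ := by
  have hc : -(1 / (2 * σ ^ 2)) < 0 := by
    have : 0 < 1 / (2 * σ ^ 2) := by positivity
    linarith
  have hn : Summable fun n : ℕ => Real.exp (-((n : ℤ) : ℝ) ^ 2 / (2 * σ ^ 2)) := by
    have := Real.summable_exp_nat_mul_of_ge hc (f := fun n : ℕ => (n : ℝ) ^ 2)
      (fun i => by
        rcases Nat.eq_zero_or_pos i with rfl | hi
        · simp
        · have : (1 : ℝ) ≤ i := by exact_mod_cast hi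
          nlinarith)
    refine this.congr fun n => ?_
    congr 1
    push_cast
    ring
  have hs : Summable fun x : ℤ => Real.exp (-(x : ℝ) ^ 2 / (2 * σ ^ 2)) := by
    refine Summable.of_nat_of_neg hn ?_
    refine hn.congr fun n => ?_
    congr 1
    push_cast
    ring
  exact hs.tsum_ofReal_ne_top

/-- The centred discrete Gaussian on `ℤ` with standard deviation `σ > 0`. -/
def discreteGaussian (σ : ℝ) : PMF ℤ :=
  if h : 0 < σ then PMF.normalize (gaussWeight σ) (gaussWeight_ne_zero σ) (gaussWeight_ne_top h)
  else PMF.pure 0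

/-! ### The rings `ℤ[X]/(X^d+1)` and `ℤ_q[X]/(X^d+1)` -/

section Ring

variable (R : Type) [CommRing R] (d : ℕ)

abbrev Cyc : Type := AdjoinRoot (X ^ d + 1 : R[X])

variable {R d}

theorem cyc_monic [NeZero d] : (X ^ d + 1 : R[X]).Monic := by
  simpa using monic_X_pow_add_C (1 : R) (NeZero.ne d)

/-- The `i`-th coefficient of a ring element (its representative of degree less than `d`). -/
def coeff [NeZero d] (a : Cyc R d) (i : Fin d) : R :=
  (AdjoinRoot.modByMonicHom (cyc_monic (R := R) (d := d)) a).coeff i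

/-- The ring element with prescribed coefficients. -/
def ofCoeffs (f : Fin d → R) : Cyc R d :=
  AdjoinRoot.mk _ (∑ i, C (f i) * X ^ (i : ℕ))

/-- The image of `X`. -/
def xbar : Cyc R d := AdjoinRoot.root _

theorem xbar_pow : (xbar : Cyc R d) ^ d = -1 := by
  have h : AdjoinRoot.mk (X ^ d + 1 : R[X]) (X ^ d + 1) = 0 := AdjoinRoot.mk_self
  rw [map_add, map_pow, map_one, AdjoinRoot.mk_X] at h
  exact eq_neg_of_add_eq_zero_left h

theorem sigma_aux [NeZero d] :
    (X ^ d + 1 : R[X]).eval₂ (AdjoinRoot.of (X ^ d + 1 : R[X])) (-(xbar : Cyc R d) ^ (d - 1)) = 0 := by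
  obtain ⟨e, rfl⟩ : ∃ e, d = e + 1 := ⟨d - 1, (Nat.succ_pred (NeZero.ne d)).symm⟩
  have h : ((xbar : Cyc R (e + 1)) ^ e) ^ (e + 1) = (-1) ^ e := by
    rw [← pow_mul, mul_comm, pow_mul, xbar_pow]
  simp only [eval₂_add, eval₂_pow, eval₂_X, eval₂_one, Nat.add_sub_cancel]
  rw [neg_pow, h, ← pow_add]
  have : (-1 : Cyc R (e + 1)) ^ (e + 1 + e) = -1 :=
    Odd.neg_one_pow ⟨e, by ring⟩
  rw [this]
  ring

/-- The automorphism `σ₋₁`, which sends `X` to `X⁻¹ = -X^(d-1)`. -/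
def sigma [NeZero d] : Cyc R d →+* Cyc R d :=
  AdjoinRoot.lift (AdjoinRoot.of _) (-(xbar : Cyc R d) ^ (d - 1)) sigma_aux

/-- `σ₋₁(u)ᵀ v`. -/
def dotSigma [NeZero d] {ι : Type} [Fintype ι] (u v : ι → Cyc R d) : Cyc R d :=
  ∑ i, sigma (u i) * v i

/-- Reduction modulo `q`. -/
def red (q : ℕ) : Cyc ℤ d →+* Cyc (ZMod q) d :=
  AdjoinRoot.map (Int.castRingHom (ZMod q)) _ _ (by simp)

/-- The inner product of the coefficient vectors. -/
def innerZ [NeZero d] {ι : Type} [Fintype ι] (u v : ι → Cyc ℤ d) : ℤ :=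
  ∑ i, ∑ j, coeff (u i) j * coeff (v i) j

/-- The `ℓ₁` norm of an integer polynomial. -/
def l1Z [NeZero d] (c : Cyc ℤ d) : ℕ := ∑ j, (coeff c j).natAbs

variable {q : ℕ}

/-- The norms over `ℤ_q[X]/(X^d+1)`; coefficients are represented in `(-q/2, q/2]`. -/
def l1 [NeZero d] (c : Cyc (ZMod q) d) : ℕ := ∑ j, (coeff c j).valMinAbs.natAbs

def norm2 [NeZero d] {ι : Type} [Fintype ι] (u : ι → Cyc (ZMod q) d) : ℝ :=
  Real.sqrt (∑ i, ∑ j, ((coeff (u i) j).valMinAbs : ℝ) ^ 2)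

def normInf [NeZero d] {ι : Type} [Fintype ι] (u : ι → Cyc (ZMod q) d) : ℕ :=
  Finset.univ.sup fun i => Finset.univ.sup fun j => (coeff (u i) j).valMinAbs.natAbs

/-- A random polynomial with independent coefficients distributed as `μ`. -/
def polyOf (d : ℕ) {R : Type} [CommRing R] (μ : PMF R) : PMF (Cyc R d) :=
  (iid (Fin d) μ).map ofCoeffs

end Ring

/-! ### Arithmetic circuits

Algorithms are probabilistic arithmetic circuits: acyclic networks of gates in which every wire
carries one element of `K`. Wires may be copied and permuted freely; every gate costs one step.
-/

inductive Circuit (G : Type) (dom cod : G → Type) : Type → Type → Type 1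
  | wire {α β : Type} (f : β → α) : Circuit G dom cod α β
  | gate (g : G) : Circuit G dom cod (dom g) (cod g)
  | comp {α β γ : Type} (F : Circuit G dom cod α β) (F' : Circuit G dom cod β γ) :
      Circuit G dom cod α γ
  | pair {α β γ : Type} (F : Circuit G dom cod α β) (F' : Circuit G dom cod α γ) :
      Circuit G dom cod α (β ⊕ γ)

namespace Circuit

variable {G : Type} {dom cod : G → Type}

/-- The number of gates. -/
def size {α β : Type} : Circuit G dom cod α β → ℕ
  | wire _ => 0
  | gate _ => 1
  | comp F F' => F.size + F'.size
  | pair F F' => F.size + F'.size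

/-- The output distribution, given the behaviour of the gates. -/
def eval {K : Type} (interp : (g : G) → (dom g → K) → PMF (cod g → K)) {α β : Type} :
    Circuit G dom cod α β → (α → K) → PMF (β → K)
  | wire f => fun x => PMF.pure fun b => x (f b)
  | gate g => interp g
  | comp F F' => fun x => (F.eval interp x).bind (F'.eval interp)
  | pair F F' => fun x =>
      (F.eval interp x).bind fun y => (F'.eval interp x).bind fun z => PMF.pure (Sum.elim y z)

end Circuit

/-- How the elements of `T` are written on wires carrying elements of `K`. -/
class Wires (K T : Type) where
  idx : Type
  enc : T → idx → K
  dec : (idx → K) → T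

namespace Wires

instance self (K : Type) : Wires K K := ⟨Unit, fun a _ => a, fun f => f ()⟩

instance prod (K S T : Type) [Wires K S] [Wires K T] : Wires K (S × T) :=
  ⟨idx K S ⊕ idx K T, fun a => Sum.elim (enc a.1) (enc a.2),
    fun f => (dec fun i => f (.inl i), dec fun i => f (.inr i))⟩

instance pi (K ι T : Type) [Wires K T] : Wires K (ι → T) :=
  ⟨ι × idx K T, fun a i => enc (a i.1) i.2, fun f i => dec fun j => f (i, j)⟩

instance matrix (K ι μ T : Type) [Wires K T] : Wires K (Matrix ι μ T) :=
  ⟨ι × μ × idx K T, fun a i => enc (a i.1 i.2.1) i.2.2,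
    fun f => Matrix.of fun i j => dec fun k => f (i, j, k)⟩

instance cyc (R : Type) [CommRing R] (d : ℕ) [NeZero d] : Wires R (Cyc R d) :=
  ⟨Fin d, coeff, ofCoeffs⟩

/-- The encoding of a structure through the tuple of its fields. -/
abbrev ofTuple {K S T : Type} [Wires K S] (f : T → S) (g : S → T) : Wires K T :=
  ⟨idx K S, fun a => enc (f a), fun w => g (dec w)⟩

end Wires

/-! ### Parameters -/

/-- The public parameters: module ranks `κ`, `lam`, ring degree `d`, modulus `q`, number `l` of
prime factors of `X^d+1` modulo `q`, bound `ω` on the `ℓ₁` norm of challenges, tail parameter `k`,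
primitive `2l`-th root of unity `ζ`, probability `p` of a zero challenge coefficient, distribution
`χ` of commitment randomness, and the rounding `sq` of `√q` to an integer. -/
structure Params where
  κ : ℕ
  lam : ℕ
  d : ℕ
  q : ℕ
  l : ℕ
  ω : ℕ
  k : ℕ
  ζ : ZMod q
  p : ℝ
  χ : PMF ℤ
  sq : ℤ
  q_prime : q.Prime
  d_dvd : d ∣ 256
  l_dvd : l ∣ d
  ζ_prim : IsPrimitiveRoot ζ (2 * l)
  irred : ∀ j < l, Irreducible (X ^ (d / l) - C (ζ ^ (2 * j + 1)) : (ZMod q)[X])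
  ω_pos : 0 < ω
  p_pos : 0 < p
  p_lt : p < 1
  χ_supp : ∀ x ∈ χ.support, x = -1 ∨ x = 0 ∨ x = 1
  sq_near : |(sq : ℝ) - Real.sqrt q| < 1

namespace Params

variable (P : Params)

instance : Fact P.q.Prime := ⟨P.q_prime⟩

instance : NeZero P.d := ⟨fun h => by simpa [h] using P.d_dvd⟩

/-- The number of columns of the commitment matrices. -/
abbrev n : ℕ := P.κ + P.lam + 3

/-- The number of ring elements that hold `256` coefficients. -/
abbrev δ : ℕ := 256 / P.d

abbrev Zq : Type := ZMod P.q

abbrev Rq : Type := Cyc (ZMod P.q) P.d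

abbrev RZ : Type := Cyc ℤ P.d

/-- The standard deviations `𝔰₁ = 𝔰₂` and `𝔰₃`. -/
def s12 : ℝ := 11 * P.ω * Real.sqrt (P.n * P.d)

def s3 : ℝ := 11 * Real.sqrt 337 * Real.sqrt (P.n * P.d)

/-- The common norm bound `𝔰₁ √(2(κ+λ+3)d)` on the last responses. -/
def bound12 : ℝ := P.s12 * Real.sqrt (2 * (P.n * P.d))

/-- The bound `√(2k) 𝔰₃` on the coefficients of the approximate range proof. -/
def bound3 : ℝ := Real.sqrt (2 * P.k) * P.s3

/-- Polynomials with independent coefficients, `0` with probability `p`, `±1` otherwise. -/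
def ternaryPoly : PMF P.RZ := polyOf P.d (ternary P.p)

/-- The challenge distribution: ternary polynomials of `ℓ₁` norm at most `ω`
(no restriction if `d ≤ ω`). -/
def chal : PMF P.RZ := condOn P.ternaryPoly {c | l1Z c ≤ P.ω}

/-- The bound `M` on the point probabilities of the coefficients of a random ternary polynomial
modulo a prime factor `X^(d/l) - ζ^j`. -/
def maxProb : ℝ :=
  1 / P.q + 1 / P.q * ∑ j ∈ Finset.univ.filter (fun j : P.Zq => j ≠ 0),
    ∏ i ∈ Finset.range P.l,
      |P.p + (1 - P.p) * Real.cos (2 * Real.pi * ((j * P.ζ ^ i).val : ℝ) / P.q)|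

/-- The security parameter against which efficiency is measured. -/
def secPar : ℕ := P.κ + P.lam + P.d

end Params

variable (P : Params)

/-! ### Commitments and hardness assumptions -/

/-- The key of the commitment to the transaction value. -/
structure ComKey where
  A : Matrix (Fin P.κ) (Fin P.n) P.Rq
  pk1 : Fin P.n → P.Rq
  pk2 : Fin P.n → P.Rq
  B : Fin P.n → P.Rq

structure Com where
  com0 : Fin P.κ → P.Rq
  com1 : P.Rq
  com2 : P.Rq
  com3 : P.Rq

/-- The key of the additional Ajtai-BDLOP commitment. -/
structure AuxKey where
  A1 : Matrix (Fin P.κ) (Fin P.n) P.Rq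
  A2 : Matrix (Fin P.κ) (Fin P.n) P.Rq
  B1 : Fin P.n → P.Rq
  Bc : Matrix (Fin P.δ) (Fin P.n) P.Rq
  Bc' : Fin P.n → P.Rq

variable {P} in
def commit (ck : ComKey P) (m1 m2 m3 : P.Rq) (r : Fin P.n → P.Rq) : Com P where
  com0 := ck.A.mulVec r
  com1 := ck.pk1 ⬝ᵥ r + m1
  com2 := ck.pk2 ⬝ᵥ r + m2
  com3 := ck.B ⬝ᵥ r + m3

/-- The statement of the proof: a commitment key and a commitment. -/
abbrev Stmt : Type := ComKey P × Com P

variable {P} in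
/-- A solution of the homogeneous module SIS problem with norm bound `β`. -/
def IsMSISSolution {ι : Type} [Fintype ι] (A : Matrix (Fin P.κ) ι P.Rq) (β : ℝ)
    (z : ι → P.Rq) : Prop :=
  A.mulVec z = 0 ∧ 0 < norm2 z ∧ norm2 z ≤ β

/-- A uniformly random element of `R_q`. -/
def unifRq : PMF P.Rq := polyOf P.d (PMF.uniformOfFintype P.Zq)

/-- The advantage of `Adv` in the dual (knapsack) module LWE problem with `ρ` rows and `m` columns:
to distinguish `(G, G s)` from `(G, u)` for uniform `G`, `u` and `s` with coefficients from `χ`. -/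
def dualMLWEAdv (ρ : Type) [Fintype ρ] (m : ℕ)
    (Adv : Matrix ρ (Fin m) P.Rq → (ρ → P.Rq) → PMF Bool) : ℝ :=
  |Pr ((iid ρ (iid (Fin m) (unifRq P))).bind fun G =>
        (iid (Fin m) (polyOf P.d P.χ)).bind fun s =>
          Adv (Matrix.of G) ((Matrix.of G).mulVec fun i => red P.q (s i))) {true}
    - Pr ((iid ρ (iid (Fin m) (unifRq P))).bind fun G =>
        (iid ρ (unifRq P)).bind fun u => Adv (Matrix.of G) u) {true}|

/-! ### The protocol -/

/-- First message of the prover: the additional commitment `f = (f0, f1)`, `u1`, `u2`. -/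
structure Msg1 where
  f0 : Fin P.κ → P.Rq
  f1 : P.Rq
  u1 : Fin P.δ → P.Rq
  u2 : P.Rq

/-- First challenge: the `256` rows `r_j` of the random matrix, as vectors of ring elements. The
row number `j` is a pair `(a, i)`, standing for the coefficient of `X^i` in the `a`-th entry of a
vector of `256/d` ring elements. -/
abbrev Ch1 : Type := Fin P.δ → Fin P.d → Fin P.n → P.Rq

/-- Second message: `z3`. -/
abbrev Msg2 : Type := Fin P.δ → P.Rq

/-- Second challenge: the scalars of the random linear combination. -/
structure Ch2 where
  d1 : Fin P.δ → Fin P.d → P.Zq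
  d2 : Fin (P.d - 1) → P.Zq

/-- Vectors in the range of the linear map `T`. -/
@[ext]
structure RelOut where
  v0 : Fin P.κ → P.Rq
  v1 : P.Rq
  v2 : P.Rq
  v3 : P.Rq
  v4 : P.Rq

/-- Third message: `h`, `w` and `v`. -/
structure Msg3 where
  h : P.Rq
  w : Fin P.κ → P.Rq
  v : RelOut P

/-- Last message: the responses `z1` and `z2`. -/
structure Msg4 where
  z1 : Fin P.n → P.Rq
  z2 : Fin P.n → P.Rq

structure Transcript where
  m1 : Msg1 P
  ch1 : Ch1 P
  m2 : Msg2 P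
  ch2 : Ch2 P
  m3 : Msg3 P
  c : P.Rq
  m4 : Msg4 P

section Protocol

variable {P}

/-- The unit vector `e_j`. -/
def eVec (a : Fin P.δ) (i : Fin P.d) : Fin P.δ → P.Rq := Pi.single a (xbar ^ (i : ℕ))

/-- `∑ d₁ⱼ σ₋₁(e_j)ᵀ y`. -/
def combE (e : Ch2 P) (y : Fin P.δ → P.Rq) : P.Rq :=
  ∑ a, ∑ i, e.d1 a i • dotSigma (eVec a i) y

/-- `∑ d₁ⱼ σ₋₁(r_j)ᵀ r`. -/
def combR (R : Ch1 P) (e : Ch2 P) (r : Fin P.n → P.Rq) : P.Rq :=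
  ∑ a, ∑ i, e.d1 a i • dotSigma (R a i) r

/-- `∑_{j ≥ 2} d₂,ⱼ₋₁ σ₋₁(e'_j) v`, where `e'_j = X^(j-1)`. -/
def combV (e : Ch2 P) (v : P.Rq) : P.Rq :=
  ∑ j : Fin (P.d - 1), e.d2 j • (sigma (xbar ^ (j.val + 1)) * v)

/-- The linear map `T`. -/
def relT (ck : ComKey P) (R : Ch1 P) (e : Ch2 P) (r : Fin P.n → P.Rq) (v : P.Rq)
    (y : Fin P.δ → P.Rq) (g : P.Rq) : RelOut P where
  v0 := ck.A.mulVec r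
  v1 := ck.pk1 ⬝ᵥ r + v
  v2 := ck.pk2 ⬝ᵥ r + (P.sq : P.Rq) * v
  v3 := ck.B ⬝ᵥ r + v
  v4 := combR R e r + combV e v + combE e y + g

/-- The decision of the verifier. -/
structure Accepts (x : Stmt P) (hk : AuxKey P) (τ : Transcript P) : Prop where
  norm_z1 : norm2 τ.m4.z1 ≤ P.bound12
  norm_z2 : norm2 τ.m4.z2 ≤ P.bound12
  norm_z3 : (normInf τ.m2 : ℝ) ≤ P.bound3
  const_h : coeff τ.m3.h 0 = 0
  opening : hk.A1.mulVec τ.m4.z1 + hk.A2.mulVec τ.m4.z2 = τ.m3.w + τ.c • τ.m1.f0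
  v0 : τ.m3.v.v0 = x.1.A.mulVec τ.m4.z1 - τ.c • x.2.com0
  v1 : τ.m3.v.v1 =
    (relT x.1 τ.ch1 τ.ch2 τ.m4.z1 (τ.c * τ.m1.f1 - hk.B1 ⬝ᵥ τ.m4.z2)
      (τ.c • τ.m1.u1 - hk.Bc.mulVec τ.m4.z2) (τ.c * τ.m1.u2 - hk.Bc' ⬝ᵥ τ.m4.z2)).v1
      - τ.c * x.2.com1
  v2 : τ.m3.v.v2 =
    (relT x.1 τ.ch1 τ.ch2 τ.m4.z1 (τ.c * τ.m1.f1 - hk.B1 ⬝ᵥ τ.m4.z2)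
      (τ.c • τ.m1.u1 - hk.Bc.mulVec τ.m4.z2) (τ.c * τ.m1.u2 - hk.Bc' ⬝ᵥ τ.m4.z2)).v2
      - τ.c * x.2.com2
  v3 : τ.m3.v.v3 =
    (relT x.1 τ.ch1 τ.ch2 τ.m4.z1 (τ.c * τ.m1.f1 - hk.B1 ⬝ᵥ τ.m4.z2)
      (τ.c • τ.m1.u1 - hk.Bc.mulVec τ.m4.z2) (τ.c * τ.m1.u2 - hk.Bc' ⬝ᵥ τ.m4.z2)).v3
      - τ.c * x.2.com3
  v4 : τ.m3.v.v4 =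
    (relT x.1 τ.ch1 τ.ch2 τ.m4.z1 (τ.c * τ.m1.f1 - hk.B1 ⬝ᵥ τ.m4.z2)
      (τ.c • τ.m1.u1 - hk.Bc.mulVec τ.m4.z2) (τ.c * τ.m1.u2 - hk.Bc' ⬝ᵥ τ.m4.z2)).v4
      - τ.c * (τ.m3.h + combE τ.ch2 τ.m2)

/-- The verifier's uniform scalars. -/
def ch2Law (P : Params) : PMF (Ch2 P) :=
  (iid (Fin P.δ) (iid (Fin P.d) (PMF.uniformOfFintype P.Zq))).bind fun d1 =>
    (iid (Fin (P.d - 1)) (PMF.uniformOfFintype P.Zq)).bind fun d2 => PMF.pure ⟨d1, d2⟩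

/-- The verifier's random matrix over `ℤ`, with entries from `Bin₁`. -/
def ch1LawZ (P : Params) : PMF (Fin P.δ → Fin P.d → Fin P.n → P.RZ) :=
  iid (Fin P.δ) (iid (Fin P.d) (iid (Fin P.n) (polyOf P.d bin1)))

def redCh1 (R : Fin P.δ → Fin P.d → Fin P.n → P.RZ) : Ch1 P := fun a i m => red P.q (R a i m)

/-- Rejection sampling with repetition rate `M = 3`; `true` means that `z` may be sent. -/
def rej {ι : Type} [Fintype ι] (z v : ι → P.RZ) (σ : ℝ) : PMF Bool :=
  coin (1 / 3 * Real.exp ((-2 * (innerZ z v : ℝ) + (innerZ v v : ℝ)) / (2 * σ ^ 2)))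

/-- Uniformly random element of `R_q` with constant coefficient zero. -/
def unifZeroConst (P : Params) : PMF P.Rq :=
  (iid (Fin P.d) (PMF.uniformOfFintype P.Zq)).map fun f => ofCoeffs (Function.update f 0 0)

/-- The product of the integer challenge matrix and the coefficient vector of `r`. -/
def matZ (R : Fin P.δ → Fin P.d → Fin P.n → P.RZ) (r : Fin P.n → P.RZ) : Fin P.δ → P.RZ :=
  fun a => ofCoeffs fun i => innerZ (R a i) r

/-- Reduction modulo `q` of vectors. -/
def redV {ι : Type} (u : ι → P.RZ) : ι → P.Rq := fun i => red P.q (u i)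

/-- The run of the honest prover, with input `(r, v)`, and the honest verifier. The result is
`none` if the prover aborts in one of the three rejection sampling steps. -/
def honestRun (x : Stmt P) (hk : AuxKey P) (r : Fin P.n → P.RZ) (v : P.Zq) :
    PMF (Option (Transcript P)) := do
  let rq : Fin P.n → P.Rq := redV r
  let vq : P.Rq := AdjoinRoot.of _ v
  let s ← iid (Fin P.n) (polyOf P.d P.χ)
  let g ← unifZeroConst P
  let y1 ← iid (Fin P.n) (polyOf P.d (discreteGaussian P.s12))
  let y2 ← iid (Fin P.n) (polyOf P.d (discreteGaussian P.s12))
  let y3 ← iid (Fin P.δ) (polyOf P.d (discreteGaussian P.s3))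
  let sq : Fin P.n → P.Rq := redV s
  let m1 : Msg1 P :=
    { f0 := hk.A1.mulVec rq + hk.A2.mulVec sq
      f1 := hk.B1 ⬝ᵥ sq + vq
      u1 := hk.Bc.mulVec sq + redV y3
      u2 := hk.Bc' ⬝ᵥ sq + g }
  let RZ ← ch1LawZ P
  let R : Ch1 P := redCh1 RZ
  let z3 : Fin P.δ → P.RZ := y3 + matZ RZ r
  let ok3 ← rej z3 (matZ RZ r) P.s3
  if ok3 = false then PMF.pure none else do
    let e ← ch2Law P
    let xx : P.Rq :=
      combR R e rq + combE e (redV y3) - combE e (redV z3) + combV e vq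
    let m3 : Msg3 P :=
      { h := g + xx
        w := hk.A1.mulVec (redV y1) + hk.A2.mulVec (redV y2)
        v := relT x.1 R e (redV y1) (-(hk.B1 ⬝ᵥ redV y2)) (-(hk.Bc.mulVec (redV y2)))
          (-(hk.Bc' ⬝ᵥ redV y2)) }
    let c ← P.chal
    let z1 : Fin P.n → P.RZ := y1 + c • r
    let z2 : Fin P.n → P.RZ := y2 + c • s
    let ok1 ← rej z1 (c • r) P.s12
    let ok2 ← rej z2 (c • s) P.s12
    if ok1 = false ∨ ok2 = false then PMF.pure none else
      PMF.pure (some ⟨m1, R, redV z3, e, m3, red P.q c, ⟨redV z1, redV z2⟩⟩)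

/-- The distribution of the honest run conditioned on the prover not aborting. -/
def nonAborting (x : Stmt P) (hk : AuxKey P) (r : Fin P.n → P.RZ) (v : P.Zq) :
    PMF (Option (Transcript P)) :=
  condOn (honestRun x hk r v) {o | o.isSome}

/-- The relation of honest inputs: `r` has coefficients in `{-1, 0, 1}`, and `x` is a commitment
to `(v, √q v, v)` with randomness `r`. -/
def HonestInput (x : Stmt P) (r : Fin P.n → P.RZ) (v : P.Zq) : Prop :=
  (∀ i j, coeff (r i) j = -1 ∨ coeff (r i) j = 0 ∨ coeff (r i) j = 1) ∧
    x.2 = commit x.1 (AdjoinRoot.of _ v) ((P.sq : P.Rq) * AdjoinRoot.of _ v) (AdjoinRoot.of _ v)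
      (redV r)

end Protocol

/-- A cheating prover whose random tape has been fixed. -/
structure DetProver where
  msg1 : Msg1 P
  msg2 : Ch1 P → Msg2 P
  msg3 : Ch1 P → Ch2 P → Msg3 P
  msg4 : Ch1 P → Ch2 P → P.Rq → Msg4 P

variable {P} in
def DetProver.transcript (A : DetProver P) (R : Ch1 P) (e : Ch2 P) (c : P.Rq) : Transcript P :=
  ⟨A.msg1, R, A.msg2 R, e, A.msg3 R e, c, A.msg4 R e c⟩

variable {P} in
/-- The probability that a randomised prover (a distribution of deterministic ones) convinces the
honest verifier. -/
def acceptProb (x : Stmt P) (hk : AuxKey P) (𝒜 : PMF (DetProver P)) : ℝ :=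
  Pr (do
    let A ← 𝒜
    let R ← (ch1LawZ P).map redCh1
    let e ← ch2Law P
    let c ← P.chal.map (red P.q)
    return A.transcript R e c) {τ | Accepts x hk τ}

/-! ### Encodings and gates -/

instance : Wires P.Zq (ComKey P) :=
  Wires.ofTuple (fun a => (a.A, a.pk1, a.pk2, a.B)) fun t => ⟨t.1, t.2.1, t.2.2.1, t.2.2.2⟩

instance : Wires P.Zq (Com P) :=
  Wires.ofTuple (fun a => (a.com0, a.com1, a.com2, a.com3))
    fun t => ⟨t.1, t.2.1, t.2.2.1, t.2.2.2⟩

instance : Wires P.Zq (AuxKey P) :=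
  Wires.ofTuple (fun a => (a.A1, a.A2, a.B1, a.Bc, a.Bc'))
    fun t => ⟨t.1, t.2.1, t.2.2.1, t.2.2.2.1, t.2.2.2.2⟩

instance : Wires P.Zq (Msg1 P) :=
  Wires.ofTuple (fun a => (a.f0, a.f1, a.u1, a.u2)) fun t => ⟨t.1, t.2.1, t.2.2.1, t.2.2.2⟩

instance : Wires P.Zq (Ch2 P) :=
  Wires.ofTuple (fun a => (a.d1, a.d2)) fun t => ⟨t.1, t.2⟩

instance : Wires P.Zq (RelOut P) :=
  Wires.ofTuple (fun a => (a.v0, a.v1, a.v2, a.v3, a.v4))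
    fun t => ⟨t.1, t.2.1, t.2.2.1, t.2.2.2.1, t.2.2.2.2⟩

instance : Wires P.Zq (Msg3 P) :=
  Wires.ofTuple (fun a => (a.h, a.w, a.v)) fun t => ⟨t.1, t.2.1, t.2.2⟩

instance : Wires P.Zq (Msg4 P) :=
  Wires.ofTuple (fun a => (a.z1, a.z2)) fun t => ⟨t.1, t.2⟩

instance : Wires P.Zq (Transcript P) :=
  Wires.ofTuple (fun a => (a.m1, a.ch1, a.m2, a.ch2, a.m3, a.c, a.m4))
    fun t => ⟨t.1, t.2.1, t.2.2.1, t.2.2.2.1, t.2.2.2.2.1, t.2.2.2.2.2.1, t.2.2.2.2.2.2⟩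

/-- The elementary steps: constants, addition and multiplication in `ℤ_q`, inversion in `R_q`,
and sampling from the distributions that the protocol uses. -/
inductive Gate
  | const (a : P.Zq)
  | add
  | mul
  | inv
  | unif
  | chi
  | bin
  | gauss12
  | gauss3
  | chal

namespace Gate

variable {P}

def dom : Gate P → Type
  | add => Bool
  | mul => Bool
  | inv => Fin P.d
  | _ => Empty

def cod : Gate P → Type
  | inv => Fin P.d
  | chal => Fin P.d
  | _ => Unit

def interp : (g : Gate P) → (dom g → P.Zq) → PMF (cod g → P.Zq)
  | const a => fun _ => PMF.pure fun _ => a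
  | add => fun x => PMF.pure fun _ => x false + x true
  | mul => fun x => PMF.pure fun _ => x false * x true
  | inv => fun x => PMF.pure (coeff (Ring.inverse (ofCoeffs (d := P.d) x)))
  | unif => fun _ => (PMF.uniformOfFintype P.Zq).map fun a _ => a
  | chi => fun _ => P.χ.map fun a _ => (a : P.Zq)
  | bin => fun _ => bin1.map fun a _ => (a : P.Zq)
  | gauss12 => fun _ => (discreteGaussian P.s12).map fun a _ => (a : P.Zq)
  | gauss3 => fun _ => (discreteGaussian P.s3).map fun a _ => (a : P.Zq)
  | chal => fun _ => P.chal.map fun c => coeff (red P.q c)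

end Gate

/-- Oracle calls: the next-message functions of a prover that can be reset at will. -/
inductive Query
  | msg1
  | msg2
  | msg3
  | msg4

namespace Query

def dom : Query → Type
  | msg1 => Empty
  | msg2 => Wires.idx P.Zq (Ch1 P)
  | msg3 => Wires.idx P.Zq (Ch1 P × Ch2 P)
  | msg4 => Wires.idx P.Zq (Ch1 P × Ch2 P × P.Rq)

def cod : Query → Type
  | msg1 => Wires.idx P.Zq (Msg1 P)
  | msg2 => Wires.idx P.Zq (Msg2 P)
  | msg3 => Wires.idx P.Zq (Msg3 P)
  | msg4 => Wires.idx P.Zq (Msg4 P)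

variable {P}

def interp (A : DetProver P) : (g : Query) → (dom P g → P.Zq) → PMF (cod P g → P.Zq)
  | msg1 => fun _ => PMF.pure (Wires.enc A.msg1)
  | msg2 => fun w => PMF.pure (Wires.enc (A.msg2 (Wires.dec w)))
  | msg3 => fun w =>
      let t : Ch1 P × Ch2 P := Wires.dec w
      PMF.pure (Wires.enc (A.msg3 t.1 t.2))
  | msg4 => fun w =>
      let t : Ch1 P × Ch2 P × P.Rq := Wires.dec w
      PMF.pure (Wires.enc (A.msg4 t.1 t.2.1 t.2.2))

end Query

/-- A randomised algorithm with inputs of type `S` and outputs of type `T`. -/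
abbrev Algorithm (S T : Type) [Wires P.Zq S] [Wires P.Zq T] : Type 1 :=
  Circuit (Gate P) Gate.dom Gate.cod (Wires.idx P.Zq S) (Wires.idx P.Zq T)

/-- A randomised algorithm that may also call the prover. -/
abbrev OracleAlgorithm (S T : Type) [Wires P.Zq S] [Wires P.Zq T] : Type 1 :=
  Circuit (Gate P ⊕ Query) (Sum.elim Gate.dom (Query.dom P)) (Sum.elim Gate.cod (Query.cod P))
    (Wires.idx P.Zq S) (Wires.idx P.Zq T)

variable {P} in
def Algorithm.run {S T : Type} [Wires P.Zq S] [Wires P.Zq T] (F : Algorithm P S T) (x : S) :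
    PMF T :=
  (Circuit.eval Gate.interp F (Wires.enc x)).map Wires.dec

variable {P} in
def oracleInterp (A : DetProver P) :
    (g : Gate P ⊕ Query) → (Sum.elim Gate.dom (Query.dom P) g → P.Zq) →
      PMF (Sum.elim Gate.cod (Query.cod P) g → P.Zq)
  | .inl g => Gate.interp g
  | .inr g => Query.interp A g

variable {P} in
def OracleAlgorithm.run {S T : Type} [Wires P.Zq S] [Wires P.Zq T] (F : OracleAlgorithm P S T)
    (A : DetProver P) (x : S) : PMF T :=
  (Circuit.eval (oracleInterp A) F (Wires.enc x)).map Wires.dec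

/-! ### Completeness -/

/-- For all keys and honest inputs the prover does not abort with probability about `1/27`, and
without abort the verifier accepts with overwhelming probability. -/
def IsComplete : Prop :=
  ∀ (x : Stmt P) (hk : AuxKey P) (r : Fin P.n → P.RZ) (v : P.Zq), HonestInput x r v →
    ((1 - 2 ^ (-100 : ℝ)) / 3 : ℝ) ^ 3 ≤ Pr (honestRun x hk r v) {o | o.isSome} ∧
    1 - (2 * 2 ^ (-(P.n * P.d : ℝ) / 8) + 256 * (2 * Real.exp (-P.k)) + 2 ^ (-100 : ℝ))
      ≤ Pr (nonAborting x hk r v) {o | ∃ τ, o = some τ ∧ Accepts x hk τ}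

/-! ### Soundness -/

/-- A witness for the relaxed relation. -/
structure Opening where
  cbar : P.Rq
  r : Fin P.n → P.Rq
  s : Fin P.n → P.Rq
  m1 : P.Rq
  m2 : P.Rq
  m3 : P.Rq

instance : Wires P.Zq (Opening P) :=
  Wires.ofTuple (fun a => (a.cbar, a.r, a.s, a.m1, a.m2, a.m3))
    fun t => ⟨t.1, t.2.1, t.2.2.1, t.2.2.2.1, t.2.2.2.2.1, t.2.2.2.2.2⟩

variable {P}

/-- The proved relation: a weak opening of the additional commitment `f = (f0, f1)` to `(r, m1)`
whose randomness `r` is short and opens the given commitment to `(v, √q v, v)` with `v ∈ ℤ_q`. -/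
structure RelPoC (x : Stmt P) (hk : AuxKey P) (f : Msg1 P) (o : Opening P) : Prop where
  unit : IsUnit o.cbar
  norm_c : l1 o.cbar ≤ 2 * P.ω
  norm_r : norm2 (o.cbar • o.r) ≤ 2 * P.bound12
  norm_s : norm2 (o.cbar • o.s) ≤ 2 * P.bound12
  open_f0 : f.f0 = hk.A1.mulVec o.r + hk.A2.mulVec o.s
  open_f1 : f.f1 = hk.B1 ⬝ᵥ o.s + o.m1
  short : (normInf o.r : ℝ) ≤ 2 * P.bound3
  open_com : x.2 = commit x.1 o.m1 o.m2 o.m3 o.r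
  form : ∃ v : P.Zq, o.m1 = AdjoinRoot.of _ v ∧ o.m2 = (P.sq : P.Rq) * AdjoinRoot.of _ v ∧
    o.m3 = AdjoinRoot.of _ v

/-- The norm bound of the module SIS problem: `8 ω √((𝔰₁√(2(κ+λ+3)d))² + (𝔰₂√(2(κ+λ+3)d))²)`. -/
def msisBound (P : Params) : ℝ := 8 * P.ω * Real.sqrt (P.bound12 ^ 2 + P.bound12 ^ 2)

/-- The probability that the extractor, with oracle access to the prover, outputs a witness or a
solution of module SIS for the matrix `[A1 | A2]`. -/
def extractProb (x : Stmt P) (hk : AuxKey P) (𝒜 : PMF (DetProver P))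
    (Ext : OracleAlgorithm P (Stmt P × AuxKey P) (Opening P × (Fin P.n ⊕ Fin P.n → P.Rq))) : ℝ :=
  Pr (do
    let A ← 𝒜
    let o ← Ext.run A (x, hk)
    return (A.msg1, o))
    {t | RelPoC x hk t.1 t.2.1 ∨
      IsMSISSolution (Matrix.fromCols hk.A1 hk.A2) (msisBound P) t.2.2}

variable (P)

/-- Knowledge soundness with knowledge error `K l / q^(d/l) + 1/q + 2^(-256)`, up to module SIS.
The extractor has at most `a N^a` gates and oracle calls, where `N` is the security parameter, and
its success probability is at least `(ε - err)^D / (a N^a)` if the prover succeeds with probability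
`ε > err`. Here `K` is any constant with `(q M)^(d/l) ≤ K Pr[‖c‖₁ ≤ ω]`. -/
def IsKnowledgeSound (D a : ℕ) : Prop :=
  ∃ Ext : OracleAlgorithm P (Stmt P × AuxKey P) (Opening P × (Fin P.n ⊕ Fin P.n → P.Rq)),
    Ext.size ≤ a * P.secPar ^ a ∧
    ∀ (x : Stmt P) (hk : AuxKey P) (𝒜 : PMF (DetProver P)) (K err : ℝ),
      (P.q * P.maxProb) ^ (P.d / P.l) ≤ K * Pr P.ternaryPoly {c | l1Z c ≤ P.ω} →
      err = K * (P.l / (P.q : ℝ) ^ (P.d / P.l)) + 1 / P.q + 1 / 2 ^ 256 →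
      err < acceptProb x hk 𝒜 →
      (acceptProb x hk 𝒜 - err) ^ D ≤ a * P.secPar ^ a * extractProb x hk 𝒜 Ext

/-! ### Honest-verifier zero-knowledge -/

/-- The rows of the matrices `A2, B1, Bc, Bc'`, stacked. -/
abbrev HideRows : Type := Fin P.κ ⊕ Unit ⊕ Fin P.δ ⊕ Unit

variable {P}

def auxKey (A1 : Matrix (Fin P.κ) (Fin P.n) P.Rq) (G : Matrix (HideRows P) (Fin P.n) P.Rq) :
    AuxKey P where
  A1 := A1
  A2 := Matrix.of fun i => G (.inl i)
  B1 := G (.inr (.inl ()))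
  Bc := Matrix.of fun i => G (.inr (.inr (.inl i)))
  Bc' := G (.inr (.inr (.inr ())))

variable (P)

/-- Honest-verifier zero-knowledge: there are a simulator and a reduction with at most `a N^a` gates
such that for every distinguisher the advantage in telling the non-aborting honest transcript from
the simulated one exceeds the advantage of (reduction followed by distinguisher) in dual module LWE
with the uniform matrix `[A2; B1; Bc; Bc']` by at most `2^(-100)`. -/
def IsHVZK (a : ℕ) : Prop :=
  ∃ (Sim : Algorithm P (Stmt P × AuxKey P) (Transcript P))
    (Red : Algorithm P
      ((Stmt P × AuxKey P) × ((Fin P.n → P.Rq) × P.Zq) × (HideRows P → P.Rq)) (Transcript P)),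
    Sim.size ≤ a * P.secPar ^ a ∧ Red.size ≤ a * P.secPar ^ a ∧
    ∀ (x : Stmt P) (r : Fin P.n → P.RZ) (v : P.Zq), HonestInput x r v →
    ∀ (A1 : Matrix (Fin P.κ) (Fin P.n) P.Rq)
      (Dist : AuxKey P → Transcript P → PMF Bool),
      |Pr ((iid (HideRows P) (iid (Fin P.n) (unifRq P))).bind fun G =>
            (nonAborting x (auxKey A1 (Matrix.of G)) r v).bind fun o =>
              o.elim (PMF.pure false) (Dist (auxKey A1 (Matrix.of G)))) {true}
        - Pr ((iid (HideRows P) (iid (Fin P.n) (unifRq P))).bind fun G =>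
            (Sim.run (x, auxKey A1 (Matrix.of G))).bind
              (Dist (auxKey A1 (Matrix.of G)))) {true}|
      ≤ dualMLWEAdv P (HideRows P) P.n (fun G t =>
            (Red.run ((x, auxKey A1 G), (redV r, v), t)).bind (Dist (auxKey A1 G)))
          + 2 ^ (-100 : ℝ)

end

end PoC

namespace PoC
noncomputable section

/-! ### Expectations -/

open ENNReal

/-- The expectation of a nonnegative function. -/
def ex {α : Type} (μ : PMF α) (f : α → ℝ≥0∞) : ℝ≥0∞ := ∑' a, μ a * f a

section Expectation

variable {α β γ : Type}

theorem ex_pure (a : α) (f : α → ℝ≥0∞) : ex (PMF.pure a) f = f a := by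
  rw [ex, tsum_eq_single a]
  · simp
  · intro b hb
    simp [hb]

theorem ex_bind (μ : PMF α) (ν : α → PMF β) (f : β → ℝ≥0∞) :
    ex (μ.bind ν) f = ex μ fun a => ex (ν a) f := by
  simp only [ex, PMF.bind_apply, ← ENNReal.tsum_mul_right, ← ENNReal.tsum_mul_left]
  rw [ENNReal.tsum_comm]
  simp only [mul_assoc]

theorem ex_map (μ : PMF α) (g : α → β) (f : β → ℝ≥0∞) : ex (μ.map g) f = ex μ fun a => f (g a) := by
  rw [← PMF.bind_pure_comp, ex_bind]
  simp only [Function.comp, ex_pure]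

theorem ex_mono_support {μ : PMF α} {f g : α → ℝ≥0∞} (h : ∀ a ∈ μ.support, f a ≤ g a) :
    ex μ f ≤ ex μ g := by
  refine ENNReal.tsum_le_tsum fun a => ?_
  by_cases ha : μ a = 0
  · simp [ha]
  · gcongr
    exact h a ha

theorem ex_mono {μ : PMF α} {f g : α → ℝ≥0∞} (h : ∀ a, f a ≤ g a) : ex μ f ≤ ex μ g :=
  ex_mono_support fun a _ => h a

theorem ex_congr_support {μ : PMF α} {f g : α → ℝ≥0∞} (h : ∀ a ∈ μ.support, f a = g a) :
    ex μ f = ex μ g :=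
  le_antisymm (ex_mono_support fun a ha => (h a ha).le) (ex_mono_support fun a ha => (h a ha).ge)

theorem ex_const (μ : PMF α) (c : ℝ≥0∞) : ex μ (fun _ => c) = c := by
  rw [ex, ENNReal.tsum_mul_right, PMF.tsum_coe, one_mul]

theorem ex_le_const {μ : PMF α} {f : α → ℝ≥0∞} {c : ℝ≥0∞} (h : ∀ a, f a ≤ c) : ex μ f ≤ c :=
  (ex_mono h).trans (ex_const μ c).le

theorem ex_le_const_support {μ : PMF α} {f : α → ℝ≥0∞} {c : ℝ≥0∞} (h : ∀ a ∈ μ.support, f a ≤ c) :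
    ex μ f ≤ c :=
  (ex_mono_support h).trans (ex_const μ c).le

theorem const_le_ex_support {μ : PMF α} {f : α → ℝ≥0∞} {c : ℝ≥0∞} (h : ∀ a ∈ μ.support, c ≤ f a) :
    c ≤ ex μ f :=
  (ex_const μ c).ge.trans (ex_mono_support h)

theorem ex_const_mul (μ : PMF α) (c : ℝ≥0∞) (f : α → ℝ≥0∞) :
    ex μ (fun a => c * f a) = c * ex μ f := by
  simp only [ex, ← ENNReal.tsum_mul_left]
  exact tsum_congr fun a => by ring

theorem ex_mul_const (μ : PMF α) (c : ℝ≥0∞) (f : α → ℝ≥0∞) :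
    ex μ (fun a => f a * c) = ex μ f * c := by
  simp only [mul_comm _ c, ex_const_mul]

theorem ex_add (μ : PMF α) (f g : α → ℝ≥0∞) : ex μ (fun a => f a + g a) = ex μ f + ex μ g := by
  simp only [ex, mul_add, ENNReal.tsum_add]

theorem ex_comm (μ : PMF α) (ν : PMF β) (f : α → β → ℝ≥0∞) :
    (ex μ fun a => ex ν fun b => f a b) = ex ν fun b => ex μ fun a => f a b := by
  simp only [ex, ← ENNReal.tsum_mul_left]
  rw [ENNReal.tsum_comm]
  exact tsum_congr fun b => tsum_congr fun a => by ring

theorem ex_finset_sum (μ : PMF α) {ι : Type} (s : Finset ι) (f : ι → α → ℝ≥0∞) :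
    ex μ (fun a => ∑ i ∈ s, f i a) = ∑ i ∈ s, ex μ (f i) := by
  classical
  induction s using Finset.induction_on with
  | empty => simp [ex_const]
  | insert i s hi ih => simp only [Finset.sum_insert hi, ex_add, ih]

theorem two_mul_mul_le_sq_add_sq {x c : ℝ≥0∞} (hx : x ≠ ⊤) (hc : c ≠ ⊤) :
    2 * c * x ≤ x ^ 2 + c ^ 2 := by
  lift c to NNReal using hc
  lift x to NNReal using hx
  norm_cast
  calc 2 * c * x = 2 * x * c := by ring
    _ ≤ _ := two_mul_le_add_sq x c

/-- The expectation of the square is at least the square of the expectation. -/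
theorem ex_sq_le {μ : PMF α} {f : α → ℝ≥0∞} (hf : ∀ a, f a ≤ 1) :
    ex μ f ^ 2 ≤ ex μ fun a => f a ^ 2 := by
  set c := ex μ f with hc
  have hc1 : c ≤ 1 := ex_le_const hf
  have hct : c ≠ ⊤ := ne_top_of_le_ne_top one_ne_top hc1
  have key : ∀ a, 2 * c * f a ≤ f a ^ 2 + c ^ 2 := fun a =>
    two_mul_mul_le_sq_add_sq (ne_top_of_le_ne_top one_ne_top (hf a)) hct
  have h := ex_mono (μ := μ) key
  rw [ex_const_mul, ex_add, ex_const, ← hc] at h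
  have h2 : c ^ 2 + c ^ 2 ≤ ex μ (fun a => f a ^ 2) + c ^ 2 := by
    calc c ^ 2 + c ^ 2 = 2 * c * c := by ring
      _ ≤ _ := h
  exact (ENNReal.add_le_add_iff_right (by finiteness)).1 h2

open Classical in
theorem Pr_eq_ex (μ : PMF α) (s : Set α) : Pr μ s = (ex μ fun a => if a ∈ s then 1 else 0).toReal := by
  rw [Pr, PMF.toOuterMeasure_apply, ex]
  congr 1
  refine tsum_congr fun a => ?_
  by_cases h : a ∈ s <;> simp [h]

theorem Pr_nonneg (μ : PMF α) (s : Set α) : 0 ≤ Pr μ s := ENNReal.toReal_nonneg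

open Classical in
theorem ex_indicator_le_one (μ : PMF α) (s : Set α) : (ex μ fun a => if a ∈ s then 1 else 0) ≤ 1 :=
  ex_le_const fun a => by split_ifs <;> simp

open Classical in
theorem ofReal_Pr (μ : PMF α) (s : Set α) :
    ENNReal.ofReal (Pr μ s) = ex μ fun a => if a ∈ s then 1 else 0 := by
  rw [Pr_eq_ex, ENNReal.ofReal_toReal]
  exact ne_top_of_le_ne_top one_ne_top (ex_indicator_le_one μ s)

theorem Pr_le_one (μ : PMF α) (s : Set α) : Pr μ s ≤ 1 := by
  classical
  rw [Pr_eq_ex]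
  exact ENNReal.toReal_mono one_ne_top (ex_indicator_le_one μ s) |>.trans (by simp)

open Classical in
theorem Pr_add_compl (μ : PMF α) (s : Set α) : Pr μ s + Pr μ sᶜ = 1 := by
  rw [Pr_eq_ex, Pr_eq_ex, ← ENNReal.toReal_add, ← ex_add]
  · rw [ex_congr_support (g := fun _ => 1), ex_const, ENNReal.toReal_one]
    intro a _
    by_cases h : a ∈ s <;> simp [h]
  · exact ne_top_of_le_ne_top one_ne_top (ex_indicator_le_one μ s)
  · exact ne_top_of_le_ne_top one_ne_top (ex_indicator_le_one μ sᶜ)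

/-- A PMF is determined by the expectations of all functions. -/
theorem pmf_ext_ex {μ ν : PMF α} (h : ∀ f, ex μ f = ex ν f) : μ = ν := by
  classical
  ext a
  have := h fun b => if b = a then 1 else 0
  simpa [ex] using this

open Classical in
theorem ex_condOn_le (μ : PMF α) (s : Set α) (f : α → ℝ≥0∞) (h : ∃ a ∈ s, a ∈ μ.support) :
    ex (condOn μ s) f * (ex μ fun a => if a ∈ s then 1 else 0)
      = ex μ fun a => if a ∈ s then f a else 0 := by
  rw [condOn, dif_pos h]
  have hs : (ex μ fun a => if a ∈ s then 1 else 0) = ∑' a, s.indicator μ a := by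
    refine tsum_congr fun a => ?_
    by_cases h : a ∈ s <;> simp [h]
  have h0 : (∑' a, s.indicator μ a) ≠ 0 := by
    obtain ⟨a, ha, ha'⟩ := h
    intro h0
    have := ENNReal.tsum_eq_zero.1 h0 a
    simp only [ha, Set.indicator_of_mem] at this
    exact ha' this
  rw [hs]
  simp only [ex, PMF.filter_apply, ← ENNReal.tsum_mul_right]
  refine tsum_congr fun a => ?_
  by_cases ha : a ∈ s
  · simp only [ha, Set.indicator_of_mem, if_true]
    rw [mul_right_comm, mul_assoc (μ a), ENNReal.inv_mul_cancel h0 (μ.tsum_coe_indicator_ne_top s),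
      mul_one]
  · simp [ha]

theorem ex_coin (t : ℝ) (f : Bool → ℝ≥0∞) :
    ex (coin t) f = min 1 (ENNReal.ofReal t) * f true + (1 - min 1 (ENNReal.ofReal t)) * f false := by
  rw [ex, tsum_fintype]
  simp [coin]

theorem ex_uniform [Fintype α] [Nonempty α] (f : α → ℝ≥0∞) :
    ex (PMF.uniformOfFintype α) f = (∑ a, f a) / Fintype.card α := by
  rw [ex, tsum_fintype]
  simp only [PMF.uniformOfFintype_apply, ← Finset.mul_sum]
  rw [mul_comm, div_eq_mul_inv]

theorem ex_ternary {p : ℝ} (hp : 0 ≤ p) (hp1 : p ≤ 1) (f : ℤ → ℝ≥0∞) :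
    ex (ternary p) f = ENNReal.ofReal p * f 0 + ENNReal.ofReal ((1 - p) / 2) * f 1
      + ENNReal.ofReal ((1 - p) / 2) * f (-1) := by
  have h1 : min 1 (ENNReal.ofReal p) = ENNReal.ofReal p :=
    min_eq_right (ENNReal.ofReal_le_one.2 hp1)
  have h2 : min 1 (ENNReal.ofReal (1 / 2)) = ENNReal.ofReal (1 / 2) :=
    min_eq_right (ENNReal.ofReal_le_one.2 (by norm_num))
  have h3 : 1 - ENNReal.ofReal p = ENNReal.ofReal (1 - p) := by
    rw [ENNReal.ofReal_sub _ hp, ENNReal.ofReal_one]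
  have h4 : 1 - ENNReal.ofReal (1 / 2) = ENNReal.ofReal (1 / 2) := by
    rw [← ENNReal.ofReal_one, ← ENNReal.ofReal_sub _ (by norm_num)]
    norm_num
  have h5 : ENNReal.ofReal ((1 - p) / 2) = ENNReal.ofReal (1 - p) * ENNReal.ofReal (1 / 2) := by
    rw [← ENNReal.ofReal_mul (by linarith)]
    congr 1
    ring
  rw [ternary, ex_bind, ex_coin, h1, h3]
  simp only [if_true, Bool.false_eq_true, if_false, ex_pure, ex_bind]
  rw [ex_coin, h2, h4, h5]
  simp only [if_true, Bool.false_eq_true, if_false]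
  ring

end Expectation

/-! ### Independent samples -/

section Independent

variable {α β : Type}

theorem ex_iidFin_succ (μ : PMF α) (n : ℕ) (f : (Fin (n + 1) → α) → ℝ≥0∞) :
    ex (iidFin μ (n + 1)) f = ex μ fun a => ex (iidFin μ n) fun v => f (Fin.cons a v) := by
  simp only [iidFin, ex_bind, ex_pure]

theorem iidFin_apply (μ : PMF α) (n : ℕ) (v : Fin n → α) : iidFin μ n v = ∏ i, μ (v i) := by
  classical
  induction n with
  | zero =>
    have : v = Fin.elim0 := Subsingleton.elim _ _
    subst this
    simp [iidFin]
  | succ n ih =>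
    rw [iidFin, PMF.bind_apply, tsum_eq_single (v 0), Fin.prod_univ_succ]
    · congr 1
      rw [PMF.bind_apply, tsum_eq_single (Fin.tail v), ih]
      · simp [Fin.tail]
      · intro w hw
        have : v ≠ Fin.cons (v 0) w := by
          intro h
          apply hw
          rw [h, Fin.tail_cons]
        simp [this]
    · intro a ha
      have : ∀ w, v ≠ Fin.cons a w := by
        intro w h
        apply ha
        rw [h, Fin.cons_zero]
      simp [PMF.bind_apply, this]

theorem iid_apply {ι : Type} [Fintype ι] (μ : PMF α) (v : ι → α) : iid ι μ v = ∏ i, μ (v i) := by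
  classical
  rw [iid, PMF.map_apply, tsum_eq_single (v ∘ (Fintype.equivFin ι).symm)]
  · rw [if_pos (by ext; simp), iidFin_apply]
    exact Fintype.prod_equiv (Fintype.equivFin ι).symm _ _ fun i => rfl
  · intro w hw
    rw [if_neg]
    rintro rfl
    apply hw
    ext i
    simp

theorem ex_iidFin_prod (μ : PMF α) (n : ℕ) (f : Fin n → α → ℝ≥0∞) :
    ex (iidFin μ n) (fun v => ∏ i, f i (v i)) = ∏ i, ex μ (f i) := by
  induction n with
  | zero => simp [iidFin, ex_pure]
  | succ n ih =>
    rw [ex_iidFin_succ, Fin.prod_univ_succ]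
    simp only [Fin.prod_univ_succ, Fin.cons_zero, Fin.cons_succ, ex_const_mul, ih, ex_mul_const]

theorem ex_iid_prod {ι : Type} [Fintype ι] (μ : PMF α) (f : ι → α → ℝ≥0∞) :
    ex (iid ι μ) (fun v => ∏ i, f i (v i)) = ∏ i, ex μ (f i) := by
  rw [iid, ex_map]
  have : ∀ v : Fin (Fintype.card ι) → α, ∏ i, f i (v (Fintype.equivFin ι i))
      = ∏ j, f ((Fintype.equivFin ι).symm j) (v j) := fun v =>
    Fintype.prod_equiv (Fintype.equivFin ι) _ _ fun i => by simp
  simp only [this, ex_iidFin_prod]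
  exact Fintype.prod_equiv (Fintype.equivFin ι).symm _ _ fun i => rfl

theorem iidFin_map (μ : PMF α) (g : α → β) (n : ℕ) :
    (iidFin μ n).map (fun v i => g (v i)) = iidFin (μ.map g) n := by
  induction n with
  | zero =>
    simp only [iidFin, PMF.pure_map]
    congr 1
    exact Subsingleton.elim _ _
  | succ n ih =>
    refine pmf_ext_ex fun f => ?_
    rw [ex_map, ex_iidFin_succ, ex_iidFin_succ, ex_map]
    congr 1
    ext a
    rw [← ih, ex_map]
    congr 1
    ext v
    congr 1
    ext i
    refine Fin.cases ?_ (fun i => ?_) i <;> simp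

theorem iid_map {ι : Type} [Fintype ι] (μ : PMF α) (g : α → β) :
    (iid ι μ).map (fun v i => g (v i)) = iid ι (μ.map g) := by
  rw [iid, iid, PMF.map_comp, ← iidFin_map, PMF.map_comp]
  rfl

theorem mem_support_iid {ι : Type} [Fintype ι] {μ : PMF α} {v : ι → α} :
    v ∈ (iid ι μ).support ↔ ∀ i, v i ∈ μ.support := by
  rw [PMF.mem_support_iff, iid_apply, Finset.prod_ne_zero_iff]
  simp [PMF.mem_support_iff]

theorem ex_iidFin_resample (μ : PMF α) (n : ℕ) (i : Fin n) (f : (Fin n → α) → ℝ≥0∞) :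
    ex (iidFin μ n) f = ex (iidFin μ n) fun v => ex μ fun a => f (Function.update v i a) := by
  induction n with
  | zero => exact i.elim0
  | succ n ih =>
    simp only [ex_iidFin_succ]
    refine Fin.cases ?_ (fun i => ?_) i
    · simp only [Fin.update_cons_zero, ex_const]
      rw [ex_comm]
    · simp only [← Fin.cons_update]
      congr 1
      ext a
      exact ih i _

open Classical in
/-- A coordinate may be sampled afresh. -/
theorem ex_iid_resample {ι : Type} [Fintype ι] (μ : PMF α) (i : ι) (f : (ι → α) → ℝ≥0∞) :
    ex (iid ι μ) f = ex (iid ι μ) fun v => ex μ fun a => f (Function.update v i a) := by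
  rw [iid, ex_map, ex_map, ex_iidFin_resample μ _ (Fintype.equivFin ι i)]
  congr 1
  ext v
  congr 1
  ext a
  congr 1
  ext j
  by_cases h : j = i
  · subst h
    simp
  · rw [Function.update_of_ne h, Function.update_of_ne fun h' => h ((Fintype.equivFin ι).injective h')]

open Classical in
/-- A bound that holds conditionally on all coordinates but one holds. -/
theorem ex_iid_le {ι : Type} [Fintype ι] {μ : PMF α} (i : ι) {f : (ι → α) → ℝ≥0∞} {c : ℝ≥0∞}
    (h : ∀ v, (ex μ fun a => f (Function.update v i a)) ≤ c) : ex (iid ι μ) f ≤ c := by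
  rw [ex_iid_resample μ i]
  exact ex_le_const h

theorem iid_comp_equiv {ι κ : Type} [Fintype ι] [Fintype κ] (e : κ ≃ ι) (μ : PMF α) :
    (iid ι μ).map (fun v k => v (e k)) = iid κ μ := by
  classical
  ext w
  rw [PMF.map_apply, tsum_eq_single fun i => w (e.symm i), if_pos (by ext; simp), iid_apply,
    iid_apply]
  · exact Fintype.prod_equiv e.symm _ _ fun i => rfl
  · intro v hv
    rw [if_neg]
    rintro rfl
    apply hv
    ext i
    simp

theorem iid_uncurry {ι κ : Type} [Fintype ι] [Fintype κ] (μ : PMF α) :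
    (iid ι (iid κ μ)).map (fun v (x : ι × κ) => v x.1 x.2) = iid (ι × κ) μ := by
  classical
  ext w
  rw [PMF.map_apply, tsum_eq_single fun i k => w (i, k), if_pos rfl, iid_apply, iid_apply,
    Fintype.prod_prod_type]
  · simp only [iid_apply]
  · intro v hv
    rw [if_neg]
    rintro rfl
    exact hv rfl

end Independent

end

end PoC

namespace PoC
noncomputable section

set_option linter.unusedSectionVars false

/-! ### Coefficients -/

section Coefficients

variable {R : Type} [CommRing R] {d : ℕ} [NeZero d]

theorem degree_cyc [Nontrivial R] : (X ^ d + 1 : R[X]).degree = d := by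
  simpa using degree_X_pow_add_C (Nat.pos_of_ne_zero (NeZero.ne d)) (1 : R)

theorem coeff_mk_of_degree_lt {p : R[X]} (hp : p.degree < d) (i : Fin d) :
    coeff (AdjoinRoot.mk (X ^ d + 1 : R[X]) p) i = p.coeff i := by
  nontriviality R
  rw [coeff, AdjoinRoot.modByMonicHom_mk, (modByMonic_eq_self_iff cyc_monic).2]
  rwa [degree_cyc]

theorem degree_sum_lt (f : Fin d → R) : (∑ i, C (f i) * X ^ (i : ℕ) : R[X]).degree < d := by
  refine (degree_sum_le _ _).trans_lt ((Finset.sup_lt_iff ?_).2 fun i _ => ?_)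
  · exact_mod_cast WithBot.bot_lt_coe d
  · exact (degree_C_mul_X_pow_le _ _).trans_lt (by exact_mod_cast i.2)

theorem coeff_ofCoeffs (f : Fin d → R) : coeff (ofCoeffs f) = f := by
  ext i
  rw [ofCoeffs, coeff_mk_of_degree_lt (degree_sum_lt f)]
  simp [finsetSum_coeff, coeff_X_pow, Fin.val_inj]

theorem exists_mk_degree_lt (a : Cyc R d) :
    ∃ p : R[X], p.degree < d ∧ AdjoinRoot.mk (X ^ d + 1 : R[X]) p = a := by
  refine ⟨AdjoinRoot.modByMonicHom cyc_monic a, ?_, AdjoinRoot.mk_leftInverse cyc_monic a⟩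
  rcases subsingleton_or_nontrivial R with h | h
  · rw [Subsingleton.elim (AdjoinRoot.modByMonicHom cyc_monic a) 0, degree_zero]
    exact WithBot.bot_lt_coe d
  · obtain ⟨p, rfl⟩ := AdjoinRoot.mk_surjective a
    rw [AdjoinRoot.modByMonicHom_mk]
    simpa [degree_cyc] using degree_modByMonic_lt p (cyc_monic (R := R) (d := d))

theorem ofCoeffs_coeff (a : Cyc R d) : ofCoeffs (coeff a) = a := by
  obtain ⟨p, hp, rfl⟩ := exists_mk_degree_lt a
  rw [ofCoeffs]
  congr 1
  ext i
  simp only [finsetSum_coeff, coeff_C_mul, coeff_X_pow, mul_ite, mul_one, mul_zero]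
  by_cases hi : i < d
  · rw [Finset.sum_eq_single ⟨i, hi⟩]
    · simp [coeff_mk_of_degree_lt hp]
    · intro j _ hj
      rw [if_neg]
      rintro rfl
      exact hj rfl
    · simp
  · rw [coeff_eq_zero_of_degree_lt (hp.trans_le (by exact_mod_cast not_lt.1 hi))]
    refine Finset.sum_eq_zero fun j _ => if_neg ?_
    have := j.2
    omega

/-- Ring elements and coefficient vectors. -/
def coeffEquiv : Cyc R d ≃ (Fin d → R) := ⟨coeff, ofCoeffs, ofCoeffs_coeff, coeff_ofCoeffs⟩

theorem coeff_injective : Function.Injective (coeff : Cyc R d → Fin d → R) :=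
  (coeffEquiv (R := R) (d := d)).injective

/-- The coefficients as a linear map. -/
def coeffHom : Cyc R d →ₗ[R] (Fin d → R) where
  toFun := coeff
  map_add' a b := by ext i; simp [coeff]
  map_smul' c a := by ext i; simp [coeff]

theorem coeff_add (a b : Cyc R d) : coeff (a + b) = coeff a + coeff b := map_add coeffHom a b

theorem coeff_sub (a b : Cyc R d) : coeff (a - b) = coeff a - coeff b := map_sub coeffHom a b

theorem coeff_neg (a : Cyc R d) : coeff (-a) = -coeff a := map_neg coeffHom a

theorem coeff_zero : coeff (0 : Cyc R d) = 0 := map_zero coeffHom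

theorem coeff_smul (c : R) (a : Cyc R d) : coeff (c • a) = c • coeff a := map_smul coeffHom c a

theorem coeff_sum {ι : Type} (s : Finset ι) (f : ι → Cyc R d) :
    coeff (∑ i ∈ s, f i) = ∑ i ∈ s, coeff (f i) := map_sum coeffHom f s

theorem smul_eq_of_mul (c : R) (a : Cyc R d) : c • a = AdjoinRoot.of _ c * a := by
  rw [Algebra.smul_def, AdjoinRoot.algebraMap_eq]

theorem ofCoeffs_eq_sum (f : Fin d → R) : (ofCoeffs f : Cyc R d) = ∑ i, f i • xbar ^ (i : ℕ) := by
  simp [ofCoeffs, smul_eq_of_mul, xbar]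

theorem eq_sum_coeff (a : Cyc R d) : a = ∑ i, coeff a i • xbar ^ (i : ℕ) := by
  rw [← ofCoeffs_eq_sum, ofCoeffs_coeff]

theorem coeff_xbar_pow (i j : Fin d) : coeff (xbar ^ (i : ℕ) : Cyc R d) j = if j = i then 1 else 0 := by
  have : (xbar ^ (i : ℕ) : Cyc R d) = ofCoeffs (Pi.single i 1) := by
    rw [ofCoeffs_eq_sum, Finset.sum_eq_single i]
    · simp
    · intro j _ hj
      simp [hj]
    · simp
  rw [this, coeff_ofCoeffs, Pi.single_apply]

theorem coeff_of (v : R) (j : Fin d) :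
    coeff (AdjoinRoot.of (X ^ d + 1 : R[X]) v) j = if j = 0 then v else 0 := by
  have : AdjoinRoot.of (X ^ d + 1 : R[X]) v = v • (xbar : Cyc R d) ^ ((0 : Fin d) : ℕ) := by
    simp [smul_eq_of_mul]
  rw [this, coeff_smul, Pi.smul_apply, coeff_xbar_pow]
  simp

theorem eq_of_iff (a : Cyc R d) :
    (∃ v, a = AdjoinRoot.of (X ^ d + 1 : R[X]) v) ↔ ∀ j, j ≠ 0 → coeff a j = 0 := by
  constructor
  · rintro ⟨v, rfl⟩ j hj
    rw [coeff_of, if_neg hj]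
  · intro h
    refine ⟨coeff a 0, coeff_injective (funext fun j => ?_)⟩
    rw [coeff_of]
    split_ifs with hj
    · rw [hj]
    · exact h j hj

theorem coeff_mul (a b : Cyc R d) (k : Fin d) : coeff (a * b) k =
    ∑ i, ∑ j, coeff a i * coeff b j * coeff (xbar ^ ((i : ℕ) + j) : Cyc R d) k := by
  conv_lhs => rw [eq_sum_coeff a, eq_sum_coeff b, Finset.sum_mul_sum]
  simp only [coeff_sum, Finset.sum_apply, smul_mul_smul_comm, ← pow_add, coeff_smul, Pi.smul_apply,
    smul_eq_mul]

end Coefficients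

/-! ### The automorphism `σ₋₁` -/

section Sigma

variable {R : Type} [CommRing R] {d : ℕ} [NeZero d]

theorem sigma_of (v : R) : sigma (AdjoinRoot.of (X ^ d + 1 : R[X]) v) = AdjoinRoot.of _ v := by
  rw [sigma, AdjoinRoot.lift_of]

theorem sigma_smul (c : R) (a : Cyc R d) : sigma (c • a) = c • sigma a := by
  rw [smul_eq_of_mul, map_mul, sigma_of, ← smul_eq_of_mul]

theorem sigma_xbar_mul : sigma (xbar : Cyc R d) * xbar = 1 := by
  have h : sigma (xbar : Cyc R d) = -xbar ^ (d - 1) := AdjoinRoot.lift_root _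
  rw [h, neg_mul, ← pow_succ, Nat.sub_add_cancel (Nat.pos_of_ne_zero (NeZero.ne d)), xbar_pow,
    neg_neg]

theorem sigma_xbar_pow_mul (k : ℕ) : sigma (xbar ^ k : Cyc R d) * xbar ^ k = 1 := by
  rw [map_pow, ← mul_pow, sigma_xbar_mul, one_pow]

theorem sigma_xbar_pow {k : ℕ} (hk : k ≤ d) :
    sigma (xbar ^ k : Cyc R d) = -xbar ^ (d - k) := by
  have h : (xbar : Cyc R d) ^ k * xbar ^ (d - k) = -1 := by
    rw [← pow_add, Nat.add_sub_cancel' hk, xbar_pow]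
  calc sigma (xbar ^ k : Cyc R d) = -(sigma (xbar ^ k : Cyc R d) * (xbar ^ k * xbar ^ (d - k))) := by
        rw [h]; ring
    _ = -xbar ^ (d - k) := by rw [← mul_assoc, sigma_xbar_pow_mul, one_mul]

theorem coeff_zero_xbar_pow {k : ℕ} (hk : 0 < k) (hk' : k < d) :
    coeff (xbar ^ k : Cyc R d) 0 = 0 := by
  have := coeff_xbar_pow (R := R) (⟨k, hk'⟩ : Fin d) 0
  rw [this, if_neg]
  intro h
  have := congrArg Fin.val h
  simp at this
  omega

theorem coeff_zero_sigma_xbar (i j : Fin d) :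
    coeff (sigma (xbar ^ (i : ℕ) : Cyc R d) * xbar ^ (j : ℕ)) 0 = if i = j then 1 else 0 := by
  rcases lt_trichotomy i j with h | rfl | h
  · rw [if_neg h.ne]
    have hij : (i : ℕ) < j := h
    have : (j : ℕ) = i + (j - i) := by omega
    rw [this, pow_add, ← mul_assoc, sigma_xbar_pow_mul, one_mul]
    exact coeff_zero_xbar_pow (by omega) (by omega)
  · rw [sigma_xbar_pow_mul, if_pos rfl]
    have := coeff_xbar_pow (R := R) (0 : Fin d) 0
    simpa using this
  · rw [if_neg h.ne']
    have hij : (j : ℕ) < i := h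
    have : (i : ℕ) = (i - j) + j := by omega
    rw [this, pow_add, map_mul, mul_assoc, sigma_xbar_pow_mul, mul_one, sigma_xbar_pow (by omega),
      coeff_neg, Pi.neg_apply, coeff_zero_xbar_pow (by omega) (by omega), neg_zero]

/-- The constant coefficient of `σ₋₁(u) v` is the inner product of the coefficient vectors. -/
theorem coeff_zero_sigma_mul (u v : Cyc R d) :
    coeff (sigma u * v) 0 = ∑ j, coeff u j * coeff v j := by
  conv_lhs => rw [eq_sum_coeff u, eq_sum_coeff v, map_sum, Finset.sum_mul_sum]
  simp only [coeff_sum, Finset.sum_apply, sigma_smul, smul_mul_smul_comm, coeff_smul, Pi.smul_apply,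
    coeff_zero_sigma_xbar, smul_eq_mul]
  simp

theorem coeff_zero_dotSigma {ι : Type} [Fintype ι] (u v : ι → Cyc R d) :
    coeff (dotSigma u v) 0 = ∑ i, ∑ j, coeff (u i) j * coeff (v i) j := by
  simp only [dotSigma, coeff_sum, Finset.sum_apply, coeff_zero_sigma_mul]

theorem sum_coeff_xbar_pow_mul_sq (k : ℕ) (a : Cyc R d) :
    ∑ j, coeff (xbar ^ k * a) j * coeff (xbar ^ k * a) j = ∑ j, coeff a j * coeff a j := by
  rw [← coeff_zero_sigma_mul, ← coeff_zero_sigma_mul, map_mul, mul_mul_mul_comm, sigma_xbar_pow_mul,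
    one_mul]

end Sigma

/-! ### Reduction modulo `q` -/

section Reduction

variable {d : ℕ} [NeZero d] {q : ℕ}

theorem red_smul (c : ℤ) (a : Cyc ℤ d) : red q (c • a) = (c : ZMod q) • red q a := by
  rw [smul_eq_of_mul, smul_eq_of_mul, map_mul, red, AdjoinRoot.map_of]
  rfl

theorem red_xbar : red q (xbar : Cyc ℤ d) = xbar := AdjoinRoot.map_root _ _ _ _

theorem red_ofCoeffs (f : Fin d → ℤ) : red q (ofCoeffs f) = ofCoeffs fun i => (f i : ZMod q) := by
  simp only [ofCoeffs_eq_sum, map_sum, map_pow, red_smul, red_xbar]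

theorem coeff_red (a : Cyc ℤ d) (i : Fin d) : coeff (red q a) i = ((coeff a i : ℤ) : ZMod q) := by
  have h : red q a = ofCoeffs fun i => ((coeff a i : ℤ) : ZMod q) := by
    rw [← red_ofCoeffs, ofCoeffs_coeff]
  rw [h, coeff_ofCoeffs]

/-- The lift with coefficients in `(-q/2, q/2]`. -/
def lift (a : Cyc (ZMod q) d) : Cyc ℤ d := ofCoeffs fun i => (coeff a i).valMinAbs

theorem coeff_lift (a : Cyc (ZMod q) d) (i : Fin d) : coeff (lift a) i = (coeff a i).valMinAbs := by
  rw [lift, coeff_ofCoeffs]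

theorem red_lift (a : Cyc (ZMod q) d) : red q (lift a) = a := by
  refine coeff_injective (funext fun i => ?_)
  rw [coeff_red, coeff_lift, ZMod.coe_valMinAbs]

end Reduction

/-! ### Norms -/

section Norms

variable {d : ℕ} [NeZero d] {q : ℕ} {ι : Type} [Fintype ι]

theorem innerZ_self_nonneg (u : ι → Cyc ℤ d) : 0 ≤ innerZ u u :=
  Finset.sum_nonneg fun _ _ => Finset.sum_nonneg fun _ _ => mul_self_nonneg _

theorem sum_coeff_mul_sq_le (c a : Cyc ℤ d) :
    ∑ j, coeff (c * a) j * coeff (c * a) j ≤ (l1Z c : ℤ) ^ 2 * ∑ j, coeff a j * coeff a j := by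
  have h1 : ∀ k, coeff (c * a) k = ∑ i : Fin d, coeff c i * coeff (xbar ^ (i : ℕ) * a) k := by
    intro k
    conv_lhs => rw [eq_sum_coeff c, Finset.sum_mul]
    simp only [coeff_sum, Finset.sum_apply, smul_mul_assoc, coeff_smul, Pi.smul_apply, smul_eq_mul]
  have h2 : ∀ k, coeff (c * a) k ^ 2
      ≤ (∑ i, |coeff c i|) * ∑ i : Fin d, |coeff c i| * coeff (xbar ^ (i : ℕ) * a) k ^ 2 := by
    intro k
    rw [h1]
    refine Finset.sum_sq_le_sum_mul_sum_of_sq_le_mul _ (fun i _ => abs_nonneg _)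
      (fun i _ => by positivity) fun i _ => ?_
    rw [← mul_assoc, abs_mul_abs_self, mul_pow, sq (coeff c i)]
  have h3 : (∑ i, |coeff c i|) = (l1Z c : ℤ) := by simp [l1Z]
  calc ∑ j, coeff (c * a) j * coeff (c * a) j
      ≤ ∑ k, (∑ i, |coeff c i|) * ∑ i : Fin d, |coeff c i| * coeff (xbar ^ (i : ℕ) * a) k ^ 2 := by
        refine Finset.sum_le_sum fun k _ => ?_
        rw [← sq]
        exact h2 k
    _ = (∑ i, |coeff c i|) * ∑ i : Fin d, |coeff c i| *
          ∑ k, coeff (xbar ^ (i : ℕ) * a) k * coeff (xbar ^ (i : ℕ) * a) k := by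
        rw [← Finset.mul_sum, Finset.sum_comm]
        simp only [Finset.mul_sum, sq]
    _ = _ := by
        simp only [sum_coeff_xbar_pow_mul_sq, ← Finset.sum_mul, h3]
        ring

theorem innerZ_smul_le (c : Cyc ℤ d) (u : ι → Cyc ℤ d) :
    innerZ (c • u) (c • u) ≤ (l1Z c : ℤ) ^ 2 * innerZ u u := by
  rw [innerZ, innerZ, Finset.mul_sum]
  exact Finset.sum_le_sum fun i _ => sum_coeff_mul_sq_le c (u i)

theorem valMinAbs_intCast_sq_le [NeZero q] (x : ℤ) : ((x : ZMod q).valMinAbs) ^ 2 ≤ x ^ 2 :=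
  Int.natAbs_le_iff_sq_le.1
    (ZMod.natAbs_min_of_le_div_two q _ _ (ZMod.coe_valMinAbs _) (ZMod.natAbs_valMinAbs_le _))

theorem norm2_red_le [NeZero q] (u : ι → Cyc ℤ d) :
    norm2 (fun i => red q (u i)) ≤ Real.sqrt (innerZ u u) := by
  refine Real.sqrt_le_sqrt ?_
  rw [innerZ]
  push_cast
  refine Finset.sum_le_sum fun i _ => Finset.sum_le_sum fun j _ => ?_
  rw [coeff_red, ← sq]
  exact_mod_cast valMinAbs_intCast_sq_le _

theorem norm2_eq_lift (u : ι → Cyc (ZMod q) d) :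
    norm2 u = Real.sqrt (innerZ (fun i => lift (u i)) fun i => lift (u i)) := by
  rw [norm2, innerZ]
  push_cast
  simp only [coeff_lift, sq]

theorem norm2_nonneg (u : ι → Cyc (ZMod q) d) : 0 ≤ norm2 u := Real.sqrt_nonneg _

theorem l1Z_lift (c : Cyc (ZMod q) d) : l1Z (lift c) = l1 c := by
  simp only [l1Z, l1, coeff_lift]

theorem norm2_smul_le [NeZero q] (c : Cyc (ZMod q) d) (u : ι → Cyc (ZMod q) d) :
    norm2 (c • u) ≤ l1 c * norm2 u := by
  have h : c • u = fun i => red q (lift c * lift (u i)) := by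
    ext i
    rw [map_mul, red_lift, red_lift, Pi.smul_apply, smul_eq_mul]
  rw [h]
  refine (norm2_red_le _).trans ?_
  have h2 : innerZ (fun i => lift c * lift (u i)) (fun i => lift c * lift (u i)) ≤ _ :=
    innerZ_smul_le (lift c) fun i => lift (u i)
  rw [norm2_eq_lift u, ← l1Z_lift]
  refine Real.sqrt_le_iff.2 ⟨by positivity, ?_⟩
  rw [mul_pow, Real.sq_sqrt (by exact_mod_cast innerZ_self_nonneg _)]
  exact_mod_cast h2

theorem sqrt_innerZ_eq_norm (w : ι → Cyc ℤ d) : Real.sqrt (innerZ w w)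
    = ‖(WithLp.toLp 2 fun x : ι × Fin d => ((coeff (w x.1) x.2 : ℤ) : ℝ) :
        EuclideanSpace ℝ (ι × Fin d))‖ := by
  rw [EuclideanSpace.norm_eq, innerZ, Fintype.sum_prod_type]
  push_cast
  simp only [Real.norm_eq_abs, sq, abs_mul_abs_self]

theorem sqrt_innerZ_sub_le (u v : ι → Cyc ℤ d) : Real.sqrt (innerZ (u - v) (u - v))
    ≤ Real.sqrt (innerZ u u) + Real.sqrt (innerZ v v) := by
  rw [sqrt_innerZ_eq_norm, sqrt_innerZ_eq_norm, sqrt_innerZ_eq_norm]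
  refine le_trans (le_of_eq ?_) (norm_sub_le _ _)
  congr 1
  ext x
  simp [coeff_sub]

theorem norm2_sub_le [NeZero q] (u v : ι → Cyc (ZMod q) d) : norm2 (u - v) ≤ norm2 u + norm2 v := by
  have h : u - v = fun i => red q (lift (u i) - lift (v i)) := by
    ext i
    rw [map_sub, red_lift, red_lift, Pi.sub_apply]
  rw [h]
  refine (norm2_red_le _).trans ?_
  rw [norm2_eq_lift u, norm2_eq_lift v]
  exact sqrt_innerZ_sub_le (fun i => lift (u i)) fun i => lift (v i)

theorem norm2_eq_zero_iff (u : ι → Cyc (ZMod q) d) : norm2 u = 0 ↔ u = 0 := by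
  rw [norm2, Real.sqrt_eq_zero (by positivity),
    Finset.sum_eq_zero_iff_of_nonneg fun i _ => by positivity]
  constructor
  · intro h
    ext i
    have := h i (Finset.mem_univ i)
    rw [Finset.sum_eq_zero_iff_of_nonneg fun j _ => by positivity] at this
    refine coeff_injective (funext fun j => ?_)
    simpa [coeff_zero] using this j (Finset.mem_univ j)
  · rintro rfl
    simp [coeff_zero]

theorem norm2_sum_elim {ι' : Type} [Fintype ι'] (u : ι → Cyc (ZMod q) d) (v : ι' → Cyc (ZMod q) d) :
    norm2 (Sum.elim u v) = Real.sqrt (norm2 u ^ 2 + norm2 v ^ 2) := by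
  rw [norm2, norm2, norm2, Real.sq_sqrt (by positivity), Real.sq_sqrt (by positivity),
    Fintype.sum_sum_type]
  rfl

theorem l1_sub_le [NeZero q] (a b : Cyc (ZMod q) d) : l1 (a - b) ≤ l1 a + l1 b := by
  rw [l1, l1, l1, ← Finset.sum_add_distrib]
  refine Finset.sum_le_sum fun j _ => ?_
  rw [coeff_sub, Pi.sub_apply, sub_eq_add_neg]
  refine (ZMod.natAbs_valMinAbs_add_le _ _).trans ((Int.natAbs_add_le _ _).trans ?_)
  rw [ZMod.natAbs_valMinAbs_neg]

theorem l1_red_le [NeZero q] (a : Cyc ℤ d) : l1 (red q a) ≤ l1Z a := by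
  refine Finset.sum_le_sum fun j _ => ?_
  rw [coeff_red]
  have := valMinAbs_intCast_sq_le (q := q) (coeff a j)
  exact Int.natAbs_le_iff_sq_le.2 this

end Norms

end

end PoC

namespace PoC
noncomputable section

set_option linter.unusedSectionVars false

open ENNReal

/-! ### Products of independent coefficients -/

section Products

variable {R : Type} [CommRing R] {d : ℕ} [NeZero d]

theorem ex_polyOf (μ : PMF R) (f : Cyc R d → ℝ≥0∞) :
    ex (polyOf d μ) f = ex (iid (Fin d) μ) fun v => f (ofCoeffs v) := by
  rw [polyOf, ex_map]

theorem ex_polyOf_prod (μ : PMF R) (f : Fin d → R → ℝ≥0∞) :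
    ex (polyOf d μ) (fun a => ∏ j, f j (coeff a j)) = ∏ j, ex μ (f j) := by
  simp only [ex_polyOf, coeff_ofCoeffs, ex_iid_prod]

theorem ex_iid_polyOf_prod {ι : Type} [Fintype ι] (μ : PMF R) (f : ι → Fin d → R → ℝ≥0∞) :
    ex (iid ι (polyOf d μ)) (fun v => ∏ i, ∏ j, f i j (coeff (v i) j)) = ∏ i, ∏ j, ex μ (f i j) := by
  rw [ex_iid_prod (polyOf d μ) fun i a => ∏ j, f i j (coeff a j)]
  simp only [ex_polyOf_prod]

theorem polyOf_apply (μ : PMF R) (a : Cyc R d) : polyOf d μ a = ∏ j, μ (coeff a j) := by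
  classical
  rw [polyOf, PMF.map_apply, tsum_eq_single (coeff a), if_pos (ofCoeffs_coeff a).symm, iid_apply]
  intro v hv
  rw [if_neg]
  rintro rfl
  exact hv (coeff_ofCoeffs v).symm

theorem mem_support_polyOf {μ : PMF R} {a : Cyc R d} :
    a ∈ (polyOf d μ).support ↔ ∀ j, coeff a j ∈ μ.support := by
  rw [PMF.mem_support_iff, polyOf_apply, Finset.prod_ne_zero_iff]
  simp [PMF.mem_support_iff]

theorem polyOf_map_red (q : ℕ) (μ : PMF ℤ) :
    (polyOf d μ).map (red q) = polyOf d (μ.map fun a : ℤ => (a : ZMod q)) := by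
  rw [polyOf, polyOf, PMF.map_comp, ← iid_map, PMF.map_comp]
  exact congrArg (fun g => PMF.map g (iid (Fin d) μ)) (funext fun v => red_ofCoeffs v)

end Products

/-! ### The discrete Gaussian -/

section Gaussian

theorem summable_exp_neg_mul_sq {c : ℝ} (hc : 0 < c) :
    Summable fun n : ℤ => Real.exp (-c * (n : ℝ) ^ 2) := by
  have hσ : 0 < 1 / Real.sqrt (2 * c) := by positivity
  have h := ENNReal.summable_toReal (gaussWeight_ne_top hσ)
  refine h.congr fun n => ?_
  rw [gaussWeight, ENNReal.toReal_ofReal (Real.exp_pos _).le, div_pow, Real.sq_sqrt (by positivity)]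
  congr 1
  field_simp

theorem summable_exp_neg_quadratic {c : ℝ} (hc : 0 < c) (s : ℝ) :
    Summable fun n : ℤ => Real.exp (-c * (n : ℝ) ^ 2 + s * n) := by
  refine Summable.of_nonneg_of_le (fun n => (Real.exp_pos _).le) (fun n => ?_)
    ((summable_exp_neg_mul_sq (half_pos hc)).mul_left (Real.exp (s ^ 2 / (2 * c))))
  rw [← Real.exp_add, Real.exp_le_exp]
  have : s * n ≤ s ^ 2 / (2 * c) + c / 2 * (n : ℝ) ^ 2 := by
    have h := sq_nonneg (s / c - n)
    have h2 : s ^ 2 / (2 * c) + c / 2 * (n : ℝ) ^ 2 - s * n = c / 2 * (s / c - n) ^ 2 := by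
      field_simp
      ring
    have h3 : 0 ≤ c / 2 * (s / c - n) ^ 2 := by positivity
    linarith
  linarith

/-- Shifting a Gaussian on `ℤ` does not increase its total mass. -/
theorem tsum_exp_neg_quadratic_le {a : ℝ} (ha : 0 < a) (b : ℝ) :
    ∑' n : ℤ, Real.exp (-Real.pi * a * (n : ℝ) ^ 2 + 2 * Real.pi * b * n)
      ≤ Real.exp (Real.pi * b ^ 2 / a) * ∑' n : ℤ, Real.exp (-Real.pi * a * (n : ℝ) ^ 2) := by
  have h1 := Complex.tsum_exp_neg_quadratic (a := (a : ℂ)) (by simpa using ha) (b : ℂ)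
  have h0 := Real.tsum_exp_neg_mul_int_sq ha
  have hs : Summable fun n : ℤ => Real.exp (-Real.pi / a * (n : ℝ) ^ 2) := by
    have := summable_exp_neg_mul_sq (c := Real.pi / a) (by positivity)
    simpa only [neg_div] using this
  have hl : (∑' n : ℤ, Complex.exp (-Real.pi * a * (n : ℂ) ^ 2 + 2 * Real.pi * b * n))
      = ((∑' n : ℤ, Real.exp (-Real.pi * a * (n : ℝ) ^ 2 + 2 * Real.pi * b * n) : ℝ) : ℂ) := by
    push_cast
    rfl
  have hn : ∀ n : ℤ, ‖Complex.exp (-Real.pi / a * ((n : ℂ) + Complex.I * b) ^ 2)‖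
      = Real.exp (Real.pi * b ^ 2 / a) * Real.exp (-Real.pi / a * (n : ℝ) ^ 2) := by
    intro n
    rw [Complex.norm_exp, ← Real.exp_add]
    congr 1
    have : (-Real.pi / a * ((n : ℂ) + Complex.I * b) ^ 2 : ℂ)
        = ((-Real.pi / a * ((n : ℝ) ^ 2 - b ^ 2) : ℝ) : ℂ)
          + ((-Real.pi / a * (2 * n * b) : ℝ) : ℂ) * Complex.I := by
      push_cast
      ring_nf
      rw [Complex.I_sq]
      ring
    rw [this, Complex.add_re, Complex.ofReal_re, Complex.re_ofReal_mul, Complex.I_re]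
    ring
  rw [hl] at h1
  have h2 := congrArg norm h1
  rw [Complex.norm_real, Real.norm_of_nonneg (tsum_nonneg fun n => (Real.exp_pos _).le), norm_mul] at h2
  rw [h2, h0]
  have hnorm : ‖(1 / (a : ℂ) ^ (1 / 2 : ℂ))‖ = 1 / a ^ (1 / 2 : ℝ) := by
    rw [norm_div, norm_one, Complex.norm_cpow_eq_rpow_re_of_pos ha]
    norm_num
  rw [hnorm, mul_left_comm]
  refine mul_le_mul_of_nonneg_left ?_ (by positivity)
  rw [← tsum_mul_left]
  refine (norm_tsum_le_tsum_norm ?_).trans (le_of_eq (tsum_congr hn))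
  simp only [hn]
  exact hs.mul_left _

theorem tsum_exp_half_le {a : ℝ} (ha : 0 < a) :
    ∑' n : ℤ, Real.exp (-Real.pi * (a / 2) * (n : ℝ) ^ 2)
      ≤ Real.sqrt 2 * ∑' n : ℤ, Real.exp (-Real.pi * a * (n : ℝ) ^ 2) := by
  rw [Real.tsum_exp_neg_mul_int_sq ha, Real.tsum_exp_neg_mul_int_sq (half_pos ha), ← mul_assoc]
  have h1 : 1 / (a / 2) ^ (1 / 2 : ℝ) = Real.sqrt 2 * (1 / a ^ (1 / 2 : ℝ)) := by
    rw [← Real.sqrt_eq_rpow, ← Real.sqrt_eq_rpow, Real.sqrt_div ha.le]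
    field_simp
  rw [h1]
  have hs : ∀ c : ℝ, 0 < c → Summable fun n : ℤ => Real.exp (-Real.pi / c * (n : ℝ) ^ 2) := by
    intro c hc
    have := summable_exp_neg_mul_sq (c := Real.pi / c) (by positivity)
    simpa only [neg_div] using this
  refine mul_le_mul_of_nonneg_left ((hs _ (half_pos ha)).tsum_le_tsum (fun n => ?_) (hs _ ha))
    (by positivity)
  rw [Real.exp_le_exp]
  refine mul_le_mul_of_nonneg_right ?_ (sq_nonneg _)
  rw [neg_div, neg_div, neg_le_neg_iff]
  gcongr
  linarith

variable {σ : ℝ}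

theorem discreteGaussian_apply (hσ : 0 < σ) (x : ℤ) :
    discreteGaussian σ x = gaussWeight σ x * (∑' x, gaussWeight σ x)⁻¹ := by
  rw [discreteGaussian, dif_pos hσ, PMF.normalize_apply]

theorem ex_discreteGaussian_le (hσ : 0 < σ) {f : ℤ → ℝ≥0∞} {c : ℝ≥0∞}
    (h : ∑' x, gaussWeight σ x * f x ≤ c * ∑' x, gaussWeight σ x) :
    ex (discreteGaussian σ) f ≤ c := by
  have : ex (discreteGaussian σ) f = (∑' x, gaussWeight σ x * f x) / ∑' x, gaussWeight σ x := by
    rw [ex, div_eq_mul_inv, ← ENNReal.tsum_mul_right]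
    refine tsum_congr fun x => ?_
    rw [discreteGaussian_apply hσ]
    ring
  rw [this]
  exact ENNReal.div_le_of_le_mul h

theorem tsum_gaussWeight (hσ : 0 < σ) : ∑' x, gaussWeight σ x
    = ENNReal.ofReal (∑' n : ℤ, Real.exp (-Real.pi * (1 / (2 * Real.pi * σ ^ 2)) * (n : ℝ) ^ 2)) := by
  rw [ENNReal.ofReal_tsum_of_nonneg (fun n => (Real.exp_pos _).le)]
  · refine tsum_congr fun n => ?_
    rw [gaussWeight]
    congr 2
    field_simp
  · have := summable_exp_neg_mul_sq (c := Real.pi * (1 / (2 * Real.pi * σ ^ 2))) (by positivity)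
    simpa only [neg_mul] using this

/-- The discrete Gaussian is subgaussian with variance proxy `σ²`. -/
theorem ex_discreteGaussian_exp (hσ : 0 < σ) (s : ℝ) :
    ex (discreteGaussian σ) (fun x => ENNReal.ofReal (Real.exp (s * x)))
      ≤ ENNReal.ofReal (Real.exp (s ^ 2 * σ ^ 2 / 2)) := by
  refine ex_discreteGaussian_le hσ ?_
  rw [tsum_gaussWeight hσ, ← ENNReal.ofReal_mul (Real.exp_pos _).le]
  have h := tsum_exp_neg_quadratic_le (a := 1 / (2 * Real.pi * σ ^ 2)) (by positivity)
    (s / (2 * Real.pi))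
  have e1 : Real.pi * (s / (2 * Real.pi)) ^ 2 / (1 / (2 * Real.pi * σ ^ 2)) = s ^ 2 * σ ^ 2 / 2 := by
    field_simp
  rw [e1] at h
  refine le_trans (le_of_eq ?_) (ENNReal.ofReal_le_ofReal h)
  rw [ENNReal.ofReal_tsum_of_nonneg (fun n => (Real.exp_pos _).le)]
  · refine tsum_congr fun n => ?_
    rw [gaussWeight, ← ENNReal.ofReal_mul (Real.exp_pos _).le, ← Real.exp_add]
    congr 2
    field_simp
  · have := summable_exp_neg_quadratic (c := Real.pi * (1 / (2 * Real.pi * σ ^ 2))) (by positivity)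
      (2 * Real.pi * (s / (2 * Real.pi)))
    simpa only [neg_mul] using this

theorem ex_discreteGaussian_exp_sq (hσ : 0 < σ) :
    ex (discreteGaussian σ) (fun x => ENNReal.ofReal (Real.exp ((x : ℝ) ^ 2 / (4 * σ ^ 2))))
      ≤ ENNReal.ofReal (Real.sqrt 2) := by
  refine ex_discreteGaussian_le hσ ?_
  rw [tsum_gaussWeight hσ, ← ENNReal.ofReal_mul (Real.sqrt_nonneg _)]
  have h := tsum_exp_half_le (a := 1 / (2 * Real.pi * σ ^ 2)) (by positivity)
  refine le_trans (le_of_eq ?_) (ENNReal.ofReal_le_ofReal h)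
  rw [ENNReal.ofReal_tsum_of_nonneg (fun n => (Real.exp_pos _).le)]
  · refine tsum_congr fun n => ?_
    rw [gaussWeight, ← ENNReal.ofReal_mul (Real.exp_pos _).le, ← Real.exp_add]
    congr 2
    field_simp
    ring
  · have := summable_exp_neg_mul_sq (c := Real.pi * (1 / (2 * Real.pi * σ ^ 2) / 2)) (by positivity)
    simpa only [neg_mul] using this

open Classical in
theorem ex_discreteGaussian_tail (hσ : 0 < σ) {k : ℝ} (hk : 0 ≤ k) :
    ex (discreteGaussian σ) (fun x => if Real.sqrt (2 * k) * σ < |(x : ℝ)| then 1 else 0)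
      ≤ ENNReal.ofReal (2 * Real.exp (-k)) := by
  set t := Real.sqrt (2 * k) with ht
  have ht2 : t ^ 2 = 2 * k := Real.sq_sqrt (by positivity)
  have ht0 : 0 ≤ t := Real.sqrt_nonneg _
  have hb : ∀ x : ℤ, (if t * σ < |(x : ℝ)| then 1 else 0 : ℝ≥0∞)
      ≤ ENNReal.ofReal (Real.exp (-(2 * k))) * (ENNReal.ofReal (Real.exp (t / σ * x))
        + ENNReal.ofReal (Real.exp (-(t / σ) * x))) := by
    intro x
    split_ifs with h
    · rw [← ENNReal.ofReal_add (Real.exp_pos _).le (Real.exp_pos _).le,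
        ← ENNReal.ofReal_mul (Real.exp_pos _).le, ENNReal.one_le_ofReal, mul_add, ← Real.exp_add,
        ← Real.exp_add]
      have h2 : 2 * k ≤ t / σ * |(x : ℝ)| := by
        have : t / σ * (t * σ) ≤ t / σ * |(x : ℝ)| := by gcongr
        have e : t / σ * (t * σ) = 2 * k := by
          rw [← ht2]
          field_simp
        linarith
      rcases abs_cases (x : ℝ) with ⟨hx, _⟩ | ⟨hx, _⟩
      · rw [hx] at h2
        have : 1 ≤ Real.exp (-(2 * k) + t / σ * x) := Real.one_le_exp (by linarith)
        have := Real.exp_pos (-(2 * k) + -(t / σ) * x)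
        linarith
      · rw [hx] at h2
        have : 1 ≤ Real.exp (-(2 * k) + -(t / σ) * x) := Real.one_le_exp (by linarith)
        have := Real.exp_pos (-(2 * k) + t / σ * x)
        linarith
    · exact zero_le
  have e : (t / σ) ^ 2 * σ ^ 2 / 2 = k := by
    rw [div_pow, div_mul_cancel₀ _ (by positivity), ht2]
    ring
  calc _ ≤ _ := ex_mono hb
    _ = ENNReal.ofReal (Real.exp (-(2 * k))) *
        (ex (discreteGaussian σ) (fun x => ENNReal.ofReal (Real.exp (t / σ * x)))
        + ex (discreteGaussian σ) (fun x => ENNReal.ofReal (Real.exp (-(t / σ) * x)))) := by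
      rw [ex_const_mul, ex_add]
    _ ≤ ENNReal.ofReal (Real.exp (-(2 * k))) *
        (ENNReal.ofReal (Real.exp k) + ENNReal.ofReal (Real.exp k)) := by
      gcongr
      · simpa only [e] using ex_discreteGaussian_exp hσ (t / σ)
      · simpa only [neg_sq, e] using ex_discreteGaussian_exp hσ (-(t / σ))
    _ = _ := by
      rw [← ENNReal.ofReal_add (Real.exp_pos _).le (Real.exp_pos _).le,
        ← ENNReal.ofReal_mul (Real.exp_pos _).le, mul_add, ← Real.exp_add]
      congr 1
      have : -(2 * k) + k = -k := by ring
      rw [this]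
      ring

end Gaussian

end

end PoC

namespace PoC
noncomputable section

set_option linter.unusedSectionVars false

open ENNReal

/-! ### Rejection sampling -/

section Rejection

variable {d : ℕ} [NeZero d] {ι : Type} [Fintype ι]

/-- The logarithm of the ratio of the Gaussian centred at `0` and the Gaussian centred at `v`. -/
def logRatio (z v : ι → Cyc ℤ d) (σ : ℝ) : ℝ :=
  (-2 * (innerZ z v : ℝ) + (innerZ v v : ℝ)) / (2 * σ ^ 2)

/-- The probability that rejection sampling accepts `z`. -/
def rejProb (z v : ι → Cyc ℤ d) (σ : ℝ) : ℝ≥0∞ :=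
  min 1 (ENNReal.ofReal (1 / 3 * Real.exp (logRatio z v σ)))

theorem ex_rej {P : Params} (z v : ι → P.RZ) (σ : ℝ) (f : Bool → ℝ≥0∞) :
    ex (rej z v σ) f = rejProb z v σ * f true + (1 - rejProb z v σ) * f false := by
  rw [rej, ex_coin, rejProb, logRatio]

theorem logRatio_eq_sum (z v : ι → Cyc ℤ d) (σ : ℝ) : logRatio z v σ =
    ∑ i, ∑ j, (-2 * ((coeff (z i) j : ℤ) : ℝ) * ((coeff (v i) j : ℤ) : ℝ)
      + ((coeff (v i) j : ℤ) : ℝ) ^ 2) / (2 * σ ^ 2) := by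
  rw [logRatio, innerZ, innerZ]
  push_cast
  simp only [Finset.mul_sum, ← Finset.sum_add_distrib, Finset.sum_div]
  refine Finset.sum_congr rfl fun i _ => Finset.sum_congr rfl fun j _ => ?_
  ring

theorem ofReal_exp_sum {κ : Type} (s : Finset κ) (f : κ → ℝ) :
    ENNReal.ofReal (Real.exp (∑ i ∈ s, f i)) = ∏ i ∈ s, ENNReal.ofReal (Real.exp (f i)) := by
  rw [Real.exp_sum, ENNReal.ofReal_prod_of_nonneg fun i _ => (Real.exp_pos _).le]

theorem gaussWeight_sub_mul (σ : ℝ) (z v : ℤ) : gaussWeight σ (z - v) *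
    ENNReal.ofReal (Real.exp ((-2 * (z : ℝ) * v + (v : ℝ) ^ 2) / (2 * σ ^ 2))) = gaussWeight σ z := by
  rw [gaussWeight, gaussWeight, ← ENNReal.ofReal_mul (Real.exp_pos _).le, ← Real.exp_add]
  congr 2
  rw [← add_div]
  congr 1
  push_cast
  ring

variable {σ : ℝ}

theorem gaussian_sub_mul (hσ : 0 < σ) (z v : ι → Cyc ℤ d) :
    iid ι (polyOf d (discreteGaussian σ)) (z - v) * ENNReal.ofReal (Real.exp (logRatio z v σ))
      = iid ι (polyOf d (discreteGaussian σ)) z := by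
  simp only [logRatio_eq_sum, ofReal_exp_sum, iid_apply, polyOf_apply, ← Finset.prod_mul_distrib,
    discreteGaussian_apply hσ, Pi.sub_apply, coeff_sub]
  refine Finset.prod_congr rfl fun i _ => Finset.prod_congr rfl fun j _ => ?_
  rw [mul_right_comm, gaussWeight_sub_mul]

theorem ex_add_right_eq_tsum {G : Type} [AddGroup G] (μ : PMF G) (v : G) (f : G → ℝ≥0∞) :
    ex μ (fun y => f (y + v)) = ∑' z, μ (z - v) * f z := by
  rw [ex, ← (Equiv.addRight v).tsum_eq fun z => μ (z - v) * f z]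
  simp

/-- The accepted outputs of rejection sampling have at most a third of the Gaussian density. -/
theorem ex_rejProb_mul_le (hσ : 0 < σ) (v : ι → Cyc ℤ d) (f : (ι → Cyc ℤ d) → ℝ≥0∞) :
    ex (iid ι (polyOf d (discreteGaussian σ))) (fun y => rejProb (y + v) v σ * f (y + v))
      ≤ ENNReal.ofReal (1 / 3) * ex (iid ι (polyOf d (discreteGaussian σ))) f := by
  rw [ex_add_right_eq_tsum _ v fun z => rejProb z v σ * f z, ex, ← ENNReal.tsum_mul_left]
  refine ENNReal.tsum_le_tsum fun z => ?_
  calc _ ≤ iid ι (polyOf d (discreteGaussian σ)) (z - v) *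
        (ENNReal.ofReal (1 / 3 * Real.exp (logRatio z v σ)) * f z) := by
        gcongr
        exact min_le_right _ _
    _ = ENNReal.ofReal (1 / 3) * (iid ι (polyOf d (discreteGaussian σ)) (z - v) *
        ENNReal.ofReal (Real.exp (logRatio z v σ)) * f z) := by
        rw [ENNReal.ofReal_mul (by norm_num)]
        ring
    _ = _ := by rw [gaussian_sub_mul hσ]

theorem ex_exp_logRatio_le (hσ : 0 < σ) (v : ι → Cyc ℤ d) (t : ℝ) :
    ex (iid ι (polyOf d (discreteGaussian σ)))
      (fun z => ENNReal.ofReal (Real.exp (t * logRatio z v σ)))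
      ≤ ENNReal.ofReal (Real.exp (t * (t + 1) * innerZ v v / (2 * σ ^ 2))) := by
  have h1 : ∀ z : ι → Cyc ℤ d, ENNReal.ofReal (Real.exp (t * logRatio z v σ))
      = ∏ i, ∏ j, (ENNReal.ofReal (Real.exp (t * ((coeff (v i) j : ℤ) : ℝ) ^ 2 / (2 * σ ^ 2)))
        * ENNReal.ofReal (Real.exp (-(t * ((coeff (v i) j : ℤ) : ℝ) / σ ^ 2)
            * ((coeff (z i) j : ℤ) : ℝ)))) := by
    intro z
    simp only [logRatio_eq_sum, Finset.mul_sum, ofReal_exp_sum]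
    refine Finset.prod_congr rfl fun i _ => Finset.prod_congr rfl fun j _ => ?_
    rw [← ENNReal.ofReal_mul (Real.exp_pos _).le, ← Real.exp_add]
    congr 2
    field_simp
    ring
  simp only [h1]
  rw [ex_iid_polyOf_prod (discreteGaussian σ) fun i j x =>
    ENNReal.ofReal (Real.exp (t * ((coeff (v i) j : ℤ) : ℝ) ^ 2 / (2 * σ ^ 2)))
        * ENNReal.ofReal (Real.exp (-(t * ((coeff (v i) j : ℤ) : ℝ) / σ ^ 2) * (x : ℝ)))]
  have h2 : t * (t + 1) * (innerZ v v : ℝ) / (2 * σ ^ 2)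
      = ∑ i, ∑ j, t * (t + 1) * ((coeff (v i) j : ℤ) : ℝ) ^ 2 / (2 * σ ^ 2) := by
    rw [innerZ]
    push_cast
    simp only [← Finset.sum_div, Finset.mul_sum, sq]
  rw [h2, ofReal_exp_sum]
  refine Finset.prod_le_prod' fun i _ => ?_
  rw [ofReal_exp_sum]
  refine Finset.prod_le_prod' fun j _ => ?_
  rw [ex_const_mul]
  refine (mul_le_mul_right (ex_discreteGaussian_exp hσ _) _).trans (le_of_eq ?_)
  rw [← ENNReal.ofReal_mul (Real.exp_pos _).le, ← Real.exp_add]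
  congr 2
  field_simp
  ring

theorem rejection_tail_bound : Real.exp (798 / 11) / 3 ^ 132 ≤ (1 / 2) ^ 103 := by
  have h1 : Real.exp (798 / 11) ≤ 2.7182818286 ^ 73 := by
    calc Real.exp (798 / 11) ≤ Real.exp ((73 : ℕ) * 1) := by
          rw [Real.exp_le_exp]
          norm_num
      _ = Real.exp 1 ^ 73 := Real.exp_nat_mul 1 73
      _ ≤ _ := pow_le_pow_left₀ (Real.exp_pos _).le Real.exp_one_lt_d9.le _
  rw [div_le_iff₀ (by positivity)]
  refine h1.trans ?_
  norm_num

/-- Rejection sampling accepts with probability close to a third. -/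
theorem le_ex_rejProb (hσ : 0 < σ) (v : ι → Cyc ℤ d) (hv : (innerZ v v : ℝ) ≤ σ ^ 2 / 121) :
    ENNReal.ofReal (1 / 3 * (1 - (1 / 2) ^ 103))
      ≤ ex (iid ι (polyOf d (discreteGaussian σ))) fun y => rejProb (y + v) v σ := by
  classical
  set D := iid ι (polyOf d (discreteGaussian σ)) with hD
  have htail : ex D (fun z => if 3 < Real.exp (logRatio z v σ) then 1 else 0)
      ≤ ENNReal.ofReal ((1 / 2) ^ 103) := by
    have h1 : ∀ z, (if 3 < Real.exp (logRatio z v σ) then 1 else 0 : ℝ≥0∞)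
        ≤ ENNReal.ofReal (1 / 3 ^ 132) * ENNReal.ofReal (Real.exp (132 * logRatio z v σ)) := by
      intro z
      split_ifs with h
      · rw [← ENNReal.ofReal_mul (by positivity), ENNReal.one_le_ofReal, div_mul_eq_mul_div, one_mul,
          one_le_div (by positivity)]
        have e : Real.exp (132 * logRatio z v σ) = Real.exp (logRatio z v σ) ^ 132 := by
          rw [← Real.exp_nat_mul]
          norm_num
        rw [e]
        exact pow_le_pow_left₀ (by norm_num) h.le _
      · exact zero_le
    refine (ex_mono h1).trans ?_
    rw [ex_const_mul]
    refine (mul_le_mul_right (ex_exp_logRatio_le hσ v 132) _).trans ?_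
    rw [← ENNReal.ofReal_mul (by positivity)]
    refine ENNReal.ofReal_le_ofReal (le_trans ?_ rejection_tail_bound)
    rw [div_mul_eq_mul_div, one_mul]
    have h2 : 132 * (132 + 1) * (innerZ v v : ℝ) / (2 * σ ^ 2) ≤ 798 / 11 := by
      rw [div_le_div_iff₀ (by positivity) (by norm_num)]
      linarith
    gcongr
  have hsum : 1 ≤ ex D (fun z => if 3 < Real.exp (logRatio z v σ) then 0 else 1)
      + ENNReal.ofReal ((1 / 2) ^ 103) := by
    refine le_trans ?_ (add_le_add_right htail _)
    rw [← ex_add]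
    refine const_le_ex_support fun z _ => ?_
    split_ifs <;> simp
  have hgood : ENNReal.ofReal (1 - (1 / 2) ^ 103)
      ≤ ex D (fun z => if 3 < Real.exp (logRatio z v σ) then 0 else 1) := by
    rw [ENNReal.ofReal_sub _ (by positivity), ENNReal.ofReal_one]
    exact tsub_le_iff_right.2 hsum
  rw [ENNReal.ofReal_mul (by norm_num)]
  refine (mul_le_mul_right hgood _).trans ?_
  rw [ex_add_right_eq_tsum _ v fun z => rejProb z v σ, ex, ← ENNReal.tsum_mul_left]
  refine ENNReal.tsum_le_tsum fun z => ?_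
  split_ifs with h
  · simp
  · have hmin : rejProb z v σ = ENNReal.ofReal (1 / 3) * ENNReal.ofReal (Real.exp (logRatio z v σ)) := by
      rw [rejProb, min_eq_right, ENNReal.ofReal_mul (by norm_num)]
      rw [ENNReal.ofReal_le_one]
      linarith
    rw [hmin, mul_one, ← gaussian_sub_mul hσ z v]
    exact le_of_eq (by ring)

open Classical in
/-- Tail bound for the Euclidean norm of a Gaussian vector. -/
theorem ex_gaussian_norm_tail (hσ : 0 < σ) :
    ex (iid ι (polyOf d (discreteGaussian σ)))
      (fun z => if 2 * (Fintype.card ι * d) * σ ^ 2 < (innerZ z z : ℝ) then 1 else 0)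
      ≤ ENNReal.ofReal (2 ^ (-(Fintype.card ι * d : ℝ) / 8)) := by
  set m : ℝ := Fintype.card ι * d with hm
  have h1 : ∀ z : ι → Cyc ℤ d, (if 2 * m * σ ^ 2 < (innerZ z z : ℝ) then 1 else 0 : ℝ≥0∞)
      ≤ ENNReal.ofReal (Real.exp (-(m / 2)))
        * ∏ i, ∏ j, ENNReal.ofReal (Real.exp (((coeff (z i) j : ℤ) : ℝ) ^ 2 / (4 * σ ^ 2))) := by
    intro z
    split_ifs with h
    · simp only [← ofReal_exp_sum]
      rw [← ENNReal.ofReal_mul (Real.exp_pos _).le, ENNReal.one_le_ofReal, ← Real.exp_add]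
      refine Real.one_le_exp ?_
      have : (∑ i, ∑ j, ((coeff (z i) j : ℤ) : ℝ) ^ 2 / (4 * σ ^ 2)) = innerZ z z / (4 * σ ^ 2) := by
        rw [innerZ]
        push_cast
        simp only [← Finset.sum_div, sq]
      rw [this]
      have : m / 2 ≤ innerZ z z / (4 * σ ^ 2) := by
        rw [le_div_iff₀ (by positivity)]
        linarith
      linarith
    · exact zero_le
  refine (ex_mono h1).trans ?_
  rw [ex_const_mul, ex_iid_polyOf_prod (discreteGaussian σ) fun i j x =>
    ENNReal.ofReal (Real.exp ((x : ℝ) ^ 2 / (4 * σ ^ 2)))]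
  have h2 : (∏ _i : ι, ∏ _j : Fin d, ex (discreteGaussian σ)
      fun x => ENNReal.ofReal (Real.exp ((x : ℝ) ^ 2 / (4 * σ ^ 2))))
      ≤ ∏ _i : ι, ∏ _j : Fin d, ENNReal.ofReal (Real.sqrt 2) :=
    Finset.prod_le_prod' fun i _ => Finset.prod_le_prod' fun j _ => ex_discreteGaussian_exp_sq hσ
  refine (mul_le_mul_right h2 _).trans ?_
  simp only [Finset.prod_const, Finset.card_univ, Fintype.card_fin]
  rw [← pow_mul, ← ENNReal.ofReal_pow (Real.sqrt_nonneg _), ← ENNReal.ofReal_mul (Real.exp_pos _).le]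
  refine ENNReal.ofReal_le_ofReal ?_
  have h3 : Real.sqrt 2 ^ (d * Fintype.card ι) = (Real.sqrt 2) ^ m := by
    rw [← Real.rpow_natCast]
    congr 1
    push_cast
    ring
  have hm0 : 0 ≤ m := by positivity
  have h4 : Real.exp (-(m / 2)) = (Real.exp (-(1 / 2))) ^ m := by
    rw [← Real.exp_mul]
    congr 1
    ring
  have h5 : (2 : ℝ) ^ (-m / 8) = ((2 : ℝ) ^ (-(1 / 8) : ℝ)) ^ m := by
    rw [← Real.rpow_mul (by norm_num)]
    congr 1
    ring
  rw [h3, h4, h5, ← Real.mul_rpow (Real.exp_pos _).le (Real.sqrt_nonneg _)]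
  refine Real.rpow_le_rpow (by positivity) ?_ hm0
  refine le_of_pow_le_pow_left₀ (n := 8) (by norm_num) (by positivity) ?_
  have e1 : ((2 : ℝ) ^ (-(1 / 8) : ℝ)) ^ 8 = 1 / 2 := by
    rw [← Real.rpow_natCast, ← Real.rpow_mul (by norm_num)]
    norm_num
  have e2 : Real.sqrt 2 ^ 8 = 16 := by
    have : Real.sqrt 2 ^ 8 = (Real.sqrt 2 ^ 2) ^ 4 := by ring
    rw [this, Real.sq_sqrt (by norm_num)]
    norm_num
  have e3 : Real.exp (-(1 / 2)) ^ 8 = Real.exp (-4) := by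
    rw [← Real.exp_nat_mul]
    norm_num
  have e4 : (32 : ℝ) ≤ Real.exp 4 := by
    have : Real.exp 4 = Real.exp 1 ^ 4 := by
      rw [← Real.exp_nat_mul]
      norm_num
    rw [this]
    calc (32 : ℝ) ≤ 2.7 ^ 4 := by norm_num
      _ ≤ _ := pow_le_pow_left₀ (by norm_num) (by linarith [Real.exp_one_gt_d9]) _
  rw [mul_pow, e1, e2, e3, Real.exp_neg]
  have : (Real.exp 4)⁻¹ ≤ 1 / 32 := by
    rw [one_div]
    exact inv_anti₀ (by norm_num) e4
  linarith

end Rejection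

/-! ### Random projections -/

section Projection

theorem ex_bin1 (f : ℤ → ℝ≥0∞) : ex bin1 f = ENNReal.ofReal (1 / 2) * f 0
    + ENNReal.ofReal (1 / 4) * f 1 + ENNReal.ofReal (1 / 4) * f (-1) := by
  rw [bin1, ex_ternary (by norm_num) (by norm_num)]
  norm_num

theorem ex_bin1_exp_le (s : ℝ) : ex bin1 (fun x => ENNReal.ofReal (Real.exp (s * x)))
    ≤ ENNReal.ofReal (Real.exp (s ^ 2 / 4)) := by
  rw [ex_bin1, ← ENNReal.ofReal_mul (by norm_num), ← ENNReal.ofReal_mul (by norm_num),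
    ← ENNReal.ofReal_mul (by norm_num), ← ENNReal.ofReal_add (by positivity) (by positivity),
    ← ENNReal.ofReal_add (by positivity) (by positivity)]
  refine ENNReal.ofReal_le_ofReal ?_
  have h := Real.cosh_le_exp_half_sq (s / 2)
  have h2 : Real.cosh (s / 2) ^ 2 ≤ Real.exp (s ^ 2 / 4) := by
    calc Real.cosh (s / 2) ^ 2 ≤ Real.exp ((s / 2) ^ 2 / 2) ^ 2 :=
          pow_le_pow_left₀ (Real.cosh_pos _).le h _
      _ = _ := by
        rw [← Real.exp_nat_mul]
        congr 1
        push_cast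
        ring
  refine le_trans (le_of_eq ?_) h2
  have h3 := Real.cosh_sq' (s / 2)
  have h4 := Real.cosh_two_mul (s / 2)
  have h5 : 2 * (s / 2) = s := by ring
  rw [h5] at h4
  have h6 := Real.cosh_eq s
  have h7 := Real.cosh_sq (s / 2)
  simp
  nlinarith

variable {d : ℕ} [NeZero d] {ι : Type} [Fintype ι]

theorem ex_row_exp_le {r : ι → Cyc ℤ d} {m : ℝ} (hr : (innerZ r r : ℝ) ≤ m) (s : ℝ) :
    ex (iid ι (polyOf d bin1)) (fun u => ENNReal.ofReal (Real.exp (s * innerZ u r)))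
      ≤ ENNReal.ofReal (Real.exp (s ^ 2 * m / 4)) := by
  have h1 : ∀ u : ι → Cyc ℤ d, ENNReal.ofReal (Real.exp (s * innerZ u r))
      = ∏ i, ∏ j, ENNReal.ofReal (Real.exp (s * ((coeff (r i) j : ℤ) : ℝ)
          * ((coeff (u i) j : ℤ) : ℝ))) := by
    intro u
    simp only [← ofReal_exp_sum, innerZ]
    push_cast
    simp only [Finset.mul_sum]
    congr 2
    refine Finset.sum_congr rfl fun i _ => Finset.sum_congr rfl fun j _ => ?_
    ring
  simp only [h1]
  rw [ex_iid_polyOf_prod bin1 fun i j x => ENNReal.ofReal (Real.exp (s * ((coeff (r i) j : ℤ) : ℝ)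
          * (x : ℝ)))]
  calc _ ≤ ∏ i, ∏ j, ENNReal.ofReal (Real.exp ((s * ((coeff (r i) j : ℤ) : ℝ)) ^ 2 / 4)) :=
        Finset.prod_le_prod' fun i _ => Finset.prod_le_prod' fun j _ => ex_bin1_exp_le _
    _ = ENNReal.ofReal (Real.exp (s ^ 2 * innerZ r r / 4)) := by
        simp only [← ofReal_exp_sum, innerZ]
        push_cast
        simp only [Finset.mul_sum, ← Finset.sum_div]
        congr 3
        refine Finset.sum_congr rfl fun i _ => Finset.sum_congr rfl fun j _ => ?_
        ring
    _ ≤ _ := by gcongr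

open MeasureTheory ProbabilityTheory in
theorem ofReal_exp_sq_eq_lintegral (t : ℝ) : ENNReal.ofReal (Real.exp (t ^ 2 / 2))
    = ∫⁻ g, ENNReal.ofReal (gaussianPDFReal 0 1 g * Real.exp (t * g)) := by
  have h : ∀ g, gaussianPDFReal 0 1 g * Real.exp (t * g)
      = Real.exp (t ^ 2 / 2) * gaussianPDFReal t 1 g := by
    intro g
    simp only [gaussianPDFReal, NNReal.coe_one, mul_one]
    rw [mul_assoc, ← Real.exp_add, mul_left_comm, ← Real.exp_add]
    congr 2
    ring
  simp only [h, ENNReal.ofReal_mul (Real.exp_pos _).le]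
  rw [lintegral_const_mul' _ _ ENNReal.ofReal_ne_top, lintegral_gaussianPDFReal_eq_one _ one_ne_zero,
    mul_one]

open MeasureTheory ProbabilityTheory in
theorem lintegral_gaussian_exp_quarter :
    ∫⁻ g, ENNReal.ofReal (gaussianPDFReal 0 1 g * Real.exp (g ^ 2 / 4))
      = ENNReal.ofReal (Real.sqrt 2) := by
  have h : ∀ g, gaussianPDFReal 0 1 g * Real.exp (g ^ 2 / 4)
      = Real.sqrt 2 * gaussianPDFReal 0 2 g := by
    intro g
    simp only [gaussianPDFReal, NNReal.coe_one, mul_one, NNReal.coe_ofNat]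
    rw [mul_assoc, ← Real.exp_add, ← mul_assoc]
    congr 1
    · rw [mul_comm (2 * Real.pi) 2, Real.sqrt_mul (by norm_num) (2 * Real.pi), mul_inv, ← mul_assoc,
        mul_inv_cancel₀ (by positivity), one_mul]
    · congr 1
      ring
  simp only [h, ENNReal.ofReal_mul (Real.sqrt_nonneg _)]
  rw [lintegral_const_mul' _ _ ENNReal.ofReal_ne_top, lintegral_gaussianPDFReal_eq_one _ two_ne_zero,
    mul_one]

instance : Countable (Cyc ℤ d) := (coeffEquiv (R := ℤ) (d := d)).injective.countable

open MeasureTheory ProbabilityTheory in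
theorem ex_row_exp_sq_le {r : ι → Cyc ℤ d} {m : ℝ} (hm : 0 < m) (hr : (innerZ r r : ℝ) ≤ m) :
    ex (iid ι (polyOf d bin1)) (fun u => ENNReal.ofReal (Real.exp ((innerZ u r : ℝ) ^ 2 / (2 * m))))
      ≤ ENNReal.ofReal (Real.sqrt 2) := by
  have h1 : ∀ u : ι → Cyc ℤ d, ENNReal.ofReal (Real.exp ((innerZ u r : ℝ) ^ 2 / (2 * m)))
      = ∫⁻ g, ENNReal.ofReal (gaussianPDFReal 0 1 g) *
          ENNReal.ofReal (Real.exp (g / Real.sqrt m * innerZ u r)) := by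
    intro u
    have := ofReal_exp_sq_eq_lintegral ((innerZ u r : ℝ) / Real.sqrt m)
    rw [div_pow, Real.sq_sqrt hm.le, div_div, mul_comm m 2] at this
    rw [this]
    refine lintegral_congr fun g => ?_
    rw [ENNReal.ofReal_mul (gaussianPDFReal_nonneg _ _ _)]
    congr 3
    ring
  have hmeas : ∀ c : ℝ, Measurable fun g : ℝ => ENNReal.ofReal (gaussianPDFReal 0 1 g) *
      ENNReal.ofReal (Real.exp (g / Real.sqrt m * c)) := by
    intro c
    fun_prop
  calc _ = ∑' u, ∫⁻ g, iid ι (polyOf d bin1) u * (ENNReal.ofReal (gaussianPDFReal 0 1 g) *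
          ENNReal.ofReal (Real.exp (g / Real.sqrt m * innerZ u r))) := by
        refine tsum_congr fun u => ?_
        beta_reduce
        rw [h1, lintegral_const_mul _ (hmeas _)]
    _ = ∫⁻ g, ∑' u, iid ι (polyOf d bin1) u * (ENNReal.ofReal (gaussianPDFReal 0 1 g) *
          ENNReal.ofReal (Real.exp (g / Real.sqrt m * innerZ u r))) := by
        exact (lintegral_tsum fun u => ((hmeas _).const_mul _).aemeasurable).symm
    _ ≤ ∫⁻ g, ENNReal.ofReal (gaussianPDFReal 0 1 g * Real.exp (g ^ 2 / 4)) := by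
        refine lintegral_mono fun g => ?_
        change ex (iid ι (polyOf d bin1)) (fun u => ENNReal.ofReal (gaussianPDFReal 0 1 g) *
          ENNReal.ofReal (Real.exp (g / Real.sqrt m * innerZ u r))) ≤ _
        rw [ex_const_mul, ENNReal.ofReal_mul (gaussianPDFReal_nonneg _ _ _)]
        gcongr
        refine (ex_row_exp_le hr _).trans (le_of_eq ?_)
        rw [div_pow, Real.sq_sqrt hm.le]
        congr 2
        field_simp
    _ = _ := lintegral_gaussian_exp_quarter

theorem projection_tail_bound : Real.exp (-(337 / 2)) * Real.sqrt 2 ^ 256 ≤ (1 / 2) ^ 103 := by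
  have e2 : Real.sqrt 2 ^ 256 = 2 ^ 128 := by
    have : Real.sqrt 2 ^ 256 = (Real.sqrt 2 ^ 2) ^ 128 := by ring
    rw [this, Real.sq_sqrt (by norm_num)]
  have h1 : (2.7 : ℝ) ^ 168 ≤ Real.exp (337 / 2) := by
    calc (2.7 : ℝ) ^ 168 ≤ Real.exp 1 ^ 168 :=
          pow_le_pow_left₀ (by norm_num) (by linarith [Real.exp_one_gt_d9]) _
      _ = Real.exp ((168 : ℕ) * 1) := (Real.exp_nat_mul 1 168).symm
      _ ≤ _ := by
        rw [Real.exp_le_exp]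
        norm_num
  rw [e2, Real.exp_neg, inv_mul_le_iff₀ (Real.exp_pos _)]
  refine le_trans ?_ (mul_le_mul_of_nonneg_right h1 (by positivity))
  norm_num

end Projection

end

end PoC

namespace PoC
noncomputable section

set_option linter.unusedSectionVars false

open ENNReal

variable {P : Params}

/-! ### Algebra of the protocol -/

section Algebra

theorem dotSigma_add {ι : Type} [Fintype ι] (u v w : ι → P.Rq) :
    dotSigma u (v + w) = dotSigma u v + dotSigma u w := by
  simp only [dotSigma, Pi.add_apply, mul_add, Finset.sum_add_distrib]

theorem dotSigma_smul {ι : Type} [Fintype ι] (u v : ι → P.Rq) (c : P.Rq) :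
    dotSigma u (c • v) = c * dotSigma u v := by
  simp only [dotSigma, Pi.smul_apply, smul_eq_mul, Finset.mul_sum]
  exact Finset.sum_congr rfl fun i _ => by ring

theorem combE_add (e : Ch2 P) (y z : Fin P.δ → P.Rq) :
    combE e (y + z) = combE e y + combE e z := by
  simp only [combE, dotSigma_add, smul_add, Finset.sum_add_distrib]

theorem combE_smul (e : Ch2 P) (c : P.Rq) (y : Fin P.δ → P.Rq) :
    combE e (c • y) = c * combE e y := by
  simp only [combE, dotSigma_smul, Finset.mul_sum, mul_smul_comm]

theorem combE_neg (e : Ch2 P) (y : Fin P.δ → P.Rq) : combE e (-y) = -combE e y := by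
  have := combE_smul e (-1) y
  rwa [neg_one_smul, neg_one_mul] at this

theorem combE_sub (e : Ch2 P) (y z : Fin P.δ → P.Rq) :
    combE e (y - z) = combE e y - combE e z := by
  rw [sub_eq_add_neg, combE_add, combE_neg, sub_eq_add_neg]

theorem combR_add (R : Ch1 P) (e : Ch2 P) (r s : Fin P.n → P.Rq) :
    combR R e (r + s) = combR R e r + combR R e s := by
  simp only [combR, dotSigma_add, smul_add, Finset.sum_add_distrib]

theorem combR_smul (R : Ch1 P) (e : Ch2 P) (c : P.Rq) (r : Fin P.n → P.Rq) :
    combR R e (c • r) = c * combR R e r := by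
  simp only [combR, dotSigma_smul, Finset.mul_sum, mul_smul_comm]

theorem combV_add (e : Ch2 P) (v w : P.Rq) : combV e (v + w) = combV e v + combV e w := by
  simp only [combV, mul_add, smul_add, Finset.sum_add_distrib]

theorem combV_mul (e : Ch2 P) (c v : P.Rq) : combV e (c * v) = c * combV e v := by
  simp only [combV, Finset.mul_sum, mul_smul_comm, mul_left_comm c]

theorem combV_neg (e : Ch2 P) (v : P.Rq) : combV e (-v) = -combV e v := by
  have := combV_mul e (-1) v
  rwa [neg_one_mul, neg_one_mul] at this

theorem combV_sub (e : Ch2 P) (v w : P.Rq) : combV e (v - w) = combV e v - combV e w := by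
  rw [sub_eq_add_neg, combV_add, combV_neg, sub_eq_add_neg]

theorem redV_add {ι : Type} (u v : ι → P.RZ) : redV (u + v) = redV u + redV v := by
  ext i
  exact map_add _ _ _

theorem redV_smul {ι : Type} (c : P.RZ) (u : ι → P.RZ) : redV (c • u) = red P.q c • redV u := by
  ext i
  exact map_mul _ _ _

/-- The product of the challenge matrix and the coefficient vector of `r`, modulo `q`. -/
def matQ (R : Ch1 P) (r : Fin P.n → P.Rq) : Fin P.δ → P.Rq :=
  fun a => ofCoeffs fun i => ∑ m, ∑ j, coeff (R a i m) j * coeff (r m) j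

theorem redV_matZ (R : Fin P.δ → Fin P.d → Fin P.n → P.RZ) (r : Fin P.n → P.RZ) :
    redV (matZ R r) = matQ (redCh1 R) (redV r) := by
  ext a
  rw [redV, matZ, red_ofCoeffs, matQ]
  congr 1
  ext i
  simp only [innerZ, redCh1, redV, coeff_red]
  push_cast
  rfl

theorem coeff_zero_combR (R : Ch1 P) (e : Ch2 P) (r : Fin P.n → P.Rq) :
    coeff (combR R e r) 0 = ∑ a, ∑ i, e.d1 a i * coeff (matQ R r a) i := by
  simp only [combR, coeff_sum, Finset.sum_apply, coeff_smul, Pi.smul_apply, coeff_zero_dotSigma,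
    smul_eq_mul, matQ, coeff_ofCoeffs]

theorem coeff_zero_dotSigma_eVec (a : Fin P.δ) (i : Fin P.d) (y : Fin P.δ → P.Rq) :
    coeff (dotSigma (eVec a i) y) 0 = coeff (y a) i := by
  rw [coeff_zero_dotSigma, Finset.sum_eq_single a]
  · simp [eVec, coeff_xbar_pow]
  · intro b _ hb
    simp [eVec, Pi.single_eq_of_ne hb, coeff_zero]
  · simp

theorem coeff_zero_combE (e : Ch2 P) (y : Fin P.δ → P.Rq) :
    coeff (combE e y) 0 = ∑ a, ∑ i, e.d1 a i * coeff (y a) i := by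
  simp only [combE, coeff_sum, Finset.sum_apply, coeff_smul, Pi.smul_apply,
    coeff_zero_dotSigma_eVec, smul_eq_mul]

/-- The index of the nonconstant coefficient `j + 1`. -/
def succIdx (j : Fin (P.d - 1)) : Fin P.d := ⟨j.val + 1, by have := j.2; omega⟩

theorem coeff_zero_combV (e : Ch2 P) (v : P.Rq) :
    coeff (combV e v) 0 = ∑ j, e.d2 j * coeff v (succIdx j) := by
  simp only [combV, coeff_sum, Finset.sum_apply, coeff_smul, Pi.smul_apply, smul_eq_mul]
  refine Finset.sum_congr rfl fun j _ => ?_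
  congr 1
  have : (xbar : P.Rq) ^ (j.val + 1) = xbar ^ (succIdx j : ℕ) := rfl
  rw [this, coeff_zero_sigma_mul]
  simp [coeff_xbar_pow]

theorem succIdx_ne_zero (j : Fin (P.d - 1)) : succIdx j ≠ 0 := by
  intro h
  have := congrArg Fin.val h
  simp [succIdx] at this

theorem coeff_zero_combV_of (e : Ch2 P) (v : P.Zq) :
    coeff (combV e (AdjoinRoot.of _ v)) 0 = 0 := by
  rw [coeff_zero_combV]
  simp [coeff_of, succIdx_ne_zero]

/-- The products of `s` with the rows of `A2`, `B1`, `Bc`, `Bc'`. -/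
def hideMul (hk : AuxKey P) (s : Fin P.n → P.Rq) : HideRows P → P.Rq :=
  Sum.elim (hk.A2.mulVec s) (Sum.elim (fun _ => hk.B1 ⬝ᵥ s)
    (Sum.elim (hk.Bc.mulVec s) fun _ => hk.Bc' ⬝ᵥ s))

/-- The transcript with given messages in which `w` and `v` are determined by the equations that
the verifier checks. -/
def simTranscript (x : Stmt P) (hk : AuxKey P) (m1 : Msg1 P) (R : Ch1 P) (z3 : Msg2 P) (e : Ch2 P)
    (h c : P.Rq) (z1 z2 : Fin P.n → P.Rq) : Transcript P where
  m1 := m1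
  ch1 := R
  m2 := z3
  ch2 := e
  m3 :=
    { h := h
      w := hk.A1.mulVec z1 + hk.A2.mulVec z2 - c • m1.f0
      v :=
        { v0 := x.1.A.mulVec z1 - c • x.2.com0
          v1 := x.1.pk1 ⬝ᵥ z1 + (c * m1.f1 - hk.B1 ⬝ᵥ z2) - c * x.2.com1
          v2 := x.1.pk2 ⬝ᵥ z1 + (P.sq : P.Rq) * (c * m1.f1 - hk.B1 ⬝ᵥ z2) - c * x.2.com2
          v3 := x.1.B ⬝ᵥ z1 + (c * m1.f1 - hk.B1 ⬝ᵥ z2) - c * x.2.com3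
          v4 := combR R e z1 + combV e (c * m1.f1 - hk.B1 ⬝ᵥ z2)
            + combE e (c • m1.u1 - hk.Bc.mulVec z2) + (c * m1.u2 - hk.Bc' ⬝ᵥ z2)
            - c * (h + combE e z3) } }
  c := c
  m4 := ⟨z1, z2⟩

theorem simTranscript_accepts (x : Stmt P) (hk : AuxKey P) (m1 : Msg1 P) (R : Ch1 P) (z3 : Msg2 P)
    (e : Ch2 P) (h c : P.Rq) (z1 z2 : Fin P.n → P.Rq) (h1 : norm2 z1 ≤ P.bound12)
    (h2 : norm2 z2 ≤ P.bound12) (h3 : (normInf z3 : ℝ) ≤ P.bound3) (h0 : coeff h 0 = 0) :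
    Accepts x hk (simTranscript x hk m1 R z3 e h c z1 z2) where
  norm_z1 := h1
  norm_z2 := h2
  norm_z3 := h3
  const_h := h0
  opening := by simp [simTranscript]
  v0 := rfl
  v1 := rfl
  v2 := rfl
  v3 := rfl
  v4 := rfl

/-- The first message that hides `(r, v, y3, g)` with the mask `t`. -/
def maskedMsg1 (hk : AuxKey P) (r : Fin P.n → P.Rq) (v : P.Zq) (t : HideRows P → P.Rq)
    (y3 : Fin P.δ → P.Rq) (g : P.Rq) : Msg1 P where
  f0 := hk.A1.mulVec r + fun i => t (.inl i)
  f1 := t (.inr (.inl ())) + AdjoinRoot.of _ v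
  u1 := (fun a => t (.inr (.inr (.inl a)))) + y3
  u2 := t (.inr (.inr (.inr ()))) + g

/-- The linear combination that masks `g` in the message `h`. -/
def combH (R : Ch1 P) (e : Ch2 P) (r : Fin P.n → P.Rq) (v : P.Zq) : P.Rq :=
  combR R e r - combE e (matQ R r) + combV e (AdjoinRoot.of _ v)

theorem coeff_zero_combH (R : Ch1 P) (e : Ch2 P) (r : Fin P.n → P.Rq) (v : P.Zq) :
    coeff (combH R e r v) 0 = 0 := by
  rw [combH, coeff_add, coeff_sub, Pi.add_apply, Pi.sub_apply, coeff_zero_combR, coeff_zero_combE,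
    coeff_zero_combV_of, sub_self, add_zero]

/-- The transcript determined by the mask `t`, the responses and the prover's input. -/
def hybTranscript (x : Stmt P) (hk : AuxKey P) (r : Fin P.n → P.Rq) (v : P.Zq)
    (t : HideRows P → P.Rq) (g : P.Rq) (R : Ch1 P) (e : Ch2 P) (c : P.Rq) (z3 : Msg2 P)
    (z1 z2 : Fin P.n → P.Rq) : Transcript P :=
  simTranscript x hk (maskedMsg1 hk r v t (z3 - matQ R r) g) R z3 e (g + combH R e r v) c z1 z2

theorem honest_eq_hybTranscript (x : Stmt P) (hk : AuxKey P) (r s y1 y2 : Fin P.n → P.Rq) (v : P.Zq)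
    (hx : x.2 = commit x.1 (AdjoinRoot.of _ v) ((P.sq : P.Rq) * AdjoinRoot.of _ v)
      (AdjoinRoot.of _ v) r)
    (g : P.Rq) (R : Ch1 P) (e : Ch2 P) (c : P.Rq) (y3 : Fin P.δ → P.Rq) :
    (⟨⟨hk.A1.mulVec r + hk.A2.mulVec s, hk.B1 ⬝ᵥ s + AdjoinRoot.of _ v, hk.Bc.mulVec s + y3,
        hk.Bc' ⬝ᵥ s + g⟩, R, y3 + matQ R r, e,
      ⟨g + (combR R e r + combE e y3 - combE e (y3 + matQ R r) + combV e (AdjoinRoot.of _ v)),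
        hk.A1.mulVec y1 + hk.A2.mulVec y2,
        relT x.1 R e y1 (-(hk.B1 ⬝ᵥ y2)) (-(hk.Bc.mulVec y2)) (-(hk.Bc' ⬝ᵥ y2))⟩, c,
      ⟨y1 + c • r, y2 + c • s⟩⟩ : Transcript P)
    = hybTranscript x hk r v (hideMul hk s) g R e c (y3 + matQ R r) (y1 + c • r) (y2 + c • s) := by
  have e1 : (y3 + matQ R r) - matQ R r = y3 := add_sub_cancel_right _ _
  simp only [hybTranscript, simTranscript, maskedMsg1, hideMul, Sum.elim_inl, Sum.elim_inr, e1,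
    Transcript.mk.injEq, Msg3.mk.injEq, true_and, and_true]
  refine ⟨?_, ?_, ?_⟩
  · rw [combH, combE_add]
    ring
  · ext i
    simp only [Matrix.mulVec_add, Matrix.mulVec_smul, Pi.add_apply, Pi.sub_apply, Pi.smul_apply,
      smul_eq_mul]
    ring
  · rw [hx]
    ext i
    · simp only [relT, commit, Matrix.mulVec_add, Matrix.mulVec_smul, Pi.add_apply, Pi.sub_apply,
        Pi.smul_apply, smul_eq_mul]
      ring
    · simp only [relT, commit, dotProduct_add, dotProduct_smul, smul_eq_mul]
      ring
    · simp only [relT, commit, dotProduct_add, dotProduct_smul, smul_eq_mul]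
      ring
    · simp only [relT, commit, dotProduct_add, dotProduct_smul, smul_eq_mul]
      ring
    · have e2 : c • (hk.Bc.mulVec s + y3) - hk.Bc.mulVec (y2 + c • s) = c • y3 - hk.Bc.mulVec y2 := by
        rw [Matrix.mulVec_add, Matrix.mulVec_smul, smul_add]
        abel
      have e3 : c * (hk.B1 ⬝ᵥ s + AdjoinRoot.of _ v) - hk.B1 ⬝ᵥ (y2 + c • s)
          = c * AdjoinRoot.of _ v - hk.B1 ⬝ᵥ y2 := by
        rw [dotProduct_add, dotProduct_smul, smul_eq_mul]
        ring
      have e4 : (fun a => hk.Bc.mulVec s a) + y3 = hk.Bc.mulVec s + y3 := rfl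
      rw [e4, e2, e3]
      simp only [relT, combH, combR_add, combR_smul, combE_add, combE_sub, combE_neg, combE_smul,
        combV_sub, combV_mul, combV_neg, dotProduct_add, dotProduct_smul, smul_eq_mul]
      ring

end Algebra

end

end PoC

namespace PoC
noncomputable section

set_option linter.unusedSectionVars false

open ENNReal

variable {P : Params}

/-! ### The honest run without aborts -/

section Honest

theorem monad_bind_eq {α β : Type} (μ : PMF α) (f : α → PMF β) : μ >>= f = μ.bind f := rfl

/-- The law of Gaussian responses of width `σ`, over the integers. -/
abbrev gaussVec (P : Params) (ι : Type) [Fintype ι] (σ : ℝ) : PMF (ι → P.RZ) :=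
  iid ι (polyOf P.d (discreteGaussian σ))

/-- The run with mask `t` in which the responses are Gaussian and independent of the secrets. -/
def hybRun (x : Stmt P) (hk : AuxKey P) (r : Fin P.n → P.Rq) (v : P.Zq) (t : HideRows P → P.Rq) :
    PMF (Transcript P) :=
  (unifZeroConst P).bind fun g =>
  (ch1LawZ P).bind fun R =>
  (ch2Law P).bind fun e =>
  P.chal.bind fun c =>
  (gaussVec P (Fin P.δ) P.s3).bind fun z3 =>
  (gaussVec P (Fin P.n) P.s12).bind fun z1 =>
  (gaussVec P (Fin P.n) P.s12).bind fun z2 =>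
  PMF.pure (hybTranscript x hk r v t g (redCh1 R) e (red P.q c) (redV z3) (redV z1) (redV z2))

/-- The law of the commitment randomness `s`. -/
abbrev secretLaw (P : Params) : PMF (Fin P.n → P.RZ) := iid (Fin P.n) (polyOf P.d P.χ)

def idealRun (x : Stmt P) (hk : AuxKey P) (r : Fin P.n → P.Rq) (v : P.Zq) : PMF (Transcript P) :=
  (secretLaw P).bind fun s => hybRun x hk r v (hideMul hk (redV s))

theorem n_mul_d_pos (P : Params) : (0 : ℝ) < P.n * P.d := by
  have h1 : 0 < P.d := Nat.pos_of_ne_zero (NeZero.ne _)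
  have h2 : 0 < P.n := by simp [Params.n]
  exact_mod_cast Nat.mul_pos h2 h1

theorem s12_pos (P : Params) : 0 < P.s12 := by
  have h1 := n_mul_d_pos P
  have h2 := P.ω_pos
  have h3 : (0 : ℝ) < P.ω := by exact_mod_cast h2
  rw [Params.s12]
  have := Real.sqrt_pos.2 h1
  positivity

theorem s3_pos (P : Params) : 0 < P.s3 := by
  have h1 := Real.sqrt_pos.2 (n_mul_d_pos P)
  rw [Params.s3]
  positivity

theorem s12_sq (P : Params) : P.s12 ^ 2 / 121 = P.ω ^ 2 * (P.n * P.d) := by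
  rw [Params.s12, mul_pow, Real.sq_sqrt (n_mul_d_pos P).le]
  ring

theorem s3_sq (P : Params) : P.s3 ^ 2 / 121 = 337 * (P.n * P.d) := by
  rw [Params.s3, mul_pow, mul_pow, Real.sq_sqrt (n_mul_d_pos P).le, Real.sq_sqrt (by norm_num)]
  ring

theorem innerZ_self_le_of_ternary {r : Fin P.n → P.RZ}
    (h : ∀ i j, coeff (r i) j = -1 ∨ coeff (r i) j = 0 ∨ coeff (r i) j = 1) :
    (innerZ r r : ℝ) ≤ P.n * P.d := by
  have : innerZ r r ≤ ∑ _i : Fin P.n, ∑ _j : Fin P.d, 1 := by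
    refine Finset.sum_le_sum fun i _ => Finset.sum_le_sum fun j _ => ?_
    rcases h i j with h | h | h <;> simp [h]
  simp only [Finset.sum_const, Finset.card_univ, Fintype.card_fin, nsmul_eq_mul, mul_one] at this
  exact_mod_cast this

theorem secretLaw_support {s : Fin P.n → P.RZ} (hs : s ∈ (secretLaw P).support) (i j) :
    coeff (s i) j = -1 ∨ coeff (s i) j = 0 ∨ coeff (s i) j = 1 :=
  P.χ_supp _ (mem_support_polyOf.1 (mem_support_iid.1 hs i) j)

theorem coin_true_ne_zero {t : ℝ} (ht : 0 < t) : coin t true ≠ 0 := by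
  simp [coin, ht]

theorem exists_small_ternaryPoly (P : Params) :
    ∃ c ∈ {c : P.RZ | l1Z c ≤ P.ω}, c ∈ P.ternaryPoly.support := by
  refine ⟨0, by simp [l1Z, coeff_zero], mem_support_polyOf.2 fun j => ?_⟩
  rw [coeff_zero, ternary, PMF.mem_support_bind_iff]
  exact ⟨true, coin_true_ne_zero P.p_pos, by simp⟩

theorem l1Z_le_of_mem_chal {c : P.RZ} (hc : c ∈ P.chal.support) : l1Z c ≤ P.ω := by
  rw [Params.chal, condOn, dif_pos (exists_small_ternaryPoly P)] at hc
  exact (PMF.mem_support_filter_iff _).1 hc |>.1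

theorem innerZ_chal_smul_le {c : P.RZ} (hc : c ∈ P.chal.support) {r : Fin P.n → P.RZ}
    (h : ∀ i j, coeff (r i) j = -1 ∨ coeff (r i) j = 0 ∨ coeff (r i) j = 1) :
    (innerZ (c • r) (c • r) : ℝ) ≤ P.s12 ^ 2 / 121 := by
  have h1 : (innerZ (c • r) (c • r) : ℝ) ≤ (l1Z c : ℝ) ^ 2 * innerZ r r := by
    exact_mod_cast innerZ_smul_le c r
  have h2 := innerZ_self_le_of_ternary h
  have h3 : (l1Z c : ℝ) ≤ P.ω := by exact_mod_cast l1Z_le_of_mem_chal hc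
  have h4 : (0 : ℝ) ≤ innerZ r r := by exact_mod_cast innerZ_self_nonneg r
  rw [s12_sq]
  refine h1.trans ?_
  gcongr

theorem δ_mul_d (P : Params) : P.δ * P.d = 256 := Nat.div_mul_cancel P.d_dvd

theorem innerZ_matZ (R : Fin P.δ → Fin P.d → Fin P.n → P.RZ) (r : Fin P.n → P.RZ) :
    innerZ (matZ R r) (matZ R r) = ∑ a, ∑ i, innerZ (R a i) r ^ 2 := by
  simp only [innerZ, matZ, coeff_ofCoeffs, sq]

open Classical in
/-- The random projection is short except with small probability. -/
theorem ex_matZ_tail {r : Fin P.n → P.RZ} (hr : (innerZ r r : ℝ) ≤ P.n * P.d) :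
    ex (ch1LawZ P) (fun R => if P.s3 ^ 2 / 121 < (innerZ (matZ R r) (matZ R r) : ℝ) then 1 else 0)
      ≤ ENNReal.ofReal ((1 / 2) ^ 103) := by
  set m : ℝ := P.n * P.d with hm
  have hm0 : 0 < m := n_mul_d_pos P
  have h1 : ∀ R : Fin P.δ → Fin P.d → Fin P.n → P.RZ,
      (if P.s3 ^ 2 / 121 < (innerZ (matZ R r) (matZ R r) : ℝ) then 1 else 0 : ℝ≥0∞)
      ≤ ENNReal.ofReal (Real.exp (-(337 / 2)))
        * ∏ a, ∏ i, ENNReal.ofReal (Real.exp ((innerZ (R a i) r : ℝ) ^ 2 / (2 * m))) := by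
    intro R
    split_ifs with h
    · simp only [← ofReal_exp_sum]
      rw [← ENNReal.ofReal_mul (Real.exp_pos _).le, ENNReal.one_le_ofReal, ← Real.exp_add]
      refine Real.one_le_exp ?_
      rw [s3_sq, ← hm, innerZ_matZ] at h
      push_cast at h
      simp only [← Finset.sum_div]
      have : 337 / 2 ≤ (∑ a, ∑ i, (innerZ (R a i) r : ℝ) ^ 2) / (2 * m) := by
        rw [le_div_iff₀ (by positivity)]
        linarith
      linarith
    · exact zero_le
  refine (ex_mono h1).trans ?_
  rw [ex_const_mul, ch1LawZ,
    ex_iid_prod (iid (Fin P.d) (iid (Fin P.n) (polyOf P.d bin1))) fun _ (Ra : Fin P.d → _) =>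
      ∏ i, ENNReal.ofReal (Real.exp ((innerZ (Ra i) r : ℝ) ^ 2 / (2 * m)))]
  have h2 : ∀ a : Fin P.δ, ex (iid (Fin P.d) (iid (Fin P.n) (polyOf P.d bin1)))
      (fun Ra => ∏ i, ENNReal.ofReal (Real.exp ((innerZ (Ra i) r : ℝ) ^ 2 / (2 * m))))
      ≤ ∏ _i : Fin P.d, ENNReal.ofReal (Real.sqrt 2) := by
    intro a
    rw [ex_iid_prod (iid (Fin P.n) (polyOf P.d bin1)) fun _ u =>
      ENNReal.ofReal (Real.exp ((innerZ u r : ℝ) ^ 2 / (2 * m)))]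
    exact Finset.prod_le_prod' fun i _ => ex_row_exp_sq_le hm0 hr
  refine (mul_le_mul_right (Finset.prod_le_prod' fun a _ => h2 a) _).trans ?_
  simp only [Finset.prod_const, Finset.card_univ, Fintype.card_fin]
  rw [← pow_mul, mul_comm P.d, δ_mul_d, ← ENNReal.ofReal_pow (Real.sqrt_nonneg _),
    ← ENNReal.ofReal_mul (Real.exp_pos _).le]
  exact ENNReal.ofReal_le_ofReal projection_tail_bound

theorem ex_comm_out {α β γ δ : Type} (μ₁ : PMF α) (μ₂ : PMF β) (μ₃ : PMF γ) (ν : PMF δ)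
    (f : α → β → γ → δ → ℝ≥0∞) :
    (ex μ₁ fun a => ex μ₂ fun b => ex μ₃ fun c => ex ν fun x => f a b c x)
      = ex ν fun x => ex μ₁ fun a => ex μ₂ fun b => ex μ₃ fun c => f a b c x := by
  simp only [ex_comm μ₃ ν, ex_comm μ₂ ν]
  rw [ex_comm μ₁ ν]

theorem ex_honestRun (x : Stmt P) (hk : AuxKey P) (r : Fin P.n → P.RZ) (v : P.Zq)
    (hx : HonestInput x r v) (F : Option (Transcript P) → ℝ≥0∞) (h0 : F none = 0) :
    ex (honestRun x hk r v) F =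
      ex (secretLaw P) fun s => ex (unifZeroConst P) fun g => ex (ch1LawZ P) fun R =>
      ex (ch2Law P) fun e => ex P.chal fun c =>
      ex (gaussVec P (Fin P.δ) P.s3) fun y3 => rejProb (y3 + matZ R r) (matZ R r) P.s3 *
      ex (gaussVec P (Fin P.n) P.s12) fun y1 => rejProb (y1 + c • r) (c • r) P.s12 *
      ex (gaussVec P (Fin P.n) P.s12) fun y2 => rejProb (y2 + c • s) (c • s) P.s12 *
      F (some (hybTranscript x hk (redV r) v (hideMul hk (redV s)) g (redCh1 R) e (red P.q c)
        (redV (y3 + matZ R r)) (redV (y1 + c • r)) (redV (y2 + c • s)))) := by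
  unfold honestRun
  simp only [monad_bind_eq, ex_bind, ex_rej, if_true, if_false, Bool.true_eq_false, ex_pure, h0,
    mul_zero, add_zero, or_true, or_false]
  congr 1
  ext s
  congr 1
  ext g
  simp only [← ex_const_mul]
  rw [ex_comm_out]
  congr 1
  ext R
  rw [ex_comm_out]
  congr 1
  ext e
  rw [ex_comm_out]
  congr 1
  ext c
  have reorder : ∀ f : (Fin P.n → P.RZ) → (Fin P.n → P.RZ) → (Fin P.δ → P.RZ) → ℝ≥0∞,
      (ex (gaussVec P (Fin P.n) P.s12) fun y1 => ex (gaussVec P (Fin P.n) P.s12) fun y2 =>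
        ex (gaussVec P (Fin P.δ) P.s3) fun y3 => f y1 y2 y3)
      = ex (gaussVec P (Fin P.δ) P.s3) fun y3 => ex (gaussVec P (Fin P.n) P.s12) fun y1 =>
        ex (gaussVec P (Fin P.n) P.s12) fun y2 => f y1 y2 y3 := by
    intro f
    rw [ex_comm (gaussVec P (Fin P.δ) P.s3)]
    congr 1
    ext y1
    rw [ex_comm]
  rw [reorder]
  congr 1
  ext y3
  congr 1
  ext y1
  congr 1
  ext y2
  congr 3
  simp only [redV_add, redV_smul, redV_matZ]
  rw [← honest_eq_hybTranscript x hk (redV r) (redV s) (redV y1) (redV y2) v hx.2]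

end Honest

end

end PoC

namespace PoC
noncomputable section

set_option linter.unusedSectionVars false

open ENNReal

variable {P : Params}

section Completeness

theorem ex_hybRun (x : Stmt P) (hk : AuxKey P) (r : Fin P.n → P.Rq) (v : P.Zq)
    (t : HideRows P → P.Rq) (f : Transcript P → ℝ≥0∞) : ex (hybRun x hk r v t) f =
      ex (unifZeroConst P) fun g => ex (ch1LawZ P) fun R =>
      ex (ch2Law P) fun e => ex P.chal fun c =>
      ex (gaussVec P (Fin P.δ) P.s3) fun z3 => ex (gaussVec P (Fin P.n) P.s12) fun z1 =>
      ex (gaussVec P (Fin P.n) P.s12) fun z2 =>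
      f (hybTranscript x hk r v t g (redCh1 R) e (red P.q c) (redV z3) (redV z1) (redV z2)) := by
  simp only [hybRun, ex_bind, ex_pure]

/-- The honest run has at most `1/27` of the density of the ideal run. -/
theorem ex_honestRun_le (x : Stmt P) (hk : AuxKey P) (r : Fin P.n → P.RZ) (v : P.Zq)
    (hx : HonestInput x r v) (F : Option (Transcript P) → ℝ≥0∞) (h0 : F none = 0) :
    ex (honestRun x hk r v) F
      ≤ ENNReal.ofReal (1 / 27) * ex (idealRun x hk (redV r) v) fun τ => F (some τ) := by
  rw [ex_honestRun x hk r v hx F h0, idealRun, ex_bind, ← ex_const_mul]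
  refine ex_mono fun s => ?_
  rw [ex_hybRun, ← ex_const_mul]
  refine ex_mono fun g => ?_
  rw [← ex_const_mul]
  refine ex_mono fun R => ?_
  rw [← ex_const_mul]
  refine ex_mono fun e => ?_
  rw [← ex_const_mul]
  refine ex_mono fun c => ?_
  set Φ := fun z3 z1 z2 => F (some (hybTranscript x hk (redV r) v (hideMul hk (redV s)) g (redCh1 R) e
    (red P.q c) (redV z3) (redV z1) (redV z2)))
  refine (ex_rejProb_mul_le (s3_pos P) (matZ R r) fun z3 => ex (gaussVec P (Fin P.n) P.s12) fun y1 =>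
    rejProb (y1 + c • r) (c • r) P.s12 * ex (gaussVec P (Fin P.n) P.s12) fun y2 =>
    rejProb (y2 + c • s) (c • s) P.s12 * Φ z3 (y1 + c • r) (y2 + c • s)).trans ?_
  have e27 : ENNReal.ofReal (1 / 27) = ENNReal.ofReal (1 / 3) *
      (ENNReal.ofReal (1 / 3) * ENNReal.ofReal (1 / 3)) := by
    rw [← ENNReal.ofReal_mul (by norm_num), ← ENNReal.ofReal_mul (by norm_num)]
    norm_num
  rw [e27, mul_assoc]
  gcongr
  rw [← ex_const_mul]
  refine ex_mono fun z3 => ?_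
  refine (ex_rejProb_mul_le (s12_pos P) (c • r) fun z1 => ex (gaussVec P (Fin P.n) P.s12) fun y2 =>
    rejProb (y2 + c • s) (c • s) P.s12 * Φ z3 z1 (y2 + c • s)).trans ?_
  rw [mul_assoc]
  gcongr
  rw [← ex_const_mul]
  exact ex_mono fun z1 => ex_rejProb_mul_le (s12_pos P) (c • s) (Φ z3 z1)

/-- A lower bound on the probability that the honest prover does not abort. -/
def liveProb : ℝ := (1 / 3 * (1 - (1 / 2) ^ 103)) ^ 3 * (1 - (1 / 2) ^ 103)

theorem le_ex_honestRun (x : Stmt P) (hk : AuxKey P) (r : Fin P.n → P.RZ) (v : P.Zq)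
    (hx : HonestInput x r v) (F : Option (Transcript P) → ℝ≥0∞) (h0 : F none = 0)
    (h1 : ∀ τ, F (some τ) = 1) : ENNReal.ofReal liveProb ≤ ex (honestRun x hk r v) F := by
  classical
  set a := ENNReal.ofReal (1 / 3 * (1 - (1 / 2) ^ 103)) with ha
  have ha1 : (0 : ℝ) ≤ 1 / 3 * (1 - (1 / 2) ^ 103) := by norm_num
  have hlive : ENNReal.ofReal liveProb = a ^ 3 * ENNReal.ofReal (1 - (1 / 2) ^ 103) := by
    rw [liveProb, ENNReal.ofReal_mul (by positivity), ENNReal.ofReal_pow ha1]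
  rw [ex_honestRun x hk r v hx F h0, hlive]
  simp only [h1, mul_one]
  refine const_le_ex_support fun s hs => const_le_ex_support fun g _ => ?_
  have hR := ex_matZ_tail (P := P) (innerZ_self_le_of_ternary hx.1)
  have hgood : ENNReal.ofReal (1 - (1 / 2) ^ 103) ≤ ex (ch1LawZ P) fun R =>
      if P.s3 ^ 2 / 121 < (innerZ (matZ R r) (matZ R r) : ℝ) then 0 else 1 := by
    rw [ENNReal.ofReal_sub _ (by positivity), ENNReal.ofReal_one]
    refine tsub_le_iff_right.2 (le_trans ?_ (add_le_add_right hR _))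
    rw [← ex_add]
    refine const_le_ex_support fun z _ => ?_
    split_ifs <;> simp
  refine (mul_le_mul_right hgood _).trans ?_
  rw [← ex_const_mul]
  refine ex_mono fun R => ?_
  split_ifs with hR
  · simp
  rw [mul_one]
  refine const_le_ex_support fun e _ => const_le_ex_support fun c hc => ?_
  have h12 : a ^ 2 ≤ ex (gaussVec P (Fin P.n) P.s12) fun y1 => rejProb (y1 + c • r) (c • r) P.s12 *
      ex (gaussVec P (Fin P.n) P.s12) fun y2 => rejProb (y2 + c • s) (c • s) P.s12 := by
    rw [ex_mul_const, sq]
    exact mul_le_mul' (le_ex_rejProb (s12_pos P) _ (innerZ_chal_smul_le hc hx.1))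
      (le_ex_rejProb (s12_pos P) _ (innerZ_chal_smul_le hc (secretLaw_support hs)))
  rw [ex_mul_const, pow_succ' a 2]
  exact mul_le_mul' (le_ex_rejProb (s3_pos P) _ (not_lt.1 hR)) h12

theorem liveProb_bound : 1 / 27 ≤ (1 + (1 / 2) ^ 100) * liveProb := by
  norm_num [liveProb]

theorem exists_live (x : Stmt P) (hk : AuxKey P) (r : Fin P.n → P.RZ) (v : P.Zq)
    (hx : HonestInput x r v) :
    ∃ o ∈ {o : Option (Transcript P) | o.isSome}, o ∈ (honestRun x hk r v).support := by
  classical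
  by_contra! h
  have h1 := le_ex_honestRun x hk r v hx (fun o => if o.isSome then 1 else 0) (by simp) (by simp)
  rw [ex_congr_support (g := fun _ => 0), ex_const] at h1
  · have h2 : (0 : ℝ) < liveProb := by norm_num [liveProb]
    exact absurd h1 (by simpa using h2)
  · intro o ho
    have : ¬ o.isSome := fun h' => h o h' ho
    simp [this]

/-- Conditioned on not aborting, the honest run is dominated by the ideal run. -/
theorem ex_nonAborting_le (x : Stmt P) (hk : AuxKey P) (r : Fin P.n → P.RZ) (v : P.Zq)
    (hx : HonestInput x r v) (F : Option (Transcript P) → ℝ≥0∞) :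
    ex (nonAborting x hk r v) F
      ≤ ENNReal.ofReal (1 + (1 / 2) ^ 100) * ex (idealRun x hk (redV r) v) fun τ => F (some τ) := by
  classical
  have h1 := ex_condOn_le (honestRun x hk r v) {o | o.isSome} F (exists_live x hk r v hx)
  have h2 := ex_honestRun_le x hk r v hx (fun o => if o ∈ {o | Option.isSome o} then F o else 0)
    (by simp)
  have h3 := le_ex_honestRun x hk r v hx (fun o => if o ∈ {o | Option.isSome o} then 1 else 0)
    (by simp) (by simp)
  have hpos : (0 : ℝ) < liveProb := by norm_num [liveProb]
  have h4 : ex (nonAborting x hk r v) F * ENNReal.ofReal liveProb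
      ≤ ENNReal.ofReal (1 / 27) * ex (idealRun x hk (redV r) v) fun τ => F (some τ) := by
    refine (mul_le_mul_right h3 _).trans ?_
    rw [nonAborting]
    convert h1.le.trans ?_
    refine le_of_eq_of_le (by congr!) (h2.trans (mul_le_mul_right (ex_mono fun τ => ?_) _))
    simp
  have h5 : ex (nonAborting x hk r v) F * ENNReal.ofReal liveProb
      ≤ (ENNReal.ofReal (1 + (1 / 2) ^ 100) * ex (idealRun x hk (redV r) v) fun τ => F (some τ))
        * ENNReal.ofReal liveProb := by
    refine h4.trans ?_
    rw [mul_right_comm, ← ENNReal.ofReal_mul (by positivity)]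
    gcongr
    exact liveProb_bound
  exact (ENNReal.mul_le_mul_iff_left (by simpa using hpos) ENNReal.ofReal_ne_top).1 h5

theorem ex_iid_coord {ι α : Type} [Fintype ι] (μ : PMF α) (i : ι) (f : α → ℝ≥0∞) :
    ex (iid ι μ) (fun v => f (v i)) = ex μ f := by
  classical
  rw [ex_iid_resample μ i]
  simp only [Function.update_self, ex_const]

open Classical in
theorem ex_bound3_tail : ex (gaussVec P (Fin P.δ) P.s3)
    (fun z => if (normInf (redV z) : ℝ) ≤ P.bound3 then 0 else 1)
      ≤ ENNReal.ofReal (256 * (2 * Real.exp (-P.k))) := by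
  have h1 : ∀ z : Fin P.δ → P.RZ, (if (normInf (redV z) : ℝ) ≤ P.bound3 then 0 else 1 : ℝ≥0∞)
      ≤ ∑ a, ∑ i, if P.bound3 < |((coeff (z a) i : ℤ) : ℝ)| then 1 else 0 := by
    intro z
    split_ifs with h
    · exact zero_le
    · by_contra! hlt
      apply h
      have hall : ∀ a i, ¬ P.bound3 < |((coeff (z a) i : ℤ) : ℝ)| := by
        intro a i hai
        refine absurd hlt (not_lt.2 ?_)
        refine le_trans ?_ (Finset.single_le_sum (fun _ _ => zero_le) (Finset.mem_univ a))
        refine le_trans ?_ (Finset.single_le_sum (fun _ _ => zero_le) (Finset.mem_univ i))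
        rw [if_pos hai]
      have hb0 : 0 ≤ P.bound3 := mul_nonneg (Real.sqrt_nonneg _) (s3_pos P).le
      have hnat : normInf (redV z) ≤ ⌊P.bound3⌋₊ := by
        refine Finset.sup_le fun a _ => Finset.sup_le fun i _ => Nat.le_floor ?_
        rw [redV, coeff_red]
        have h2 := Int.natAbs_le_iff_sq_le.2 (valMinAbs_intCast_sq_le (q := P.q) (coeff (z a) i))
        refine le_trans ?_ (not_lt.1 (hall a i))
        rw [← Int.cast_abs, Int.abs_eq_natAbs, Int.cast_natCast]
        exact Nat.cast_le.2 h2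
      exact (Nat.cast_le.2 hnat).trans (Nat.floor_le hb0)
  refine (ex_mono h1).trans ?_
  simp only [ex_finset_sum]
  have h2 : ∀ (a : Fin P.δ) (i : Fin P.d), ex (gaussVec P (Fin P.δ) P.s3)
      (fun z => if P.bound3 < |((coeff (z a) i : ℤ) : ℝ)| then 1 else 0)
      ≤ ENNReal.ofReal (2 * Real.exp (-P.k)) := by
    intro a i
    rw [ex_iid_coord _ a fun u : P.RZ => if P.bound3 < |((coeff u i : ℤ) : ℝ)| then 1 else 0, ex_polyOf]
    simp only [coeff_ofCoeffs]
    rw [ex_iid_coord _ i fun u : ℤ => if P.bound3 < |(u : ℝ)| then 1 else 0]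
    exact ex_discreteGaussian_tail (s3_pos P) (Nat.cast_nonneg _)
  refine (Finset.sum_le_sum fun a _ => Finset.sum_le_sum fun i _ => h2 a i).trans (le_of_eq ?_)
  simp only [Finset.sum_const, Finset.card_univ, Fintype.card_fin, smul_smul, δ_mul_d]
  rw [nsmul_eq_mul, ← ENNReal.ofReal_natCast, ← ENNReal.ofReal_mul (by positivity)]
  norm_num

open Classical in
theorem ex_bound12_tail : ex (gaussVec P (Fin P.n) P.s12)
    (fun z => if norm2 (redV z) ≤ P.bound12 then 0 else 1)
      ≤ ENNReal.ofReal (2 ^ (-(P.n * P.d : ℝ) / 8)) := by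
  have h := ex_gaussian_norm_tail (d := P.d) (ι := Fin P.n) (s12_pos P)
  rw [Fintype.card_fin] at h
  refine le_trans (ex_mono fun z => ?_) h
  split_ifs with h1 h2 h2
  · exact zero_le
  · exact le_rfl
  · exact le_rfl
  · exfalso
    apply h1
    refine (norm2_red_le z).trans ?_
    rw [Params.bound12, Real.sqrt_le_left
      (mul_nonneg (s12_pos P).le (Real.sqrt_nonneg _)), mul_pow,
      Real.sq_sqrt (by positivity)]
    linarith [not_lt.1 h2]

theorem coeff_zero_of_mem_unifZeroConst {g : P.Rq} (hg : g ∈ (unifZeroConst P).support) :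
    coeff g 0 = 0 := by
  obtain ⟨f, _, rfl⟩ := (PMF.mem_support_map_iff _ _ _).1 hg
  rw [coeff_ofCoeffs, Function.update_self]

open Classical in
theorem ex_idealRun_reject (x : Stmt P) (hk : AuxKey P) (r : Fin P.n → P.Rq) (v : P.Zq) :
    ex (idealRun x hk r v) (fun τ => if Accepts x hk τ then 0 else 1)
      ≤ ENNReal.ofReal (2 * 2 ^ (-(P.n * P.d : ℝ) / 8) + 256 * (2 * Real.exp (-P.k))) := by
  rw [idealRun, ex_bind]
  refine ex_le_const fun s => ?_
  rw [ex_hybRun]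
  refine ex_le_const_support fun g hg => ex_le_const fun R => ex_le_const fun e =>
    ex_le_const fun c => ?_
  have h1 : ∀ z3 z1 z2, (if Accepts x hk (hybTranscript x hk r v (hideMul hk (redV s)) g (redCh1 R) e
      (red P.q c) (redV z3) (redV z1) (redV z2)) then 0 else 1 : ℝ≥0∞)
      ≤ (if (normInf (redV z3) : ℝ) ≤ P.bound3 then 0 else 1)
        + ((if norm2 (redV z1) ≤ P.bound12 then 0 else 1)
        + (if norm2 (redV z2) ≤ P.bound12 then 0 else 1)) := by
    intro z3 z1 z2
    by_cases a1 : (normInf (redV z3) : ℝ) ≤ P.bound3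
    · by_cases a2 : norm2 (redV z1) ≤ P.bound12
      · by_cases a3 : norm2 (redV z2) ≤ P.bound12
        · rw [if_pos]
          · exact zero_le
          · refine simTranscript_accepts x hk _ _ _ _ _ _ _ _ a2 a3 a1 ?_
            rw [coeff_add, Pi.add_apply, coeff_zero_combH, add_zero,
              coeff_zero_of_mem_unifZeroConst hg]
        · rw [if_neg a3]
          refine le_trans ?_ (le_add_left (le_add_left le_rfl))
          split_ifs <;> simp
      · rw [if_neg a2]
        refine le_trans ?_ (le_add_left (le_add_right le_rfl))
        split_ifs <;> simp
    · rw [if_neg a1]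
      refine le_trans ?_ (le_add_right le_rfl)
      split_ifs <;> simp
  refine (ex_mono fun z3 => ex_mono fun z1 => ex_mono fun z2 => h1 z3 z1 z2).trans ?_
  simp only [ex_add, ex_const]
  refine (add_le_add ex_bound3_tail (add_le_add ex_bound12_tail ex_bound12_tail)).trans (le_of_eq ?_)
  rw [← ENNReal.ofReal_add (by positivity) (by positivity),
    ← ENNReal.ofReal_add (by positivity) (by positivity)]
  congr 1
  ring

theorem isComplete (P : Params) : IsComplete P := by
  classical
  intro x hk r v hx
  have e100 : (2 : ℝ) ^ (-100 : ℝ) = (1 / 2) ^ 100 := by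
    rw [Real.rpow_neg (by norm_num), one_div, inv_pow]
    norm_cast
  constructor
  · have h1 := le_ex_honestRun x hk r v hx (fun o => if o ∈ {o | Option.isSome o} then 1 else 0)
      (by simp) (by simp)
    have h2 : liveProb ≤ Pr (honestRun x hk r v) {o | o.isSome} := by
      rw [Pr_eq_ex]
      exact (ENNReal.ofReal_le_iff_le_toReal
        (ne_top_of_le_ne_top one_ne_top (ex_indicator_le_one _ _))).1 (by convert h1)
    refine le_trans ?_ h2
    rw [e100]
    norm_num [liveProb]
  · set T := 2 * 2 ^ (-(P.n * P.d : ℝ) / 8) + 256 * (2 * Real.exp (-P.k)) with hT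
    have hT0 : 0 ≤ T := by positivity
    set S := {o : Option (Transcript P) | ∃ τ, o = some τ ∧ Accepts x hk τ} with hS
    have h1 := Pr_add_compl (nonAborting x hk r v) S
    have h2 : Pr (nonAborting x hk r v) Sᶜ ≤ (1 + (1 / 2) ^ 100) * T := by
      rw [Pr_eq_ex]
      refine ENNReal.toReal_le_of_le_ofReal (by positivity) ?_
      refine (ex_nonAborting_le x hk r v hx _).trans ?_
      rw [ENNReal.ofReal_mul (by positivity)]
      gcongr
      refine le_trans (ex_mono fun τ => ?_) (ex_idealRun_reject x hk (redV r) v)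
      by_cases h : Accepts x hk τ <;> simp [hS, h]
    have h3 : Pr (nonAborting x hk r v) Sᶜ ≤ 1 := Pr_le_one _ _
    rw [e100]
    have : Pr (nonAborting x hk r v) Sᶜ ≤ T + (1 / 2) ^ 100 := by
      rcases le_total T 1 with h | h
      · have : (1 / 2 : ℝ) ^ 100 * T ≤ (1 / 2) ^ 100 * 1 := by gcongr
        linarith
      · have : (0 : ℝ) ≤ (1 / 2) ^ 100 := by positivity
        linarith
    linarith

end Completeness

end

end PoC

namespace PoC
noncomputable section

set_option linter.unusedSectionVars false

/-! ### Encodings are faithful -/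

/-- Decoding inverts encoding. -/
class LawfulWires (K T : Type) [Wires K T] : Prop where
  dec_enc : ∀ a : T, Wires.dec (K := K) (Wires.enc a) = a

namespace LawfulWires

instance self (K : Type) : LawfulWires K K := ⟨fun _ => rfl⟩

instance prod (K S T : Type) [Wires K S] [Wires K T] [LawfulWires K S] [LawfulWires K T] :
    LawfulWires K (S × T) := ⟨fun a => Prod.ext (dec_enc a.1) (dec_enc a.2)⟩

instance pi (K ι T : Type) [Wires K T] [LawfulWires K T] : LawfulWires K (ι → T) :=
  ⟨fun a => funext fun i => dec_enc (a i)⟩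

instance cyc (R : Type) [CommRing R] (d : ℕ) [NeZero d] : LawfulWires R (Cyc R d) :=
  ⟨ofCoeffs_coeff⟩

variable (P : Params)

instance : LawfulWires P.Zq (Msg1 P) :=
  ⟨fun a => congrArg (fun t : (Fin P.κ → P.Rq) × P.Rq × (Fin P.δ → P.Rq) × P.Rq =>
    (⟨t.1, t.2.1, t.2.2.1, t.2.2.2⟩ : Msg1 P)) (dec_enc (K := P.Zq) (a.f0, a.f1, a.u1, a.u2))⟩

instance : LawfulWires P.Zq (Ch2 P) :=
  ⟨fun a => congrArg (fun t : (Fin P.δ → Fin P.d → P.Zq) × (Fin (P.d - 1) → P.Zq) =>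
    (⟨t.1, t.2⟩ : Ch2 P)) (dec_enc (K := P.Zq) (a.d1, a.d2))⟩

instance : LawfulWires P.Zq (RelOut P) :=
  ⟨fun a => congrArg (fun t : (Fin P.κ → P.Rq) × P.Rq × P.Rq × P.Rq × P.Rq =>
    (⟨t.1, t.2.1, t.2.2.1, t.2.2.2.1, t.2.2.2.2⟩ : RelOut P))
    (dec_enc (K := P.Zq) (a.v0, a.v1, a.v2, a.v3, a.v4))⟩

instance : LawfulWires P.Zq (Msg3 P) :=
  ⟨fun a => congrArg (fun t : P.Rq × (Fin P.κ → P.Rq) × RelOut P =>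
    (⟨t.1, t.2.1, t.2.2⟩ : Msg3 P)) (dec_enc (K := P.Zq) (a.h, a.w, a.v))⟩

instance : LawfulWires P.Zq (Msg4 P) :=
  ⟨fun a => congrArg (fun t : (Fin P.n → P.Rq) × (Fin P.n → P.Rq) =>
    (⟨t.1, t.2⟩ : Msg4 P)) (dec_enc (K := P.Zq) (a.z1, a.z2))⟩

instance : LawfulWires P.Zq (Transcript P) :=
  ⟨fun a => congrArg (fun t : Msg1 P × Ch1 P × Msg2 P × Ch2 P × Msg3 P × P.Rq × Msg4 P =>
    (⟨t.1, t.2.1, t.2.2.1, t.2.2.2.1, t.2.2.2.2.1, t.2.2.2.2.2.1, t.2.2.2.2.2.2⟩ : Transcript P))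
    (dec_enc (K := P.Zq) (a.m1, a.ch1, a.m2, a.ch2, a.m3, a.c, a.m4))⟩

instance : LawfulWires P.Zq (Opening P) :=
  ⟨fun a => congrArg (fun t : P.Rq × (Fin P.n → P.Rq) × (Fin P.n → P.Rq) × P.Rq × P.Rq × P.Rq =>
    (⟨t.1, t.2.1, t.2.2.1, t.2.2.2.1, t.2.2.2.2.1, t.2.2.2.2.2⟩ : Opening P))
    (dec_enc (K := P.Zq) (a.cbar, a.r, a.s, a.m1, a.m2, a.m3))⟩

end LawfulWires

/-! ### Functions computed by circuits -/

variable {P : Params}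

open Wires

section Impl

variable {S T U : Type} [Wires P.Zq S] [Wires P.Zq T] [Wires P.Zq U]

variable (P) in
/-- The randomised function `F` is computed by a circuit with at most `N` gates. -/
def Impl (F : S → PMF T) (N : ℕ) : Prop :=
  ∃ C : Algorithm P S T, C.size ≤ N ∧ ∀ x, C.eval Gate.interp (enc x) = (F x).map (enc (K := P.Zq))

variable (P) in
/-- The function `f` is computed by a circuit with at most `N` gates. -/
def Calc (f : S → T) (N : ℕ) : Prop := Impl P (fun x => PMF.pure (f x)) N

theorem Impl.run_eq [LawfulWires P.Zq T] {F : S → PMF T} {N : ℕ} (h : Impl P F N) :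
    ∃ C : Algorithm P S T, C.size ≤ N ∧ ∀ x, C.run x = F x := by
  obtain ⟨C, hC, h⟩ := h
  refine ⟨C, hC, fun x => ?_⟩
  rw [Algorithm.run, h, PMF.map_comp]
  have : (dec : (idx P.Zq T → P.Zq) → T) ∘ enc = id := funext LawfulWires.dec_enc
  rw [this, PMF.map_id]

theorem Impl.mono {F : S → PMF T} {N N' : ℕ} (h : Impl P F N) (hN : N ≤ N') : Impl P F N' :=
  let ⟨C, hC, h⟩ := h
  ⟨C, hC.trans hN, h⟩

theorem Impl.congr {F F' : S → PMF T} {N : ℕ} (h : Impl P F N) (hF : ∀ x, F x = F' x) :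
    Impl P F' N :=
  (funext hF : F = F') ▸ h

theorem calc_wire {f : S → T} (φ : idx P.Zq T → idx P.Zq S)
    (h : ∀ x b, enc (K := P.Zq) (f x) b = enc x (φ b)) : Calc P f 0 :=
  ⟨Circuit.wire φ, le_rfl, fun x => by
    rw [Circuit.eval, PMF.pure_map]
    exact congrArg PMF.pure (funext fun b => (h x b).symm)⟩

theorem calc_id : Calc P (fun x : S => x) 0 := calc_wire id fun _ _ => rfl

theorem Impl.comp {F : S → PMF T} {F' : T → PMF U} {N N' : ℕ} (h : Impl P F N) (h' : Impl P F' N') :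
    Impl P (fun x => (F x).bind F') (N + N') := by
  obtain ⟨C, hC, h⟩ := h
  obtain ⟨C', hC', h'⟩ := h'
  refine ⟨Circuit.comp C C', add_le_add hC hC', fun x => ?_⟩
  change (C.eval _ (enc x)).bind (C'.eval _) = _
  rw [h, PMF.bind_map, PMF.map_bind]
  congr 1
  funext y
  exact h' y

theorem Impl.pair {F : S → PMF T} {F' : S → PMF U} {N N' : ℕ} (h : Impl P F N) (h' : Impl P F' N') :
    Impl P (fun x => (F x).bind fun y => (F' x).bind fun z => PMF.pure (y, z)) (N + N') := by
  obtain ⟨C, hC, h⟩ := h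
  obtain ⟨C', hC', h'⟩ := h'
  refine ⟨Circuit.pair C C', add_le_add hC hC', fun x => ?_⟩
  change (C.eval _ (enc x)).bind (fun y => (C'.eval _ (enc x)).bind fun z =>
    PMF.pure (Sum.elim y z)) = _
  rw [h, h', PMF.bind_map, PMF.map_bind]
  congr 1
  funext y
  simp only [Function.comp, PMF.bind_map, PMF.map_bind, PMF.pure_map]
  rfl

theorem Calc.comp {f : S → T} {g : T → U} {N N' : ℕ} (hg : Calc P g N') (hf : Calc P f N) :
    Calc P (fun x => g (f x)) (N + N') :=
  (Impl.comp hf hg).congr fun x => by rw [PMF.pure_bind]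

theorem Calc.prodMk {f : S → T} {g : S → U} {N N' : ℕ} (hf : Calc P f N) (hg : Calc P g N') :
    Calc P (fun x => (f x, g x)) (N + N') :=
  (Impl.pair hf hg).congr fun x => by rw [PMF.pure_bind, PMF.pure_bind]

/-- A circuit followed by one that may also use the input. -/
theorem Impl.bind {F : S → PMF T} {F' : S → T → PMF U} {N N' : ℕ} (h : Impl P F N)
    (h' : Impl P (fun p : S × T => F' p.1 p.2) N') :
    Impl P (fun x => (F x).bind fun y => F' x y) (N + N') := by
  have h1 := (Impl.pair (calc_id (P := P) (S := S)) h).comp h'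
  rw [zero_add] at h1
  refine h1.congr fun x => ?_
  simp only [PMF.pure_bind, PMF.bind_bind]

theorem Impl.map {F : S → PMF T} {f : T → U} {N N' : ℕ} (h : Impl P F N) (hf : Calc P f N') :
    Impl P (fun x => (F x).map f) (N + N') :=
  (Impl.comp h hf).congr fun _ => rfl

theorem Calc.wire {f : S → T} {g : T → U} {N : ℕ} (hf : Calc P f N)
    (φ : idx P.Zq U → idx P.Zq T) (h : ∀ x b, enc (K := P.Zq) (g x) b = enc x (φ b)) :
    Calc P (fun x => g (f x)) N :=
  (calc_wire φ h).comp hf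

theorem Calc.fst {f : S → T × U} {N : ℕ} (hf : Calc P f N) : Calc P (fun x => (f x).1) N :=
  hf.wire (g := Prod.fst) Sum.inl fun _ _ => rfl

theorem Calc.snd {f : S → T × U} {N : ℕ} (hf : Calc P f N) : Calc P (fun x => (f x).2) N :=
  hf.wire (g := Prod.snd) Sum.inr fun _ _ => rfl

theorem Calc.apply {ι : Type} {f : S → ι → T} {N : ℕ} (hf : Calc P f N) (i : ι) :
    Calc P (fun x => f x i) N :=
  hf.wire (g := fun v : ι → T => v i) (fun b => (i, b)) fun _ _ => rfl

theorem Calc.matrix_apply {ι μ : Type} {f : S → Matrix ι μ T} {N : ℕ} (hf : Calc P f N) (i : ι)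
    (j : μ) : Calc P (fun x => f x i j) N :=
  hf.wire (g := fun v : Matrix ι μ T => v i j) (fun b => (i, j, b)) fun _ _ => rfl

theorem calc_pi_fin {n : ℕ} {f : S → Fin n → T} {N : ℕ} (h : ∀ i, Calc P (fun x => f x i) N) :
    Calc P f (n * N) := by
  induction n with
  | zero =>
    rw [Nat.zero_mul]
    exact calc_wire (fun b => b.1.elim0) fun _ b => b.1.elim0
  | succ n ih =>
    have h1 := ((h 0).prodMk (ih fun i => h i.succ)).wire
      (g := fun p : T × (Fin n → T) => (Fin.cons p.1 p.2 : Fin (n + 1) → T))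
      (fun b : Fin (n + 1) × idx P.Zq T => Fin.cases (motive := fun _ => idx P.Zq T ⊕ (Fin n × idx P.Zq T)) (Sum.inl b.2)
        (fun i => Sum.inr (i, b.2)) b.1)
      fun x b => by
        obtain ⟨i, b⟩ := b
        refine Fin.cases ?_ (fun i => ?_) i <;> rfl
    have h2 : (fun x => (Fin.cons (f x 0) fun i => f x i.succ : Fin (n + 1) → T)) = f := by
      ext x i
      refine Fin.cases ?_ (fun i => ?_) i <;> rfl
    have h3 : N + n * N = (n + 1) * N := by ring
    rw [← h3]
    exact h2 ▸ h1

theorem Calc.pi {ι : Type} [Fintype ι] {f : S → ι → T} {N : ℕ}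
    (h : ∀ i, Calc P (fun x => f x i) N) : Calc P f (Fintype.card ι * N) := by
  have h1 := (calc_pi_fin (f := fun x j => f x ((Fintype.equivFin ι).symm j)) fun j =>
    h ((Fintype.equivFin ι).symm j)).wire
    (g := fun v : Fin (Fintype.card ι) → T => fun i => v (Fintype.equivFin ι i))
    (fun b : ι × idx P.Zq T => (Fintype.equivFin ι b.1, b.2)) fun _ _ => rfl
  simpa only [Equiv.symm_apply_apply] using h1

theorem calc_iidFin {μ : PMF T} {N : ℕ} (h : Impl P (fun _ : S => μ) N) (n : ℕ) :
    Impl P (fun _ : S => iidFin μ n) (n * N) := by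
  induction n with
  | zero =>
    rw [Nat.zero_mul]
    exact calc_wire (fun b => b.1.elim0) fun _ b => b.1.elim0
  | succ n ih =>
    have h1 := (h.pair ih).map (calc_wire
      (f := fun p : T × (Fin n → T) => (Fin.cons p.1 p.2 : Fin (n + 1) → T))
      (fun b : Fin (n + 1) × idx P.Zq T => Fin.cases (motive := fun _ => idx P.Zq T ⊕ (Fin n × idx P.Zq T)) (Sum.inl b.2)
        (fun i => Sum.inr (i, b.2)) b.1)
      fun x b => by
        obtain ⟨i, b⟩ := b
        refine Fin.cases ?_ (fun i => ?_) i <;> rfl)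
    have h3 : N + n * N + 0 = (n + 1) * N := by ring
    rw [← h3]
    refine h1.congr fun x => ?_
    simp only [PMF.map_bind, PMF.pure_map, iidFin]

theorem Impl.iid {ι : Type} [Fintype ι] {μ : PMF T} {N : ℕ} (h : Impl P (fun _ : S => μ) N) :
    Impl P (fun _ : S => PoC.iid ι μ) (Fintype.card ι * N) := by
  have h1 := (calc_iidFin h (Fintype.card ι)).map (calc_wire
    (f := fun v : Fin (Fintype.card ι) → T => fun i => v (Fintype.equivFin ι i))
    (fun b : ι × idx P.Zq T => (Fintype.equivFin ι b.1, b.2)) fun _ _ => rfl)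
  rw [add_zero] at h1
  exact h1

end Impl

/-! ### Gates -/

section Gates

variable {S T : Type} [Wires P.Zq S] [Wires P.Zq T]

theorem calc_const (a : P.Zq) : Calc P (fun _ : S => a) 1 :=
  ⟨Circuit.comp (Circuit.wire Empty.elim) (Circuit.gate (Gate.const a)), le_rfl, fun x => by
    rw [PMF.pure_map]
    exact PMF.pure_bind _ _⟩

theorem Calc.add {f g : S → P.Zq} {N M : ℕ} (hf : Calc P f N) (hg : Calc P g M) :
    Calc P (fun x => f x + g x) (N + M + 1) := by
  have h : Calc P (fun p : P.Zq × P.Zq => p.1 + p.2) 1 :=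
    ⟨Circuit.comp (Circuit.wire fun b : Bool => cond b (Sum.inr ()) (Sum.inl ()))
      (Circuit.gate Gate.add), le_rfl, fun x => by
        rw [PMF.pure_map]
        exact PMF.pure_bind _ _⟩
  exact h.comp (hf.prodMk hg)

theorem Calc.mul {f g : S → P.Zq} {N M : ℕ} (hf : Calc P f N) (hg : Calc P g M) :
    Calc P (fun x => f x * g x) (N + M + 1) := by
  have h : Calc P (fun p : P.Zq × P.Zq => p.1 * p.2) 1 :=
    ⟨Circuit.comp (Circuit.wire fun b : Bool => cond b (Sum.inr ()) (Sum.inl ()))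
      (Circuit.gate Gate.mul), le_rfl, fun x => by
        rw [PMF.pure_map]
        exact PMF.pure_bind _ _⟩
  exact h.comp (hf.prodMk hg)

theorem Calc.inverse {f : S → P.Rq} {N : ℕ} (hf : Calc P f N) :
    Calc P (fun x => Ring.inverse (f x)) (N + 1) := by
  have h : Calc P (fun a : P.Rq => Ring.inverse a) 1 :=
    ⟨Circuit.gate Gate.inv, le_rfl, fun x => by
      simp only [Circuit.eval, PMF.pure_map]
      change PMF.pure (coeff (Ring.inverse (ofCoeffs (coeff x)))) = _
      rw [ofCoeffs_coeff]
      rfl⟩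
  exact h.comp hf

theorem impl_source {μ : PMF T} (g : Gate P) (hd : Gate.dom g = Empty)
    (hc : Gate.cod g = idx P.Zq T)
    (h : ∀ w, Gate.interp g w = (μ.map (enc (K := P.Zq))).map fun v b => v (cast hc b)) :
    Impl P (fun _ : S => μ) 1 := by
  refine ⟨Circuit.comp (Circuit.comp (Circuit.wire fun b => (cast hd b).elim) (Circuit.gate g))
    (Circuit.wire (cast hc.symm)), le_rfl, fun x => ?_⟩
  simp only [Circuit.eval, PMF.pure_bind, h, PMF.bind_map]
  refine pmf_ext_ex fun f => ?_
  rw [ex_bind, ex_map]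
  simp [ex_pure]

theorem impl_unif : Impl P (fun _ : S => PMF.uniformOfFintype P.Zq) 1 :=
  impl_source Gate.unif rfl rfl fun w => by rw [PMF.map_comp]; rfl

theorem impl_bin : Impl P (fun _ : S => bin1.map fun a : ℤ => (a : P.Zq)) 1 :=
  impl_source Gate.bin rfl rfl fun w => by rw [PMF.map_comp]; rfl

theorem impl_gauss12 :
    Impl P (fun _ : S => (discreteGaussian P.s12).map fun a : ℤ => (a : P.Zq)) 1 :=
  impl_source Gate.gauss12 rfl rfl fun w => by rw [PMF.map_comp]; rfl

theorem impl_gauss3 :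
    Impl P (fun _ : S => (discreteGaussian P.s3).map fun a : ℤ => (a : P.Zq)) 1 :=
  impl_source Gate.gauss3 rfl rfl fun w => by rw [PMF.map_comp]; rfl

theorem impl_chal : Impl P (fun _ : S => P.chal.map (red P.q)) 1 :=
  impl_source Gate.chal rfl rfl fun w => by rw [PMF.map_comp, PMF.map_comp]; rfl

end Gates

/-! ### Ring operations -/

section RingOps

variable {S T : Type} [Wires P.Zq S] [Wires P.Zq T]

theorem calc_fintype_sum [AddCommMonoid T] {ι : Type} [Fintype ι] {f : S → ι → T} {N A Z : ℕ}
    (hz : Calc P (fun _ : S => (0 : T)) Z) (ha : Calc P (fun p : T × T => p.1 + p.2) A)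
    (h : ∀ i, Calc P (fun x => f x i) N) :
    Calc P (fun x => ∑ i, f x i) (Fintype.card ι * (N + A) + Z) := by
  have h1 : ∀ (n : ℕ) (g : S → Fin n → T), (∀ i, Calc P (fun x => g x i) N) →
      Calc P (fun x => ∑ i, g x i) (n * (N + A) + Z) := by
    intro n
    induction n with
    | zero =>
      intro g _
      simpa using hz
    | succ n ih =>
      intro g hg
      have h2 := ha.comp ((hg 0).prodMk (ih (fun x i => g x i.succ) fun i => hg i.succ))
      have h3 : N + (n * (N + A) + Z) + A = (n + 1) * (N + A) + Z := by ring
      rw [← h3]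
      simpa only [Fin.sum_univ_succ] using h2
  have h2 := h1 _ (fun x j => f x ((Fintype.equivFin ι).symm j)) fun j => h _
  have h3 : ∀ x, ∑ j, f x ((Fintype.equivFin ι).symm j) = ∑ i, f x i := fun x =>
    Fintype.sum_equiv (Fintype.equivFin ι).symm _ _ fun _ => rfl
  simpa only [h3] using h2

theorem Calc.sum {ι : Type} [Fintype ι] {f : S → ι → P.Zq} {N : ℕ}
    (h : ∀ i, Calc P (fun x => f x i) N) :
    Calc P (fun x => ∑ i, f x i) (Fintype.card ι * (N + 1) + 1) :=
  calc_fintype_sum (calc_const 0) (Calc.add calc_id.fst calc_id.snd) h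

theorem Calc.coeff {f : S → P.Rq} {N : ℕ} (hf : Calc P f N) (i : Fin P.d) :
    Calc P (fun x => coeff (f x) i) N :=
  hf.wire (g := fun a : P.Rq => PoC.coeff a i) (fun _ => i) fun _ _ => rfl

theorem Calc.ofCoeffs {f : S → Fin P.d → P.Zq} {N : ℕ} (hf : Calc P f N) :
    Calc P (fun x => (ofCoeffs (f x) : P.Rq)) N :=
  hf.wire (g := fun v : Fin P.d → P.Zq => (PoC.ofCoeffs v : P.Rq)) (fun i => (i, ())) fun v i => by
    change PoC.coeff (PoC.ofCoeffs v : P.Rq) i = v i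
    rw [coeff_ofCoeffs]

theorem calc_of_coeff {f : S → P.Rq} {N : ℕ} (hf : ∀ i, Calc P (fun x => coeff (f x) i) N) :
    Calc P f (P.d * N) := by
  have := (Calc.pi (f := fun x i => PoC.coeff (f x) i) hf).ofCoeffs
  simpa only [ofCoeffs_coeff, Fintype.card_fin] using this

theorem calc_constRq (a : P.Rq) : Calc P (fun _ : S => a) (P.d * 1) :=
  calc_of_coeff fun _ => calc_const _

theorem Calc.addRq {f g : S → P.Rq} {N M : ℕ} (hf : Calc P f N) (hg : Calc P g M) :
    Calc P (fun x => f x + g x) (N + M + P.d) := by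
  have h : Calc P (fun p : P.Rq × P.Rq => p.1 + p.2) (P.d * (0 + 0 + 1)) := by
    refine calc_of_coeff fun i => ?_
    simp only [coeff_add, Pi.add_apply]
    exact (calc_id.fst.coeff i).add (calc_id.snd.coeff i)
  have h1 := h.comp (hf.prodMk hg)
  simpa only [zero_add, mul_one] using h1

theorem Calc.linear (L : P.Rq →ₗ[P.Zq] P.Rq) {f : S → P.Rq} {N : ℕ} (hf : Calc P f N) :
    Calc P (fun x => L (f x)) (N + P.d * (P.d * 3 + 1)) := by
  have h : Calc P (fun a : P.Rq => L a) (P.d * (P.d * (0 + 1 + 1 + 1) + 1)) := by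
    refine calc_of_coeff fun k => ?_
    have e : ∀ a : P.Rq, PoC.coeff (L a) k
        = ∑ i : Fin P.d, PoC.coeff a i * PoC.coeff (L (xbar ^ (i : ℕ))) k := by
      intro a
      have e1 := congrArg L (eq_sum_coeff a)
      rw [map_sum] at e1
      rw [e1, coeff_sum, Finset.sum_apply]
      refine Finset.sum_congr rfl fun i _ => ?_
      rw [map_smul, coeff_smul, Pi.smul_apply, smul_eq_mul]
    rw [show (fun a : P.Rq => PoC.coeff (L a) k) = _ from funext e]
    have := Calc.sum (P := P) (f := fun (a : P.Rq) (i : Fin P.d) =>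
      PoC.coeff a i * PoC.coeff (L (xbar ^ (i : ℕ))) k) fun i =>
        (calc_id.coeff i).mul (calc_const _)
    simpa only [Fintype.card_fin] using this
  exact h.comp hf

theorem Calc.negRq {f : S → P.Rq} {N : ℕ} (hf : Calc P f N) :
    Calc P (fun x => -f x) (N + P.d * (P.d * 3 + 1)) :=
  hf.linear (-LinearMap.id)

theorem Calc.subRq {f g : S → P.Rq} {N M : ℕ} (hf : Calc P f N) (hg : Calc P g M) :
    Calc P (fun x => f x - g x) (N + (M + P.d * (P.d * 3 + 1)) + P.d) := by
  simpa only [sub_eq_add_neg] using hf.addRq hg.negRq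

theorem Calc.sigma {f : S → P.Rq} {N : ℕ} (hf : Calc P f N) :
    Calc P (fun x => PoC.sigma (f x)) (N + P.d * (P.d * 3 + 1)) :=
  hf.linear ⟨⟨PoC.sigma, map_add _⟩, sigma_smul⟩

theorem Calc.mulRq {f g : S → P.Rq} {N M : ℕ} (hf : Calc P f N) (hg : Calc P g M) :
    Calc P (fun x => f x * g x) (N + M + P.d * (P.d * (P.d * 4 + 2) + 1)) := by
  have h : Calc P (fun p : P.Rq × P.Rq => p.1 * p.2)
      (P.d * (P.d * (P.d * (0 + 0 + 1 + 1 + 1 + 1) + 1 + 1) + 1)) := by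
    refine calc_of_coeff fun k => ?_
    simp only [coeff_mul]
    have := Calc.sum (P := P) (S := P.Rq × P.Rq) (f := fun p (i : Fin P.d) => ∑ j : Fin P.d,
      PoC.coeff p.1 i * PoC.coeff p.2 j * PoC.coeff (xbar ^ ((i : ℕ) + j) : P.Rq) k)
      fun i => Calc.sum fun j =>
        ((calc_id.fst.coeff i).mul (calc_id.snd.coeff j)).mul (calc_const _)
    simpa only [Fintype.card_fin] using this
  exact h.comp (hf.prodMk hg)

theorem Calc.smulRq {f : S → P.Zq} {g : S → P.Rq} {N M : ℕ} (hf : Calc P f N) (hg : Calc P g M) :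
    Calc P (fun x => f x • g x) (N + M + P.d) := by
  have h : Calc P (fun p : P.Zq × P.Rq => p.1 • p.2) (P.d * (0 + 0 + 1)) := by
    refine calc_of_coeff fun i => ?_
    simp only [coeff_smul, Pi.smul_apply, smul_eq_mul]
    exact calc_id.fst.mul (calc_id.snd.coeff i)
  have h1 := h.comp (hf.prodMk hg)
  simpa only [zero_add, mul_one] using h1

theorem Calc.ofRq {f : S → P.Zq} {N : ℕ} (hf : Calc P f N) :
    Calc P (fun x => (AdjoinRoot.of _ (f x) : P.Rq)) (N + P.d + P.d) := by
  have h := hf.smulRq (calc_constRq (1 : P.Rq))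
  simpa only [smul_eq_of_mul, mul_one] using h

theorem Calc.sumRq {ι : Type} [Fintype ι] {f : S → ι → P.Rq} {N : ℕ}
    (h : ∀ i, Calc P (fun x => f x i) N) :
    Calc P (fun x => ∑ i, f x i) (Fintype.card ι * (N + (0 + 0 + P.d)) + P.d * 1) :=
  calc_fintype_sum (calc_constRq 0) (calc_id.fst.addRq calc_id.snd) h

theorem Calc.dotProduct {ι : Type} [Fintype ι] {f g : S → ι → P.Rq} {N M : ℕ} (hf : Calc P f N)
    (hg : Calc P g M) : Calc P (fun x => f x ⬝ᵥ g x) (Fintype.card ι *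
      (N + M + P.d * (P.d * (P.d * 4 + 2) + 1) + (0 + 0 + P.d)) + P.d * 1) :=
  Calc.sumRq (f := fun x i => f x i * g x i) fun i => (hf.apply i).mulRq (hg.apply i)

theorem Calc.mulVec {ι μ : Type} [Fintype ι] [Fintype μ] {A : S → Matrix ι μ P.Rq}
    {g : S → μ → P.Rq} {N M : ℕ} (hA : Calc P A N) (hg : Calc P g M) :
    Calc P (fun x => (A x).mulVec (g x)) (Fintype.card ι * (Fintype.card μ *
      (N + M + P.d * (P.d * (P.d * 4 + 2) + 1) + (0 + 0 + P.d)) + P.d * 1)) :=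
  Calc.pi fun i => Calc.sumRq (f := fun x j => A x i j * g x j) fun j =>
    (hA.matrix_apply i j).mulRq (hg.apply j)

theorem Calc.addVec {ι : Type} [Fintype ι] {f g : S → ι → P.Rq} {N M : ℕ} (hf : Calc P f N)
    (hg : Calc P g M) : Calc P (fun x => f x + g x) (Fintype.card ι * (N + M + P.d)) :=
  Calc.pi fun i => (hf.apply i).addRq (hg.apply i)

theorem Calc.subVec {ι : Type} [Fintype ι] {f g : S → ι → P.Rq} {N M : ℕ} (hf : Calc P f N)
    (hg : Calc P g M) : Calc P (fun x => f x - g x)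
      (Fintype.card ι * (N + (M + P.d * (P.d * 3 + 1)) + P.d)) :=
  Calc.pi fun i => (hf.apply i).subRq (hg.apply i)

theorem Calc.smulVec {ι : Type} [Fintype ι] {f : S → P.Rq} {g : S → ι → P.Rq} {N M : ℕ}
    (hf : Calc P f N) (hg : Calc P g M) : Calc P (fun x => f x • g x)
      (Fintype.card ι * (N + M + P.d * (P.d * (P.d * 4 + 2) + 1))) :=
  Calc.pi fun i => hf.mulRq (hg.apply i)

theorem Calc.dotSigma {ι : Type} [Fintype ι] {f g : S → ι → P.Rq} {N M : ℕ} (hf : Calc P f N)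
    (hg : Calc P g M) : Calc P (fun x => PoC.dotSigma (f x) (g x)) (Fintype.card ι *
      (N + P.d * (P.d * 3 + 1) + M + P.d * (P.d * (P.d * 4 + 2) + 1) + (0 + 0 + P.d)) + P.d * 1) :=
  Calc.sumRq (f := fun x i => PoC.sigma (f x i) * g x i) fun i =>
    (hf.apply i).sigma.mulRq (hg.apply i)

end RingOps

/-! ### Polynomial bounds -/

/-- A quantity bounded by a polynomial in the security parameter. -/
def PolyBdd (f : Params → ℕ) : Prop := ∃ a : ℕ, ∀ P, f P ≤ a * P.secPar ^ a

theorem secPar_pos (P : Params) : 0 < P.secPar :=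
  Nat.add_pos_right _ (Nat.pos_of_ne_zero (NeZero.ne P.d))

theorem poly_mono (P : Params) {a b : ℕ} (h : a ≤ b) : a * P.secPar ^ a ≤ b * P.secPar ^ b :=
  Nat.mul_le_mul h (Nat.pow_le_pow_right (secPar_pos P) h)

theorem PolyBdd.const (c : ℕ) : PolyBdd fun _ => c :=
  ⟨c, fun P => Nat.le_mul_of_pos_right c (Nat.pow_pos (secPar_pos P))⟩

theorem PolyBdd.secPar : PolyBdd fun P => P.secPar := ⟨1, fun P => by simp⟩

theorem PolyBdd.mono {f g : Params → ℕ} (h : PolyBdd g) (hfg : ∀ P, f P ≤ g P) : PolyBdd f :=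
  let ⟨a, ha⟩ := h
  ⟨a, fun P => (hfg P).trans (ha P)⟩

theorem PolyBdd.add {f g : Params → ℕ} (hf : PolyBdd f) (hg : PolyBdd g) :
    PolyBdd fun P => f P + g P := by
  obtain ⟨a, ha⟩ := hf
  obtain ⟨b, hb⟩ := hg
  refine ⟨a + b, fun P => ?_⟩
  rw [add_mul]
  refine add_le_add ((ha P).trans ?_) ((hb P).trans ?_)
  · exact Nat.mul_le_mul le_rfl (Nat.pow_le_pow_right (secPar_pos P) (Nat.le_add_right a b))
  · exact Nat.mul_le_mul le_rfl (Nat.pow_le_pow_right (secPar_pos P) (Nat.le_add_left b a))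

theorem PolyBdd.mul {f g : Params → ℕ} (hf : PolyBdd f) (hg : PolyBdd g) :
    PolyBdd fun P => f P * g P := by
  obtain ⟨a, ha⟩ := hf
  obtain ⟨b, hb⟩ := hg
  refine ⟨a * b + (a + b), fun P => ?_⟩
  calc f P * g P ≤ (a * P.secPar ^ a) * (b * P.secPar ^ b) := Nat.mul_le_mul (ha P) (hb P)
    _ = (a * b) * P.secPar ^ (a + b) := by ring
    _ ≤ _ := Nat.mul_le_mul (Nat.le_add_right _ _)
      (Nat.pow_le_pow_right (secPar_pos P) (Nat.le_add_left _ _))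

theorem PolyBdd.d : PolyBdd fun P => P.d := PolyBdd.secPar.mono fun _ => Nat.le_add_left _ _

theorem PolyBdd.κ : PolyBdd fun P => P.κ :=
  PolyBdd.secPar.mono fun _ => (Nat.le_add_right _ _).trans (Nat.le_add_right _ _)

theorem PolyBdd.lam : PolyBdd fun P => P.lam :=
  PolyBdd.secPar.mono fun _ => (Nat.le_add_left _ _).trans (Nat.le_add_right _ _)

theorem PolyBdd.n : PolyBdd fun P => P.n := (PolyBdd.κ.add PolyBdd.lam).add (PolyBdd.const 3)

theorem PolyBdd.δ : PolyBdd fun P => P.δ := (PolyBdd.const 256).mono fun _ => Nat.div_le_self _ _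

theorem PolyBdd.pred_d : PolyBdd fun P => P.d - 1 := PolyBdd.d.mono fun _ => Nat.sub_le _ _

end

end PoC

namespace PoC
noncomputable section

set_option linter.unusedSectionVars false

variable {P : Params}

open Wires

/-! ### Circuits for the linear combinations of the protocol -/

section Combinations

variable {S : Type} [Wires P.Zq S]

theorem Calc.d1 {f : S → Ch2 P} {N : ℕ} (hf : Calc P f N) : Calc P (fun x => (f x).d1) N :=
  hf.wire (g := fun e : Ch2 P => e.d1) Sum.inl fun _ _ => rfl

theorem Calc.d2 {f : S → Ch2 P} {N : ℕ} (hf : Calc P f N) : Calc P (fun x => (f x).d2) N :=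
  hf.wire (g := fun e : Ch2 P => e.d2) Sum.inr fun _ _ => rfl

theorem exists_calc_combE : ∃ N, PolyBdd N ∧ ∀ P : Params,
    Calc P (fun t : Ch2 P × (Fin P.δ → P.Rq) => combE t.1 t.2) (N P) := by
  refine ⟨?N, ?_, fun P => ?_⟩
  rotate_left 2
  · exact Calc.sumRq (f := fun (t : Ch2 P × (Fin P.δ → P.Rq)) a =>
      ∑ i, t.1.d1 a i • PoC.dotSigma (eVec a i) t.2) fun a => Calc.sumRq fun i =>
      ((calc_id.fst.d1.apply a).apply i).smulRq
        (Calc.dotSigma (f := fun _ => eVec a i)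
          (Calc.pi fun k => calc_constRq (eVec a i k)) calc_id.snd)
  · simp only [Fintype.card_fin]
    repeat' first
      | exact PolyBdd.const _
      | exact PolyBdd.d
      | exact PolyBdd.δ
      | apply PolyBdd.add
      | apply PolyBdd.mul

theorem exists_calc_combR : ∃ N, PolyBdd N ∧ ∀ P : Params,
    Calc P (fun t : Ch1 P × Ch2 P × (Fin P.n → P.Rq) => combR t.1 t.2.1 t.2.2) (N P) := by
  refine ⟨?N, ?_, fun P => ?_⟩
  rotate_left 2
  · exact Calc.sumRq (f := fun (t : Ch1 P × Ch2 P × (Fin P.n → P.Rq)) a =>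
      ∑ i, t.2.1.d1 a i • PoC.dotSigma (t.1 a i) t.2.2) fun a => Calc.sumRq fun i =>
      ((calc_id.snd.fst.d1.apply a).apply i).smulRq
        (((calc_id.fst.apply a).apply i).dotSigma calc_id.snd.snd)
  · simp only [Fintype.card_fin]
    repeat' first
      | exact PolyBdd.const _
      | exact PolyBdd.d
      | exact PolyBdd.δ
      | exact PolyBdd.n
      | exact PolyBdd.κ
      | exact PolyBdd.lam
      | apply PolyBdd.add
      | apply PolyBdd.mul

theorem exists_calc_combV : ∃ N, PolyBdd N ∧ ∀ P : Params,
    Calc P (fun t : Ch2 P × P.Rq => combV t.1 t.2) (N P) := by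
  refine ⟨?N, ?_, fun P => ?_⟩
  rotate_left 2
  · exact Calc.sumRq (f := fun (t : Ch2 P × P.Rq) j =>
      t.1.d2 j • (PoC.sigma (xbar ^ (j.val + 1)) * t.2)) fun j =>
      (calc_id.fst.d2.apply j).smulRq ((calc_constRq _).mulRq calc_id.snd)
  · simp only [Fintype.card_fin]
    repeat' first
      | exact PolyBdd.const _
      | exact PolyBdd.d
      | exact PolyBdd.pred_d
      | apply PolyBdd.add
      | apply PolyBdd.mul

theorem exists_calc_matQ : ∃ N, PolyBdd N ∧ ∀ P : Params,
    Calc P (fun t : Ch1 P × (Fin P.n → P.Rq) => matQ t.1 t.2) (N P) := by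
  refine ⟨?N, ?_, fun P => ?_⟩
  rotate_left 2
  · exact Calc.pi fun a => Calc.ofCoeffs <| Calc.pi
      (f := fun (t : Ch1 P × (Fin P.n → P.Rq)) i => ∑ m, ∑ j, coeff (t.1 a i m) j * coeff (t.2 m) j)
      fun i => Calc.sum fun m => Calc.sum fun j =>
        ((((calc_id.fst.apply a).apply i).apply m).coeff j).mul ((calc_id.snd.apply m).coeff j)
  · simp only [Fintype.card_fin]
    repeat' first
      | exact PolyBdd.const _
      | exact PolyBdd.d
      | exact PolyBdd.δ
      | exact PolyBdd.n
      | exact PolyBdd.κ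
      | exact PolyBdd.lam
      | apply PolyBdd.add
      | apply PolyBdd.mul

end Combinations

/-! ### Efficient families -/

section Efficient

variable {S T U V : Params → Type} [∀ P, Wires P.Zq (S P)] [∀ P, Wires P.Zq (T P)]
  [∀ P, Wires P.Zq (U P)] [∀ P, Wires P.Zq (V P)]

/-- A family of randomised functions that is computed by circuits of polynomial size. -/
def Eff (F : ∀ P, S P → PMF (T P)) : Prop := ∃ N, PolyBdd N ∧ ∀ P, Impl P (F P) (N P)

/-- A family of functions that is computed by circuits of polynomial size. -/
def EffCalc (f : ∀ P, S P → T P) : Prop := Eff fun P x => PMF.pure (f P x)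

theorem effCalc_id : EffCalc fun (P : Params) (x : S P) => x :=
  ⟨_, PolyBdd.const 0, fun _ => calc_id⟩

theorem EffCalc.wire {f : ∀ P, S P → T P} (hf : EffCalc f) (g : ∀ P, T P → U P)
    (φ : ∀ P : Params, idx P.Zq (U P) → idx P.Zq (T P))
    (h : ∀ P x b, enc (K := P.Zq) (g P x) b = enc x (φ P b)) : EffCalc fun P x => g P (f P x) :=
  let ⟨N, hN, hf⟩ := hf
  ⟨N, hN, fun P => Calc.wire (hf P) (φ P) (h P)⟩

theorem EffCalc.comp {g : ∀ P, T P → U P} {f : ∀ P, S P → T P} (hg : EffCalc g) (hf : EffCalc f) :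
    EffCalc fun P x => g P (f P x) :=
  let ⟨_, hN, hf⟩ := hf
  let ⟨_, hM, hg⟩ := hg
  ⟨_, hN.add hM, fun P => Calc.comp (hg P) (hf P)⟩

theorem EffCalc.prodMk {f : ∀ P, S P → T P} {g : ∀ P, S P → U P} (hf : EffCalc f) (hg : EffCalc g) :
    EffCalc fun P x => (f P x, g P x) :=
  let ⟨_, hN, hf⟩ := hf
  let ⟨_, hM, hg⟩ := hg
  ⟨_, hN.add hM, fun P => Calc.prodMk (hf P) (hg P)⟩

theorem EffCalc.fst {f : ∀ P, S P → T P × U P} (hf : EffCalc f) : EffCalc fun P x => (f P x).1 :=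
  hf.wire (fun _ => Prod.fst) (fun _ => Sum.inl) fun _ _ _ => rfl

theorem EffCalc.snd {f : ∀ P, S P → T P × U P} (hf : EffCalc f) : EffCalc fun P x => (f P x).2 :=
  hf.wire (fun _ => Prod.snd) (fun _ => Sum.inr) fun _ _ _ => rfl

theorem Eff.pair {F : ∀ P, S P → PMF (T P)} {F' : ∀ P, S P → PMF (U P)} (h : Eff F) (h' : Eff F') :
    Eff fun P x => (F P x).bind fun y => (F' P x).bind fun z => PMF.pure (y, z) :=
  let ⟨_, hN, h⟩ := h
  let ⟨_, hM, h'⟩ := h'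
  ⟨_, hN.add hM, fun P => (h P).pair (h' P)⟩

theorem Eff.bind {F : ∀ P, S P → PMF (T P)} {F' : ∀ P, S P → T P → PMF (U P)} (h : Eff F)
    (h' : Eff fun P (p : S P × T P) => F' P p.1 p.2) :
    Eff fun P x => (F P x).bind (F' P x) :=
  let ⟨_, hN, h⟩ := h
  let ⟨_, hM, h'⟩ := h'
  ⟨_, hN.add hM, fun P => (h P).bind (h' P)⟩

theorem Eff.map {F : ∀ P, S P → PMF (T P)} {f : ∀ P, T P → U P} (h : Eff F) (hf : EffCalc f) :
    Eff fun P x => (F P x).map (f P) :=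
  let ⟨_, hN, h⟩ := h
  let ⟨_, hM, hf⟩ := hf
  ⟨_, hN.add hM, fun P => (h P).map (hf P)⟩

theorem Eff.iid {ι : Params → Type} [∀ P, Fintype (ι P)] {μ : ∀ P, PMF (T P)}
    (h : Eff fun P (_ : S P) => μ P) (hι : PolyBdd fun P => Fintype.card (ι P)) :
    Eff fun P (_ : S P) => PoC.iid (ι P) (μ P) :=
  let ⟨_, hN, h⟩ := h
  ⟨_, hι.mul hN, fun P => (h P).iid⟩

theorem Eff.iid_fin {ι : Params → ℕ} {μ : ∀ P, PMF (T P)}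
    (h : Eff fun P (_ : S P) => μ P) (hι : PolyBdd ι) :
    Eff fun P (_ : S P) => PoC.iid (Fin (ι P)) (μ P) :=
  h.iid (by simpa only [Fintype.card_fin] using hι)

theorem Eff.polyOf {μ : ∀ P : Params, PMF P.Zq} (h : Eff fun P (_ : S P) => μ P) :
    Eff fun P (_ : S P) => PoC.polyOf P.d (μ P) :=
  (h.iid_fin PolyBdd.d).map (f := fun _ v => PoC.ofCoeffs v) ⟨_, PolyBdd.const 0, fun _ =>
    calc_id.ofCoeffs⟩

end Efficient

section EfficientOps

variable {S : Params → Type} [∀ P, Wires P.Zq (S P)]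

theorem EffCalc.addRq {f g : ∀ P, S P → P.Rq} (hf : EffCalc f) (hg : EffCalc g) :
    EffCalc fun P x => f P x + g P x :=
  let ⟨_, hN, hf⟩ := hf
  let ⟨_, hM, hg⟩ := hg
  ⟨_, (hN.add hM).add PolyBdd.d, fun P => Calc.addRq (hf P) (hg P)⟩

theorem polyBdd_linear : PolyBdd fun P => P.d * (P.d * 3 + 1) :=
  PolyBdd.d.mul ((PolyBdd.d.mul (.const 3)).add (.const 1))

theorem polyBdd_mul : PolyBdd fun P => P.d * (P.d * (P.d * 4 + 2) + 1) :=
  PolyBdd.d.mul ((PolyBdd.d.mul ((PolyBdd.d.mul (.const 4)).add (.const 2))).add (.const 1))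

theorem EffCalc.subRq {f g : ∀ P, S P → P.Rq} (hf : EffCalc f) (hg : EffCalc g) :
    EffCalc fun P x => f P x - g P x :=
  let ⟨_, hN, hf⟩ := hf
  let ⟨_, hM, hg⟩ := hg
  ⟨_, (hN.add (hM.add polyBdd_linear)).add PolyBdd.d, fun P => Calc.subRq (hf P) (hg P)⟩

theorem EffCalc.mulRq {f g : ∀ P, S P → P.Rq} (hf : EffCalc f) (hg : EffCalc g) :
    EffCalc fun P x => f P x * g P x :=
  let ⟨_, hN, hf⟩ := hf
  let ⟨_, hM, hg⟩ := hg
  ⟨_, (hN.add hM).add polyBdd_mul, fun P => Calc.mulRq (hf P) (hg P)⟩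

theorem EffCalc.inverse {f : ∀ P, S P → P.Rq} (hf : EffCalc f) :
    EffCalc fun P x => Ring.inverse (f P x) :=
  let ⟨_, hN, hf⟩ := hf
  ⟨_, hN.add (.const 1), fun P => Calc.inverse (hf P)⟩

theorem effCalc_const (a : ∀ P : Params, P.Rq) : EffCalc fun P (_ : S P) => a P :=
  ⟨_, PolyBdd.d.mul (.const 1), fun P => calc_constRq (a P)⟩

theorem EffCalc.ofRq {f : ∀ P, S P → P.Zq} (hf : EffCalc f) :
    EffCalc fun P x => (AdjoinRoot.of _ (f P x) : P.Rq) :=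
  let ⟨_, hN, hf⟩ := hf
  ⟨_, (hN.add PolyBdd.d).add PolyBdd.d, fun P => Calc.ofRq (hf P)⟩

theorem EffCalc.dotProduct {ι : Params → ℕ} (hι : PolyBdd ι) {f g : ∀ P, S P → Fin (ι P) → P.Rq}
    (hf : EffCalc f) (hg : EffCalc g) : EffCalc fun P x => f P x ⬝ᵥ g P x :=
  let ⟨_, hN, hf⟩ := hf
  let ⟨_, hM, hg⟩ := hg
  ⟨_, (PolyBdd.mul (by simpa only [Fintype.card_fin] using hι) (((hN.add hM).add polyBdd_mul).add
    (((PolyBdd.const 0).add (.const 0)).add PolyBdd.d))).add (PolyBdd.d.mul (.const 1)),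
    fun P => Calc.dotProduct (hf P) (hg P)⟩

theorem EffCalc.mulVec {ι μ : Params → ℕ} (hι : PolyBdd ι) (hμ : PolyBdd μ)
    {A : ∀ P, S P → Matrix (Fin (ι P)) (Fin (μ P)) P.Rq} {g : ∀ P, S P → Fin (μ P) → P.Rq}
    (hf : EffCalc A) (hg : EffCalc g) : EffCalc fun P x => (A P x).mulVec (g P x) :=
  let ⟨_, hN, hf⟩ := hf
  let ⟨_, hM, hg⟩ := hg
  ⟨_, PolyBdd.mul (by simpa only [Fintype.card_fin] using hι)
    ((PolyBdd.mul (by simpa only [Fintype.card_fin] using hμ) (((hN.add hM).add polyBdd_mul).add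
    (((PolyBdd.const 0).add (.const 0)).add PolyBdd.d))).add (PolyBdd.d.mul (.const 1))),
    fun P => Calc.mulVec (hf P) (hg P)⟩

theorem EffCalc.addVec {ι : Params → ℕ} (hι : PolyBdd ι) {f g : ∀ P, S P → Fin (ι P) → P.Rq}
    (hf : EffCalc f) (hg : EffCalc g) : EffCalc fun P x => f P x + g P x :=
  let ⟨_, hN, hf⟩ := hf
  let ⟨_, hM, hg⟩ := hg
  ⟨_, PolyBdd.mul (by simpa only [Fintype.card_fin] using hι) ((hN.add hM).add PolyBdd.d),
    fun P => Calc.addVec (hf P) (hg P)⟩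

theorem EffCalc.subVec {ι : Params → ℕ} (hι : PolyBdd ι) {f g : ∀ P, S P → Fin (ι P) → P.Rq}
    (hf : EffCalc f) (hg : EffCalc g) : EffCalc fun P x => f P x - g P x :=
  let ⟨_, hN, hf⟩ := hf
  let ⟨_, hM, hg⟩ := hg
  ⟨_, PolyBdd.mul (by simpa only [Fintype.card_fin] using hι)
    ((hN.add (hM.add polyBdd_linear)).add PolyBdd.d), fun P => Calc.subVec (hf P) (hg P)⟩

theorem EffCalc.smulVec {ι : Params → ℕ} (hι : PolyBdd ι) {f : ∀ P, S P → P.Rq}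
    {g : ∀ P, S P → Fin (ι P) → P.Rq}
    (hf : EffCalc f) (hg : EffCalc g) : EffCalc fun P x => f P x • g P x :=
  let ⟨_, hN, hf⟩ := hf
  let ⟨_, hM, hg⟩ := hg
  ⟨_, PolyBdd.mul (by simpa only [Fintype.card_fin] using hι) ((hN.add hM).add polyBdd_mul),
    fun P => Calc.smulVec (hf P) (hg P)⟩

end EfficientOps

/-! ### Transcripts are computed efficiently -/

section Transcripts

variable {S : Params → Type} [∀ P, Wires P.Zq (S P)]

theorem eff_combE : EffCalc (S := fun P => Ch2 P × (Fin P.δ → P.Rq)) (T := fun P => P.Rq)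
    fun _ t => PoC.combE t.1 t.2 :=
  exists_calc_combE

theorem EffCalc.combE {e : ∀ P, S P → Ch2 P} {y : ∀ P, S P → Fin P.δ → P.Rq} (he : EffCalc e)
    (hy : EffCalc y) : EffCalc fun P s => PoC.combE (e P s) (y P s) := by
  have h := EffCalc.comp eff_combE (he.prodMk hy)
  exact h

theorem eff_combR : EffCalc (S := fun P => Ch1 P × Ch2 P × (Fin P.n → P.Rq)) (T := fun P => P.Rq)
    fun _ t => PoC.combR t.1 t.2.1 t.2.2 :=
  exists_calc_combR

theorem EffCalc.combR {R : ∀ P, S P → Ch1 P} {e : ∀ P, S P → Ch2 P}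
    {r : ∀ P, S P → Fin P.n → P.Rq} (hR : EffCalc R) (he : EffCalc e) (hr : EffCalc r) :
    EffCalc fun P s => PoC.combR (R P s) (e P s) (r P s) := by
  have h := EffCalc.comp eff_combR (hR.prodMk (he.prodMk hr))
  exact h

theorem eff_combV : EffCalc (S := fun P => Ch2 P × P.Rq) (T := fun P => P.Rq)
    fun _ t => PoC.combV t.1 t.2 :=
  exists_calc_combV

theorem EffCalc.combV {e : ∀ P, S P → Ch2 P} {v : ∀ P, S P → P.Rq} (he : EffCalc e)
    (hv : EffCalc v) : EffCalc fun P s => PoC.combV (e P s) (v P s) := by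
  have h := EffCalc.comp eff_combV (he.prodMk hv)
  exact h

theorem eff_matQ : EffCalc (S := fun P => Ch1 P × (Fin P.n → P.Rq)) (T := fun P => Fin P.δ → P.Rq)
    fun _ t => PoC.matQ t.1 t.2 :=
  exists_calc_matQ

theorem EffCalc.matQ {R : ∀ P, S P → Ch1 P} {r : ∀ P, S P → Fin P.n → P.Rq} (hR : EffCalc R)
    (hr : EffCalc r) : EffCalc fun P s => PoC.matQ (R P s) (r P s) := by
  have h := EffCalc.comp eff_matQ (hR.prodMk hr)
  exact h

theorem EffCalc.msg1 {f0 : ∀ P, S P → Fin P.κ → P.Rq} {f1 u2 : ∀ P, S P → P.Rq}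
    {u1 : ∀ P, S P → Fin P.δ → P.Rq} (h0 : EffCalc f0) (h1 : EffCalc f1) (h2 : EffCalc u1)
    (h3 : EffCalc u2) : EffCalc fun P s => (⟨f0 P s, f1 P s, u1 P s, u2 P s⟩ : Msg1 P) :=
  (h0.prodMk (h1.prodMk (h2.prodMk h3))).wire (U := Msg1)
    (fun P (t : (Fin P.κ → P.Rq) × P.Rq × (Fin P.δ → P.Rq) × P.Rq) =>
      ⟨t.1, t.2.1, t.2.2.1, t.2.2.2⟩) (fun _ b => b) fun _ _ _ => rfl

theorem EffCalc.simTranscript {x : ∀ P, S P → Stmt P} {hk : ∀ P, S P → AuxKey P}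
    {m1 : ∀ P, S P → Msg1 P} {R : ∀ P, S P → Ch1 P} {z3 : ∀ P, S P → Msg2 P}
    {e : ∀ P, S P → Ch2 P} {h c : ∀ P, S P → P.Rq} {z1 z2 : ∀ P, S P → Fin P.n → P.Rq}
    (hx : EffCalc x) (hhk : EffCalc hk) (hm1 : EffCalc m1) (hR : EffCalc R) (hz3 : EffCalc z3)
    (he : EffCalc e) (hh : EffCalc h) (hc : EffCalc c) (hz1 : EffCalc z1) (hz2 : EffCalc z2) :
    EffCalc fun P s => PoC.simTranscript (x P s) (hk P s) (m1 P s) (R P s) (z3 P s) (e P s) (h P s)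
      (c P s) (z1 P s) (z2 P s) := by
  have hck := hx.fst
  have hcom := hx.snd
  have hA := hck.wire (fun _ => ComKey.A) (fun _ => Sum.inl) fun _ _ _ => rfl
  have hpk1 := hck.wire (fun _ => ComKey.pk1) (fun _ b => Sum.inr (Sum.inl b)) fun _ _ _ => rfl
  have hpk2 := hck.wire (fun _ => ComKey.pk2) (fun _ b => Sum.inr (Sum.inr (Sum.inl b)))
    fun _ _ _ => rfl
  have hB := hck.wire (fun _ => ComKey.B) (fun _ b => Sum.inr (Sum.inr (Sum.inr b)))
    fun _ _ _ => rfl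
  have hcom0 := hcom.wire (fun _ => Com.com0) (fun _ => Sum.inl) fun _ _ _ => rfl
  have hcom1 := hcom.wire (fun _ => Com.com1) (fun _ b => Sum.inr (Sum.inl b)) fun _ _ _ => rfl
  have hcom2 := hcom.wire (fun _ => Com.com2) (fun _ b => Sum.inr (Sum.inr (Sum.inl b)))
    fun _ _ _ => rfl
  have hcom3 := hcom.wire (fun _ => Com.com3) (fun _ b => Sum.inr (Sum.inr (Sum.inr b)))
    fun _ _ _ => rfl
  have hA1 := hhk.wire (fun _ => AuxKey.A1) (fun _ => Sum.inl) fun _ _ _ => rfl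
  have hA2 := hhk.wire (fun _ => AuxKey.A2) (fun _ b => Sum.inr (Sum.inl b)) fun _ _ _ => rfl
  have hB1 := hhk.wire (fun _ => AuxKey.B1) (fun _ b => Sum.inr (Sum.inr (Sum.inl b)))
    fun _ _ _ => rfl
  have hBc := hhk.wire (fun _ => AuxKey.Bc) (fun _ b => Sum.inr (Sum.inr (Sum.inr (Sum.inl b))))
    fun _ _ _ => rfl
  have hBc' := hhk.wire (fun _ => AuxKey.Bc') (fun _ b => Sum.inr (Sum.inr (Sum.inr (Sum.inr b))))
    fun _ _ _ => rfl
  have hf0 := hm1.wire (fun _ => Msg1.f0) (fun _ => Sum.inl) fun _ _ _ => rfl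
  have hf1 := hm1.wire (fun _ => Msg1.f1) (fun _ b => Sum.inr (Sum.inl b)) fun _ _ _ => rfl
  have hu1 := hm1.wire (fun _ => Msg1.u1) (fun _ b => Sum.inr (Sum.inr (Sum.inl b)))
    fun _ _ _ => rfl
  have hu2 := hm1.wire (fun _ => Msg1.u2) (fun _ b => Sum.inr (Sum.inr (Sum.inr b)))
    fun _ _ _ => rfl
  have hm := (hc.mulRq hf1).subRq (hB1.dotProduct PolyBdd.n hz2)
  have hw := ((hA1.mulVec PolyBdd.κ PolyBdd.n hz1).addVec PolyBdd.κ
    (hA2.mulVec PolyBdd.κ PolyBdd.n hz2)).subVec PolyBdd.κ (hc.smulVec PolyBdd.κ hf0)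
  have hv0 := (hA.mulVec PolyBdd.κ PolyBdd.n hz1).subVec PolyBdd.κ (hc.smulVec PolyBdd.κ hcom0)
  have hv1 := ((hpk1.dotProduct PolyBdd.n hz1).addRq hm).subRq (hc.mulRq hcom1)
  have hv2 := ((hpk2.dotProduct PolyBdd.n hz1).addRq
    ((effCalc_const fun P => (P.sq : P.Rq)).mulRq hm)).subRq (hc.mulRq hcom2)
  have hv3 := ((hB.dotProduct PolyBdd.n hz1).addRq hm).subRq (hc.mulRq hcom3)
  have hv4 := ((((hR.combR he hz1).addRq (he.combV hm)).addRq (he.combE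
    ((hc.smulVec PolyBdd.δ hu1).subVec PolyBdd.δ (hBc.mulVec PolyBdd.δ PolyBdd.n hz2)))).addRq
    ((hc.mulRq hu2).subRq (hBc'.dotProduct PolyBdd.n hz2))).subRq
    (hc.mulRq (hh.addRq (he.combE hz3)))
  have hm3 := hh.prodMk (hw.prodMk (hv0.prodMk (hv1.prodMk (hv2.prodMk (hv3.prodMk hv4)))))
  exact (hm1.prodMk (hR.prodMk (hz3.prodMk (he.prodMk (hm3.prodMk
    (hc.prodMk (hz1.prodMk hz2))))))).wire (U := Transcript)
    (fun P (t : Msg1 P × Ch1 P × Msg2 P × Ch2 P × (P.Rq × (Fin P.κ → P.Rq) × (Fin P.κ → P.Rq) ×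
      P.Rq × P.Rq × P.Rq × P.Rq) × P.Rq × (Fin P.n → P.Rq) × (Fin P.n → P.Rq)) =>
      ⟨t.1, t.2.1, t.2.2.1, t.2.2.2.1, ⟨t.2.2.2.2.1.1, t.2.2.2.2.1.2.1, ⟨t.2.2.2.2.1.2.2.1,
        t.2.2.2.2.1.2.2.2.1, t.2.2.2.2.1.2.2.2.2.1, t.2.2.2.2.1.2.2.2.2.2.1,
        t.2.2.2.2.1.2.2.2.2.2.2⟩⟩, t.2.2.2.2.2.1,
        ⟨t.2.2.2.2.2.2.1, t.2.2.2.2.2.2.2⟩⟩) (fun _ b => b) fun _ _ _ => rfl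

theorem EffCalc.hybTranscript {x : ∀ P, S P → Stmt P} {hk : ∀ P, S P → AuxKey P}
    {r : ∀ P, S P → Fin P.n → P.Rq} {v : ∀ P, S P → P.Zq} {t : ∀ P, S P → HideRows P → P.Rq}
    {g : ∀ P, S P → P.Rq} {R : ∀ P, S P → Ch1 P}
    {e : ∀ P, S P → Ch2 P} {c : ∀ P, S P → P.Rq} {z3 : ∀ P, S P → Msg2 P}
    {z1 z2 : ∀ P, S P → Fin P.n → P.Rq}
    (hx : EffCalc x) (hhk : EffCalc hk) (hr : EffCalc r) (hv : EffCalc v) (ht : EffCalc t)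
    (hg : EffCalc g) (hR : EffCalc R) (he : EffCalc e) (hc : EffCalc c) (hz3 : EffCalc z3)
    (hz1 : EffCalc z1) (hz2 : EffCalc z2) :
    EffCalc fun P s => PoC.hybTranscript (x P s) (hk P s) (r P s) (v P s) (t P s) (g P s) (R P s)
      (e P s) (c P s) (z3 P s) (z1 P s) (z2 P s) := by
  have hA1 := hhk.wire (fun _ => AuxKey.A1) (fun _ => Sum.inl) fun _ _ _ => rfl
  have ht0 := ht.wire (U := fun P => Fin P.κ → P.Rq) (fun _ t i => t (.inl i))
    (fun _ b => (.inl b.1, b.2)) fun _ _ _ => rfl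
  have ht1 := ht.wire (U := fun P => P.Rq) (fun _ t => t (.inr (.inl ())))
    (fun _ b => (.inr (.inl ()), b)) fun _ _ _ => rfl
  have ht2 := ht.wire (U := fun P => Fin P.δ → P.Rq) (fun _ t i => t (.inr (.inr (.inl i))))
    (fun _ b => (.inr (.inr (.inl b.1)), b.2)) fun _ _ _ => rfl
  have ht3 := ht.wire (U := fun P => P.Rq) (fun _ t => t (.inr (.inr (.inr ()))))
    (fun _ b => (.inr (.inr (.inr ())), b)) fun _ _ _ => rfl
  have hm := hR.matQ hr
  have hcomb := ((hR.combR he hr).subRq (he.combE hm)).addRq (he.combV hv.ofRq)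
  exact hx.simTranscript hhk (((hA1.mulVec PolyBdd.κ PolyBdd.n hr).addVec PolyBdd.κ ht0).msg1
    (ht1.addRq hv.ofRq) (ht2.addVec PolyBdd.δ (hz3.subVec PolyBdd.δ hm)) (ht3.addRq hg)) hR hz3 he
    (hg.addRq hcomb) hc hz1 hz2

end Transcripts

end

end PoC

namespace PoC
noncomputable section

set_option linter.unusedSectionVars false

open ENNReal

variable {P : Params}

/-! ### Simulation -/

section Shift

theorem ex_add_right {G : Type} [AddGroup G] {μ : PMF G} {u : G} (h : ∀ a, μ (a + u) = μ a)
    (f : G → ℝ≥0∞) : (ex μ fun a => f (a + u)) = ex μ f := by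
  rw [ex, ex, ← (Equiv.addRight u).tsum_eq fun a => μ a * f a]
  exact tsum_congr fun a => by rw [← h a]; rfl

theorem ex_iid_add_right {ι G : Type} [Fintype ι] [AddGroup G] {μ : PMF G}
    (h : ∀ a u, μ (a + u) = μ a) (u : ι → G) (f : (ι → G) → ℝ≥0∞) :
    (ex (iid ι μ) fun v => f (v + u)) = ex (iid ι μ) f :=
  ex_add_right (fun v => by
    rw [iid_apply, iid_apply]
    exact Finset.prod_congr rfl fun i _ => h _ _) f

theorem unifRq_add (a u : P.Rq) : unifRq P (a + u) = unifRq P a := by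
  rw [unifRq, polyOf_apply, polyOf_apply]
  simp only [PMF.uniformOfFintype_apply]

theorem ex_unifZeroConst_add {u : P.Rq} (hu : coeff u 0 = 0) (f : P.Rq → ℝ≥0∞) :
    (ex (unifZeroConst P) fun g => f (g + u)) = ex (unifZeroConst P) f := by
  rw [unifZeroConst, ex_map, ex_map]
  have h : ∀ w : Fin P.d → P.Zq, (ofCoeffs (Function.update w 0 0) : P.Rq) + u
      = ofCoeffs (Function.update (w + coeff u) 0 0) := by
    intro w
    apply coeff_injective
    rw [coeff_add, coeff_ofCoeffs, coeff_ofCoeffs]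
    ext i
    by_cases hi : i = 0
    · subst hi
      simp [hu]
    · simp [Function.update_of_ne hi]
  simp only [h]
  exact ex_iid_add_right (fun a u => by simp only [PMF.uniformOfFintype_apply]) (coeff u)
    fun w => f (ofCoeffs (Function.update w 0 0))

end Shift

section Simulator

/-- Independent samples from two distributions. -/
def prodLaw {α β : Type} (μ : PMF α) (ν : PMF β) : PMF (α × β) :=
  μ.bind fun a => ν.bind fun b => PMF.pure (a, b)

theorem ex_prodLaw {α β : Type} (μ : PMF α) (ν : PMF β) (f : α × β → ℝ≥0∞) :
    ex (prodLaw μ ν) f = ex μ fun a => ex ν fun b => f (a, b) := by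
  simp only [prodLaw, ex_bind, ex_pure]

/-- Challenges and responses `(R, e, c, z3, z1, z2)`. -/
abbrev Core (P : Params) : Type :=
  Ch1 P × Ch2 P × P.Rq × Msg2 P × (Fin P.n → P.Rq) × (Fin P.n → P.Rq)

/-- The law of the challenges and of responses that are independent of the secrets. -/
def coreLaw (P : Params) : PMF (Core P) :=
  prodLaw ((ch1LawZ P).map redCh1) <| prodLaw (ch2Law P) <| prodLaw (P.chal.map (red P.q)) <|
    prodLaw ((gaussVec P (Fin P.δ) P.s3).map redV) <|
      prodLaw ((gaussVec P (Fin P.n) P.s12).map redV) ((gaussVec P (Fin P.n) P.s12).map redV)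

theorem hybRun_eq (x : Stmt P) (hk : AuxKey P) (r : Fin P.n → P.Rq) (v : P.Zq)
    (t : HideRows P → P.Rq) : hybRun x hk r v t =
      (prodLaw (unifZeroConst P) (coreLaw P)).bind fun y => PMF.pure <|
        hybTranscript x hk r v t y.1 y.2.1 y.2.2.1 y.2.2.2.1 y.2.2.2.2.1 y.2.2.2.2.2.1
          y.2.2.2.2.2.2 := by
  refine pmf_ext_ex fun f => ?_
  simp only [ex_hybRun, ex_bind, ex_prodLaw, coreLaw, ex_map, ex_pure]

/-- The first message with prescribed rows. -/
def msg1OfRows (t : HideRows P → P.Rq) : Msg1 P where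
  f0 := fun i => t (.inl i)
  f1 := t (.inr (.inl ()))
  u1 := fun a => t (.inr (.inr (.inl a)))
  u2 := t (.inr (.inr (.inr ())))

/-- The simulator. -/
def simRun (x : Stmt P) (hk : AuxKey P) : PMF (Transcript P) :=
  (prodLaw (iid (HideRows P) (unifRq P)) (prodLaw (unifZeroConst P) (coreLaw P))).bind fun y =>
    PMF.pure <| simTranscript x hk (msg1OfRows y.1) y.2.2.1 y.2.2.2.2.2.1 y.2.2.2.1 y.2.1
      y.2.2.2.2.1 y.2.2.2.2.2.2.1 y.2.2.2.2.2.2.2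

/-- The run with a uniform mask is the simulation. -/
theorem unif_bind_hybRun (x : Stmt P) (hk : AuxKey P) (r : Fin P.n → P.Rq) (v : P.Zq) :
    (iid (HideRows P) (unifRq P)).bind (hybRun x hk r v) = simRun x hk := by
  refine pmf_ext_ex fun f => ?_
  simp only [simRun, hybRun_eq, ex_bind, ex_prodLaw, ex_pure]
  simp only [ex_comm (iid (HideRows P) (unifRq P)), ex_comm (unifZeroConst P) (coreLaw P)]
  congr 1
  ext k
  obtain ⟨R, e, c, z3, z1, z2⟩ := k
  have h1 : ∀ g : P.Rq, (ex (iid (HideRows P) (unifRq P)) fun t =>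
      f (hybTranscript x hk r v t g R e c z3 z1 z2)) = ex (iid (HideRows P) (unifRq P)) fun t =>
      f (simTranscript x hk (msg1OfRows t) R z3 e (g + combH R e r v) c z1 z2) := by
    intro g
    refine Eq.trans ?_ (ex_iid_add_right (fun a u => unifRq_add a u)
      (Sum.elim (hk.A1.mulVec r) (Sum.elim (fun _ => AdjoinRoot.of _ v)
        (Sum.elim (z3 - matQ R r) fun _ => g)))
      fun t => f (simTranscript x hk (msg1OfRows t) R z3 e (g + combH R e r v) c z1 z2))
    congr 1
    ext t
    have : maskedMsg1 hk r v t (z3 - matQ R r) g = msg1OfRows (t + Sum.elim (hk.A1.mulVec r)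
        (Sum.elim (fun _ => AdjoinRoot.of _ v) (Sum.elim (z3 - matQ R r) fun _ => g))) := by
      rw [maskedMsg1, msg1OfRows]
      congr 1
      exact add_comm _ _
    rw [hybTranscript, this]
  simp only [h1]
  exact ex_unifZeroConst_add (coeff_zero_combH R e r v) fun g =>
    ex (iid (HideRows P) (unifRq P)) fun t =>
      f (simTranscript x hk (msg1OfRows t) R z3 e g c z1 z2)

end Simulator

/-! ### The simulator and the reduction are efficient -/

section Sampling

open Wires

variable {S : Params → Type} [∀ P, Wires P.Zq (S P)]

theorem gaussVec_map_redV (ι : Type) [Fintype ι] (σ : ℝ) : (gaussVec P ι σ).map redV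
    = iid ι (polyOf P.d ((discreteGaussian σ).map fun a : ℤ => (a : P.Zq))) := by
  rw [← polyOf_map_red, ← iid_map]
  rfl

theorem ch1LawZ_map_redCh1 : (ch1LawZ P).map redCh1 = iid (Fin P.δ) (iid (Fin P.d)
    (iid (Fin P.n) (polyOf P.d (bin1.map fun a : ℤ => (a : P.Zq))))) := by
  rw [← polyOf_map_red, ← iid_map, ← iid_map, ← iid_map]
  rfl

theorem eff_unif : Eff fun P (_ : S P) => PMF.uniformOfFintype P.Zq :=
  ⟨_, .const 1, fun _ => impl_unif⟩

theorem eff_unifRq : Eff fun P (_ : S P) => unifRq P := eff_unif.polyOf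

theorem eff_unifZeroConst : Eff fun P (_ : S P) => unifZeroConst P := by
  refine (eff_unif.iid_fin PolyBdd.d).map (U := Params.Rq)
    (f := fun P w => ofCoeffs (Function.update w 0 0))
    ⟨fun P => Fintype.card (Fin P.d) * 1, ?_, fun P => ?_⟩
  · simpa using PolyBdd.d
  · refine Calc.ofCoeffs (Calc.pi fun i => ?_)
    by_cases hi : i = 0
    · subst hi
      simpa using calc_const (P := P) (S := Fin P.d → P.Zq) 0
    · simp only [Function.update_of_ne hi]
      exact Impl.mono (Calc.apply calc_id i) zero_le_one

theorem eff_ch1 : Eff fun P (_ : S P) => (ch1LawZ P).map redCh1 := by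
  simp only [ch1LawZ_map_redCh1]
  exact (((Eff.polyOf ⟨_, .const 1, fun _ => impl_bin⟩).iid_fin PolyBdd.n).iid_fin PolyBdd.d).iid_fin
    PolyBdd.δ

theorem eff_ch2 : Eff fun P (_ : S P) => ch2Law P := by
  have h := ((((eff_unif (S := S)).iid_fin PolyBdd.d).iid_fin PolyBdd.δ).pair
    (eff_unif.iid_fin PolyBdd.pred_d)).map (effCalc_id.wire (U := Ch2)
      (fun P (t : (Fin P.δ → Fin P.d → P.Zq) × (Fin (P.d - 1) → P.Zq)) => ⟨t.1, t.2⟩)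
      (fun _ b => b) fun _ _ _ => rfl)
  simpa only [PMF.map_bind, PMF.pure_map, ch2Law] using h

theorem eff_chal : Eff fun P (_ : S P) => P.chal.map (red P.q) :=
  ⟨_, .const 1, fun _ => impl_chal⟩

theorem eff_coreLaw : Eff fun P (_ : S P) => coreLaw P := by
  refine eff_ch1.pair (eff_ch2.pair (eff_chal.pair (Eff.pair ?_ (Eff.pair ?_ ?_))))
  all_goals simp only [gaussVec_map_redV]
  · exact (Eff.polyOf ⟨_, .const 1, fun _ => impl_gauss3⟩).iid_fin PolyBdd.δ
  · exact (Eff.polyOf ⟨_, .const 1, fun _ => impl_gauss12⟩).iid_fin PolyBdd.n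
  · exact (Eff.polyOf ⟨_, .const 1, fun _ => impl_gauss12⟩).iid_fin PolyBdd.n

theorem eff_unifRows : Eff fun P (_ : S P) => iid (HideRows P) (unifRq P) := by
  refine eff_unifRq.iid ?_
  simp only [Fintype.card_sum, Fintype.card_fin, Fintype.card_unit]
  exact PolyBdd.κ.add ((PolyBdd.const 1).add (PolyBdd.δ.add (.const 1)))

theorem EffCalc.msg1OfRows {t : ∀ P, S P → HideRows P → P.Rq} (ht : EffCalc t) :
    EffCalc fun P s => PoC.msg1OfRows (t P s) := by
  have ht0 := ht.wire (U := fun P => Fin P.κ → P.Rq) (fun _ t i => t (.inl i))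
    (fun _ b => (.inl b.1, b.2)) fun _ _ _ => rfl
  have ht1 := ht.wire (U := fun P => P.Rq) (fun _ t => t (.inr (.inl ())))
    (fun _ b => (.inr (.inl ()), b)) fun _ _ _ => rfl
  have ht2 := ht.wire (U := fun P => Fin P.δ → P.Rq) (fun _ t i => t (.inr (.inr (.inl i))))
    (fun _ b => (.inr (.inr (.inl b.1)), b.2)) fun _ _ _ => rfl
  have ht3 := ht.wire (U := fun P => P.Rq) (fun _ t => t (.inr (.inr (.inr ()))))
    (fun _ b => (.inr (.inr (.inr ())), b)) fun _ _ _ => rfl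
  exact ht0.msg1 ht1 ht2 ht3

theorem eff_simRun : Eff (S := fun P => Stmt P × AuxKey P) (T := Transcript)
    fun _ s => simRun s.1 s.2 := by
  have h := effCalc_id (S := fun P => (Stmt P × AuxKey P) × (HideRows P → P.Rq) × P.Rq × Core P)
  have hy := h.snd
  have hk := hy.snd.snd
  exact Eff.bind (eff_unifRows.pair (eff_unifZeroConst.pair eff_coreLaw))
    (h.fst.fst.simTranscript h.fst.snd hy.fst.msg1OfRows hk.fst hk.snd.snd.snd.fst hk.snd.fst
      hy.snd.fst hk.snd.snd.fst hk.snd.snd.snd.snd.fst hk.snd.snd.snd.snd.snd)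

theorem eff_hybRun : Eff
    (S := fun P => (Stmt P × AuxKey P) × ((Fin P.n → P.Rq) × P.Zq) × (HideRows P → P.Rq))
    (T := Transcript) fun _ s => hybRun s.1.1 s.1.2 s.2.1.1 s.2.1.2 s.2.2 := by
  have h := effCalc_id (S := fun P => ((Stmt P × AuxKey P) × ((Fin P.n → P.Rq) × P.Zq) ×
    (HideRows P → P.Rq)) × P.Rq × Core P)
  have hs := h.fst
  have hy := h.snd
  have hk := hy.snd
  simp only [hybRun_eq]
  exact Eff.bind (eff_unifZeroConst.pair eff_coreLaw)
    (hs.fst.fst.hybTranscript hs.fst.snd hs.snd.fst.fst hs.snd.fst.snd hs.snd.snd hy.fst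
      hk.fst hk.snd.fst hk.snd.snd.fst hk.snd.snd.snd.fst hk.snd.snd.snd.snd.fst
      hk.snd.snd.snd.snd.snd)

end Sampling

/-! ### Honest-verifier zero-knowledge -/

section ZeroKnowledge

theorem abs_Pr_sub_le {μ ν : PMF Bool} {t : ℝ} (ht : 0 ≤ t)
    (h : ∀ f, ex μ f ≤ ENNReal.ofReal (1 + t) * ex ν f) :
    |Pr μ {true} - Pr ν {true}| ≤ t := by
  classical
  have key : ∀ s : Set Bool, Pr μ s ≤ (1 + t) * Pr ν s := by
    intro s
    rw [← ENNReal.ofReal_le_ofReal_iff (mul_nonneg (by linarith) (Pr_nonneg _ _)),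
      ENNReal.ofReal_mul (by linarith), ofReal_Pr, ofReal_Pr]
    exact h _
  have h1 := key {true}
  have h2 := key {true}ᶜ
  have h3 := Pr_add_compl μ {true}
  have h4 := Pr_add_compl ν {true}
  have h5 := Pr_nonneg ν {true}
  have h6 := Pr_nonneg ν {true}ᶜ
  rw [abs_le]
  constructor <;> nlinarith

theorem hideMul_auxKey (A1 : Matrix (Fin P.κ) (Fin P.n) P.Rq)
    (G : Matrix (HideRows P) (Fin P.n) P.Rq) (s : Fin P.n → P.Rq) :
    hideMul (auxKey A1 G) s = G.mulVec s := by
  ext i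
  rcases i with i | i | i | i <;> rfl

theorem exists_isHVZK : ∃ a, ∀ P b, a ≤ b → IsHVZK P b := by
  obtain ⟨N, ⟨a, hN⟩, hSim⟩ := eff_simRun
  obtain ⟨M, ⟨a', hM⟩, hRed⟩ := eff_hybRun
  refine ⟨max a a', fun P b hb => ?_⟩
  obtain ⟨Sim, hSim, hSimRun⟩ := (hSim P).run_eq
  obtain ⟨Red, hRed, hRedRun⟩ := (hRed P).run_eq
  refine ⟨Sim, Red, hSim.trans ((hN P).trans (poly_mono P (le_of_max_le_left hb))),
    hRed.trans ((hM P).trans (poly_mono P (le_of_max_le_right hb))), fun x r v hx A1 Dist => ?_⟩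
  simp only [hSimRun, hRedRun, dualMLWEAdv]
  set μ := (iid (HideRows P) (iid (Fin P.n) (unifRq P))).bind fun G =>
    (nonAborting x (auxKey A1 (Matrix.of G)) r v).bind fun o =>
      o.elim (PMF.pure false) (Dist (auxKey A1 (Matrix.of G))) with hμ
  set ν := (iid (HideRows P) (iid (Fin P.n) (unifRq P))).bind fun G =>
    (secretLaw P).bind fun s => (hybRun x (auxKey A1 (Matrix.of G)) (redV r) v
      ((Matrix.of G).mulVec fun i => red P.q (s i))).bind (Dist (auxKey A1 (Matrix.of G))) with hν
  have e100 : (2 : ℝ) ^ (-100 : ℝ) = (1 / 2) ^ 100 := by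
    rw [Real.rpow_neg (by norm_num), one_div, inv_pow]
    norm_cast
  have h1 : |Pr μ {true} - Pr ν {true}| ≤ 2 ^ (-100 : ℝ) := by
    rw [e100]
    refine abs_Pr_sub_le (by positivity) fun f => ?_
    rw [hμ, hν, ex_bind, ex_bind, ← ex_const_mul]
    refine ex_mono fun G => ?_
    rw [ex_bind]
    refine (ex_nonAborting_le x _ r v hx _).trans (le_of_eq ?_)
    rw [idealRun, ex_bind, ex_bind]
    congr 2
    ext s
    rw [ex_bind, hideMul_auxKey]
    rfl
  have h2 : ∀ G : HideRows P → Fin P.n → P.Rq,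
      ((iid (HideRows P) (unifRq P)).bind fun u =>
        (hybRun x (auxKey A1 (Matrix.of G)) (redV r) v u).bind (Dist (auxKey A1 (Matrix.of G))))
      = (simRun x (auxKey A1 (Matrix.of G))).bind (Dist (auxKey A1 (Matrix.of G))) := by
    intro G
    rw [← unif_bind_hybRun x _ (redV r) v, PMF.bind_bind]
  simp only [h2]
  refine (abs_sub_le _ (Pr ν {true}) _).trans ?_
  rw [add_comm]
  exact add_le_add le_rfl h1

end ZeroKnowledge

end

end PoC

namespace PoC
noncomputable section

set_option linter.unusedSectionVars false

open ENNReal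

variable {P : Params}

/-! ### Point probabilities of random combinations modulo a prime -/

section Fourier

variable {q : ℕ} [NeZero q]

/-- The cosine of the angle `2πx/q`. -/
def cosq (x : ZMod q) : ℝ := Real.cos (2 * Real.pi * (x.val : ℝ) / q)

theorem cosq_eq_re (x : ZMod q) : cosq x = (ZMod.stdAddChar x).re := by
  rw [ZMod.stdAddChar_apply, ZMod.toCircle_apply, cosq, ← Complex.exp_ofReal_mul_I_re]
  congr 2
  push_cast
  ring

theorem cosq_neg (x : ZMod q) : cosq (-x) = cosq x := by
  rw [cosq_eq_re, cosq_eq_re, AddChar.map_neg_eq_conj, Complex.conj_re]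

theorem cosq_sub_add_cosq_add (x y : ZMod q) : cosq (x - y) + cosq (x + y) = 2 * (cosq x * cosq y) := by
  simp only [cosq_eq_re, sub_eq_add_neg, AddChar.map_add_eq_mul, AddChar.map_neg_eq_conj,
    Complex.mul_re, Complex.conj_re, Complex.conj_im]
  ring

theorem sum_cosq_mul (b : ZMod q) : ∑ j, cosq (j * b) = if b = 0 then (q : ℝ) else 0 := by
  have h := AddChar.sum_mulShift b (ZMod.isPrimitive_stdAddChar q)
  have h1 := congrArg Complex.re h
  rw [Complex.re_sum] at h1
  simp only [cosq_eq_re, h1]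
  split_ifs <;> simp [ZMod.card]

open Classical in
/-- The distribution of `∑ xᵢ uᵢ` modulo `q` for independent ternary `xᵢ`, by Fourier inversion. -/
theorem ex_iidFin_ternary {p : ℝ} (hp : 0 ≤ p) (hp1 : p ≤ 1) (n : ℕ) (u : Fin n → ZMod q)
    (b : ZMod q) :
    (ex (iidFin (ternary p) n) fun x => if ∑ i, ((x i : ℤ) : ZMod q) * u i = b then 1 else 0).toReal
      = 1 / q * ∑ j, cosq (j * b) * ∏ i, (p + (1 - p) * cosq (j * u i)) := by
  have hq : (q : ℝ) ≠ 0 := by exact_mod_cast NeZero.ne q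
  induction n generalizing b with
  | zero =>
    simp only [iidFin, ex_pure, Finset.univ_eq_empty, Finset.sum_empty, Finset.prod_empty, mul_one,
      sum_cosq_mul]
    by_cases h : b = 0
    · simp [h, hq]
    · simp [h, Ne.symm h]
  | succ n ih =>
    set Q : ZMod q → ℝ≥0∞ := fun b => ex (iidFin (ternary p) n) fun x =>
      if ∑ i, ((x i : ℤ) : ZMod q) * u i.succ = b then 1 else 0 with hQ
    have hQt : ∀ b, Q b ≠ ⊤ := fun b =>
      ne_top_of_le_ne_top one_ne_top (ex_le_const fun x => by split_ifs <;> simp)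
    have h1 : ∀ a : ℤ, (ex (iidFin (ternary p) n) fun x =>
        if ∑ i, (((Fin.cons a x : Fin (n + 1) → ℤ) i : ℤ) : ZMod q) * u i = b then 1 else 0)
        = Q (b - a * u 0) := by
      intro a
      rw [hQ]
      congr 1
      ext x
      simp only [Fin.sum_univ_succ, Fin.cons_zero, Fin.cons_succ]
      congr 1
      rw [eq_sub_iff_add_eq, add_comm]
    rw [ex_iidFin_succ]
    simp only [h1]
    rw [ex_ternary hp hp1]
    have h2 : (0 : ℝ) ≤ (1 - p) / 2 := by linarith
    rw [ENNReal.toReal_add, ENNReal.toReal_add, ENNReal.toReal_mul, ENNReal.toReal_mul,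
      ENNReal.toReal_mul, ENNReal.toReal_ofReal hp, ENNReal.toReal_ofReal h2, hQ]
    · simp only [ih]
      rw [Finset.mul_sum, Finset.mul_sum, Finset.mul_sum, Finset.mul_sum, Finset.mul_sum,
        Finset.mul_sum, Finset.mul_sum, ← Finset.sum_add_distrib, ← Finset.sum_add_distrib]
      refine Finset.sum_congr rfl fun j _ => ?_
      rw [Fin.prod_univ_succ]
      have h3 := cosq_sub_add_cosq_add (j * b) (j * u 0)
      have e0 : j * (b - ((0 : ℤ) : ZMod q) * u 0) = j * b := by push_cast; ring
      have e1 : j * (b - ((1 : ℤ) : ZMod q) * u 0) = j * b - j * u 0 := by push_cast; ring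
      have e2 : j * (b - ((-1 : ℤ) : ZMod q) * u 0) = j * b + j * u 0 := by push_cast; ring
      rw [e0, e1, e2]
      generalize ∏ i : Fin n, (p + (1 - p) * cosq (j * u i.succ)) = z
      have e3 : cosq (j * b + j * u 0) = 2 * (cosq (j * b) * cosq (j * u 0))
        - cosq (j * b - j * u 0) := by linarith
      rw [e3]
      ring
    all_goals first
      | exact ENNReal.mul_ne_top ENNReal.ofReal_ne_top (hQt _)
      | exact ENNReal.add_ne_top.2 ⟨ENNReal.mul_ne_top ENNReal.ofReal_ne_top (hQt _),
          ENNReal.mul_ne_top ENNReal.ofReal_ne_top (hQt _)⟩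

open Classical in
theorem ex_iidFin_ternary_le {p : ℝ} (hp : 0 ≤ p) (hp1 : p ≤ 1) (n : ℕ) (u : Fin n → ZMod q)
    (b : ZMod q) :
    (ex (iidFin (ternary p) n) fun x => if ∑ i, ((x i : ℤ) : ZMod q) * u i = b then 1 else 0)
      ≤ ENNReal.ofReal (1 / q * ∑ j, ∏ i, |p + (1 - p) * cosq (j * u i)|) := by
  rw [← ENNReal.ofReal_toReal (a := ex _ _) (ne_top_of_le_ne_top one_ne_top
    (ex_le_const fun x => by split_ifs <;> simp)), ex_iidFin_ternary hp hp1]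
  refine ENNReal.ofReal_le_ofReal (mul_le_mul_of_nonneg_left (Finset.sum_le_sum fun j _ => ?_)
    (by positivity))
  rw [← Finset.abs_prod]
  refine (le_abs_self _).trans ?_
  rw [abs_mul]
  exact mul_le_of_le_one_left (abs_nonneg _) (Real.abs_cos_le_one _)

end Fourier

section Slots

theorem l_pos (P : Params) : 0 < P.l :=
  Nat.pos_of_dvd_of_pos P.l_dvd (Nat.pos_of_ne_zero (NeZero.ne P.d))

theorem l_mul_div (P : Params) : P.l * (P.d / P.l) = P.d := Nat.mul_div_cancel' P.l_dvd

theorem ζ_pow_l (P : Params) : P.ζ ^ P.l = -1 := by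
  have h : (P.ζ ^ P.l) ^ 2 = 1 := by rw [← pow_mul, mul_comm, P.ζ_prim.pow_eq_one]
  rcases (sq_eq_sq_iff_eq_or_eq_neg (b := 1)).1 (h.trans (one_pow 2).symm) with h1 | h1
  · exact absurd h1 (P.ζ_prim.pow_ne_one_of_pos_of_lt (l_pos P).ne' (by have := l_pos P; omega))
  · exact h1

/-- Multiplication of the exponents by an odd number permutes the factors of `maxProb`. -/
theorem prod_odd_pow (j : P.Zq) (J : ℕ) :
    ∏ s ∈ Finset.range P.l, |P.p + (1 - P.p) * cosq (j * (P.ζ ^ (2 * J + 1)) ^ s)|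
      = ∏ i ∈ Finset.range P.l, |P.p + (1 - P.p) * cosq (j * P.ζ ^ i)| := by
  have hper : Function.Periodic (fun i : ℕ => |P.p + (1 - P.p) * cosq (j * P.ζ ^ i)|) P.l := by
    intro i
    simp only [pow_add, ζ_pow_l, mul_neg, mul_one, cosq_neg]
  have hcop : P.l.gcd (2 * J + 1) = 1 := by
    obtain ⟨e, _, he⟩ := (Nat.dvd_prime_pow Nat.prime_two).1
      (show P.l ∣ 2 ^ 8 from P.l_dvd.trans P.d_dvd)
    rw [he]
    exact Nat.Coprime.pow_left _ (Nat.coprime_two_left.2 ⟨J, rfl⟩)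
  have hmaps : ∀ s ∈ Finset.range P.l, (2 * J + 1) * s % P.l ∈ Finset.range P.l := fun s _ =>
    Finset.mem_range.2 (Nat.mod_lt _ (l_pos P))
  have hinj : Set.InjOn (fun s => (2 * J + 1) * s % P.l) (Finset.range P.l : Set ℕ) := by
    intro a ha b hb h
    have h1 : a ≡ b [MOD P.l] := Nat.ModEq.cancel_left_of_coprime hcop h
    rw [Finset.coe_range, Set.mem_Iio] at ha hb
    rwa [Nat.ModEq, Nat.mod_eq_of_lt ha, Nat.mod_eq_of_lt hb] at h1
  refine Finset.prod_nbij (fun s => (2 * J + 1) * s % P.l) hmaps hinj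
    (Finset.surjOn_of_injOn_of_card_le _ hmaps hinj le_rfl) fun s _ => ?_
  rw [hper.map_mod_nat ((2 * J + 1) * s), pow_mul]

open Classical in
theorem ex_slot_le (J : ℕ) (b : P.Zq) :
    (ex (iidFin (ternary P.p) P.l) fun x =>
      if ∑ s, ((x s : ℤ) : P.Zq) * (P.ζ ^ (2 * J + 1)) ^ (s : ℕ) = b then 1 else 0)
      ≤ ENNReal.ofReal P.maxProb := by
  refine (ex_iidFin_ternary_le P.p_pos.le P.p_lt.le P.l
    (fun s => (P.ζ ^ (2 * J + 1)) ^ (s : ℕ)) b).trans (ENNReal.ofReal_le_ofReal ?_)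
  have h1 : ∀ j : P.Zq, ∏ s : Fin P.l, |P.p + (1 - P.p) * cosq (j * (P.ζ ^ (2 * J + 1)) ^ (s : ℕ))|
      = ∏ i ∈ Finset.range P.l, |P.p + (1 - P.p) * cosq (j * P.ζ ^ i)| := fun j => by
    rw [← prod_odd_pow j J, Finset.prod_range]
  simp only [h1]
  rw [← Finset.add_sum_erase _ _ (Finset.mem_univ 0), Params.maxProb, mul_add]
  have h2 : Finset.univ.filter (fun j : P.Zq => j ≠ 0) = Finset.univ.erase 0 := by
    ext j
    simp
  have h3 : ∏ i ∈ Finset.range P.l, |P.p + (1 - P.p) * cosq ((0 : P.Zq) * P.ζ ^ i)| = 1 := by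
    simp [cosq]
  rw [h3, mul_one]
  refine le_of_eq ?_
  congr 3
  exact h2.symm

/-- The position of the coefficient of `X^(t + (d/l) s)`. -/
def slotEquiv (P : Params) : Fin (P.d / P.l) × Fin P.l ≃ Fin P.d :=
  (Equiv.prodComm _ _).trans (finProdFinEquiv.trans (finCongr (l_mul_div P)))

theorem slotEquiv_val (x : Fin (P.d / P.l) × Fin P.l) :
    (slotEquiv P x : ℕ) = x.1 + P.d / P.l * x.2 := rfl

theorem iid_fin_eq {α : Type} (μ : PMF α) (n : ℕ) : iid (Fin n) μ = iidFin μ n := by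
  ext v
  rw [iid_apply, iidFin_apply]

open Classical in
theorem ex_ternaryPoly_slots_le (J : ℕ) (b : Fin (P.d / P.l) → P.Zq) :
    (ex P.ternaryPoly fun c => if ∀ t, ∑ s : Fin P.l,
      (((PoC.coeff c (slotEquiv P (t, s)) : ℤ)) : P.Zq) * (P.ζ ^ (2 * J + 1)) ^ (s : ℕ) = b t
        then 1 else 0) ≤ ENNReal.ofReal P.maxProb ^ (P.d / P.l) := by
  rw [Params.ternaryPoly, polyOf, ex_map]
  simp only [coeff_ofCoeffs]
  have h1 := ex_map (iid (Fin P.d) (ternary P.p)) (fun v k => v (slotEquiv P k)) fun w =>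
    if ∀ t, ∑ s : Fin P.l, ((w (t, s) : ℤ) : P.Zq) * (P.ζ ^ (2 * J + 1)) ^ (s : ℕ) = b t
      then (1 : ℝ≥0∞) else 0
  rw [← h1, iid_comp_equiv, ← iid_uncurry, ex_map]
  have h2 : ∀ w : Fin (P.d / P.l) → Fin P.l → ℤ,
      (if ∀ t, ∑ s : Fin P.l, ((w t s : ℤ) : P.Zq) * (P.ζ ^ (2 * J + 1)) ^ (s : ℕ) = b t
        then (1 : ℝ≥0∞) else 0)
      = ∏ t, if ∑ s : Fin P.l, ((w t s : ℤ) : P.Zq) * (P.ζ ^ (2 * J + 1)) ^ (s : ℕ) = b t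
        then 1 else 0 := by
    intro w
    rw [Finset.prod_ite_zero]
    simp
  simp only [h2]
  rw [ex_iid_prod (iid (Fin P.l) (ternary P.p)) fun t (x : Fin P.l → ℤ) =>
    if ∑ s : Fin P.l, ((x s : ℤ) : P.Zq) * (P.ζ ^ (2 * J + 1)) ^ (s : ℕ) = b t then 1 else 0]
  calc _ ≤ ∏ _t : Fin (P.d / P.l), ENNReal.ofReal P.maxProb := Finset.prod_le_prod' fun t _ => by
        rw [iid_fin_eq]
        exact ex_slot_le J (b t)
    _ = _ := by simp

end Slots

/-! ### Differences of challenges are invertible -/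

section Units

theorem X_pow_d_add_one (P : Params) : (X ^ P.d + 1 : (ZMod P.q)[X])
    = ∏ J ∈ Finset.range P.l, (X ^ (P.d / P.l) - C (P.ζ ^ (2 * J + 1))) := by
  have h := X_pow_sub_C_eq_prod (P.ζ_prim.pow (by have := l_pos P; omega) rfl) (l_pos P) (ζ_pow_l P)
  have h1 := congrArg (expand (ZMod P.q) (P.d / P.l)) h
  rw [map_prod] at h1
  simp only [map_sub, map_pow, expand_X, expand_C, ← pow_mul] at h1
  rw [mul_comm, l_mul_div] at h1
  rw [C_neg, C_1, sub_neg_eq_add] at h1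
  rw [h1]
  refine Finset.prod_congr rfl fun J _ => ?_
  rw [pow_succ]

theorem exists_dvd_of_not_isUnit {p : (ZMod P.q)[X]}
    (h : ¬ IsUnit (AdjoinRoot.mk (X ^ P.d + 1 : (ZMod P.q)[X]) p)) :
    ∃ J < P.l, (X ^ (P.d / P.l) - C (P.ζ ^ (2 * J + 1)) : (ZMod P.q)[X]) ∣ p := by
  by_contra! hc
  refine h ?_
  have h1 : IsCoprime p (X ^ P.d + 1) := by
    rw [X_pow_d_add_one]
    refine IsCoprime.prod_right fun J hJ => ?_
    have hJ := Finset.mem_range.1 hJ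
    exact ((P.irred J hJ).coprime_iff_not_dvd.2 (hc J hJ)).symm
  obtain ⟨u, v, huv⟩ := h1
  refine IsUnit.of_mul_eq_one (AdjoinRoot.mk _ u) ?_
  have h2 := congrArg (AdjoinRoot.mk (X ^ P.d + 1 : (ZMod P.q)[X])) huv
  rw [map_add, map_mul, map_mul, AdjoinRoot.mk_self, mul_zero, add_zero, map_one] at h2
  rw [mul_comm, h2]

/-- The coefficients of the reduction of a non-unit modulo some prime factor vanish. -/
theorem exists_slots_eq_zero {a : P.Rq} (h : ¬ IsUnit a) :
    ∃ J < P.l, ∀ t, ∑ s : Fin P.l,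
      PoC.coeff a (slotEquiv P (t, s)) * (P.ζ ^ (2 * J + 1)) ^ (s : ℕ) = 0 := by
  rw [← ofCoeffs_coeff a, ofCoeffs] at h
  obtain ⟨J, hJ, hdvd⟩ := exists_dvd_of_not_isUnit h
  refine ⟨J, hJ, ?_⟩
  set η := P.ζ ^ (2 * J + 1) with hη
  set m := P.d / P.l with hm
  have hm0 : 0 < m := Nat.div_pos (Nat.le_of_dvd (Nat.pos_of_ne_zero (NeZero.ne P.d)) P.l_dvd)
    (l_pos P)
  have : NeZero m := ⟨hm0.ne'⟩
  set g : (ZMod P.q)[X] := ∑ t : Fin m, C (∑ s : Fin P.l,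
    PoC.coeff a (slotEquiv P (t, s)) * η ^ (s : ℕ)) * X ^ (t : ℕ) with hg
  have h1 : (X ^ m - C η : (ZMod P.q)[X]) ∣ (∑ i, C (PoC.coeff a i) * X ^ (i : ℕ)) - g := by
    rw [← Equiv.sum_comp (slotEquiv P), Fintype.sum_prod_type, hg, ← Finset.sum_sub_distrib]
    refine Finset.dvd_sum fun t _ => ?_
    rw [map_sum, Finset.sum_mul, ← Finset.sum_sub_distrib]
    refine Finset.dvd_sum fun s _ => ?_
    have e : C (PoC.coeff a (slotEquiv P (t, s))) * X ^ (slotEquiv P (t, s) : ℕ)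
        - C (PoC.coeff a (slotEquiv P (t, s)) * η ^ (s : ℕ)) * X ^ (t : ℕ)
        = (C (PoC.coeff a (slotEquiv P (t, s))) * X ^ (t : ℕ)) *
          ((X ^ m) ^ (s : ℕ) - (C η) ^ (s : ℕ) : (ZMod P.q)[X]) := by
      rw [slotEquiv_val, pow_add, pow_mul, C_mul, C_pow]
      ring
    rw [e]
    exact Dvd.dvd.mul_left (sub_dvd_pow_sub_pow _ _ _) _
  have h2 : (X ^ m - C η : (ZMod P.q)[X]) ∣ g := (dvd_sub_right hdvd).1 h1
  have h3 : g = 0 := by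
    refine eq_zero_of_dvd_of_degree_lt h2 ?_
    rw [degree_X_pow_sub_C hm0]
    exact degree_sum_fin_lt _
  intro t
  have h4 := congrArg (fun p : (ZMod P.q)[X] => p.coeff t) h3
  simpa only [hg, finsetSum_coeff, coeff_C_mul, coeff_X_pow, Fin.val_inj, mul_ite, mul_one, mul_zero,
    Finset.sum_ite_eq, Finset.mem_univ, if_true, Polynomial.coeff_zero] using h4

theorem Pr_small_pos (P : Params) : 0 < Pr P.ternaryPoly {c | l1Z c ≤ P.ω} := by
  classical
  obtain ⟨c, hc, hc'⟩ := exists_small_ternaryPoly P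
  rw [Pr_eq_ex, ENNReal.toReal_pos_iff]
  refine ⟨?_, (ex_indicator_le_one _ _).trans_lt one_lt_top⟩
  refine pos_iff_ne_zero.2 fun h => ?_
  have h1 := ENNReal.tsum_eq_zero.1 h c
  simp only [if_pos hc, mul_one] at h1
  exact hc' h1

theorem maxProb_nonneg (P : Params) : 0 ≤ P.maxProb := by
  rw [Params.maxProb]
  positivity

open Classical in
/-- For a fixed second challenge the difference of two challenges is invertible with high
probability. -/
theorem ex_chal_not_isUnit_le {K : ℝ}
    (hK : (P.q * P.maxProb) ^ (P.d / P.l) ≤ K * Pr P.ternaryPoly {c | l1Z c ≤ P.ω}) (c' : P.Rq) :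
    (ex (P.chal.map (red P.q)) fun c => if IsUnit (c - c') then 0 else 1)
      ≤ ENNReal.ofReal (K * (P.l / (P.q : ℝ) ^ (P.d / P.l))) := by
  set m := P.d / P.l with hm
  set π := Pr P.ternaryPoly {c | l1Z c ≤ P.ω} with hπ
  have hπ0 := Pr_small_pos P
  have hq0 : (0 : ℝ) < P.q := by exact_mod_cast P.q_prime.pos
  have hM := maxProb_nonneg P
  have key : ∀ J : ℕ, (ex P.chal fun c => if ∀ t, ∑ s : Fin P.l,
      PoC.coeff (red P.q c - c') (slotEquiv P (t, s)) * (P.ζ ^ (2 * J + 1)) ^ (s : ℕ) = 0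
      then 1 else 0) ≤ ENNReal.ofReal (K / (P.q : ℝ) ^ m) := by
    intro J
    have h1 := ex_condOn_le P.ternaryPoly {c | l1Z c ≤ P.ω} (fun c => if ∀ t, ∑ s : Fin P.l,
      PoC.coeff (red P.q c - c') (slotEquiv P (t, s)) * (P.ζ ^ (2 * J + 1)) ^ (s : ℕ) = 0
      then 1 else 0) (exists_small_ternaryPoly P)
    rw [← ofReal_Pr] at h1
    have h2 := ex_ternaryPoly_slots_le J fun t => ∑ s : Fin P.l,
      PoC.coeff c' (slotEquiv P (t, s)) * (P.ζ ^ (2 * J + 1)) ^ (s : ℕ)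
    have h3 : ex P.chal (fun c => if ∀ t, ∑ s : Fin P.l,
      PoC.coeff (red P.q c - c') (slotEquiv P (t, s)) * (P.ζ ^ (2 * J + 1)) ^ (s : ℕ) = 0
      then 1 else 0) * ENNReal.ofReal π ≤ ENNReal.ofReal (P.maxProb ^ m) := by
      rw [Params.chal, h1, ENNReal.ofReal_pow hM]
      refine le_trans (ex_mono fun c => ?_) h2
      simp only [coeff_sub, coeff_red, Pi.sub_apply, sub_mul, Finset.sum_sub_distrib, sub_eq_zero]
      split_ifs <;> simp
    rw [← ENNReal.le_div_iff_mul_le (Or.inl (ENNReal.ofReal_pos.2 hπ0).ne')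
      (Or.inl ENNReal.ofReal_ne_top), ← ENNReal.ofReal_div_of_pos hπ0] at h3
    refine h3.trans (ENNReal.ofReal_le_ofReal ?_)
    rw [div_le_div_iff₀ hπ0 (by positivity), ← mul_pow, mul_comm P.maxProb]
    exact hK
  rw [ex_map]
  have h4 : ∀ c : P.RZ, (if IsUnit (red P.q c - c') then 0 else 1 : ℝ≥0∞)
      ≤ ∑ J ∈ Finset.range P.l, if ∀ t, ∑ s : Fin P.l,
      PoC.coeff (red P.q c - c') (slotEquiv P (t, s)) * (P.ζ ^ (2 * J + 1)) ^ (s : ℕ) = 0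
      then 1 else 0 := by
    intro c
    split_ifs with h
    · exact zero_le
    · obtain ⟨J, hJ, ht⟩ := exists_slots_eq_zero h
      refine le_trans (le_of_eq ?_) (Finset.single_le_sum (f := fun J => if ∀ t, ∑ s : Fin P.l,
        PoC.coeff (red P.q c - c') (slotEquiv P (t, s)) * (P.ζ ^ (2 * J + 1)) ^ (s : ℕ) = 0
        then (1 : ℝ≥0∞) else 0) (fun _ _ => zero_le) (Finset.mem_range.2 hJ))
      exact (if_pos ht).symm
  refine (ex_mono h4).trans ?_
  rw [ex_finset_sum]
  refine (Finset.sum_le_sum fun J _ => key J).trans ?_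
  rw [Finset.sum_const, Finset.card_range, nsmul_eq_mul, ← ENNReal.ofReal_natCast,
    ← ENNReal.ofReal_mul (Nat.cast_nonneg _)]
  refine ENNReal.ofReal_le_ofReal (le_of_eq ?_)
  ring

end Units

end

end PoC

namespace PoC
noncomputable section

set_option linter.unusedSectionVars false

/-! ### Circuits with oracle gates -/

section Oracle

/-- A circuit viewed as one over a larger set of gates. -/
def Circuit.inl {G G' : Type} {dom cod : G → Type} {dom' cod' : G' → Type} {α β : Type} :
    Circuit G dom cod α β → Circuit (G ⊕ G') (Sum.elim dom dom') (Sum.elim cod cod') α β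
  | .wire f => .wire f
  | .gate g => .gate (Sum.inl g)
  | .comp F F' => .comp F.inl F'.inl
  | .pair F F' => .pair F.inl F'.inl

theorem Circuit.size_inl {G G' : Type} {dom cod : G → Type} {dom' cod' : G' → Type} {α β : Type}
    (C : Circuit G dom cod α β) : (C.inl (dom' := dom') (cod' := cod')).size = C.size := by
  induction C with
  | wire f => rfl
  | gate g => rfl
  | comp F F' h h' => exact congrArg₂ (· + ·) h h'
  | pair F F' h h' => exact congrArg₂ (· + ·) h h'

variable {P : Params}

theorem eval_inl (A : DetProver P) {α β : Type} (C : Circuit (Gate P) Gate.dom Gate.cod α β) :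
    (C.inl (dom' := Query.dom P) (cod' := Query.cod P)).eval (oracleInterp A)
      = C.eval Gate.interp := by
  induction C with
  | wire f => rfl
  | gate g => rfl
  | comp F F' h h' =>
    simp only [Circuit.inl, Circuit.eval]
    rw [h, h']
  | pair F F' h h' =>
    simp only [Circuit.inl, Circuit.eval]
    rw [h, h']

open Wires

variable {S T U : Type} [Wires P.Zq S] [Wires P.Zq T] [Wires P.Zq U]

variable (P) in
/-- The randomised function `F` with access to a prover is computed by an oracle circuit with at
most `N` gates. -/
def OImpl (F : DetProver P → S → PMF T) (N : ℕ) : Prop :=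
  ∃ C : OracleAlgorithm P S T, C.size ≤ N ∧
    ∀ A x, C.eval (oracleInterp A) (enc x) = (F A x).map (enc (K := P.Zq))

theorem OImpl.run_eq [LawfulWires P.Zq T] {F : DetProver P → S → PMF T} {N : ℕ}
    (h : OImpl P F N) :
    ∃ C : OracleAlgorithm P S T, C.size ≤ N ∧ ∀ A x, C.run A x = F A x := by
  obtain ⟨C, hC, h⟩ := h
  refine ⟨C, hC, fun A x => ?_⟩
  rw [OracleAlgorithm.run, h, PMF.map_comp]
  have : (dec : (idx P.Zq T → P.Zq) → T) ∘ enc = id := funext LawfulWires.dec_enc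
  rw [this, PMF.map_id]

theorem OImpl.congr {F F' : DetProver P → S → PMF T} {N : ℕ} (h : OImpl P F N)
    (hF : ∀ A x, F A x = F' A x) : OImpl P F' N :=
  (funext fun A => funext (hF A) : F = F') ▸ h

theorem Impl.oracle {F : S → PMF T} {N : ℕ} (h : Impl P F N) : OImpl P (fun _ => F) N := by
  obtain ⟨C, hC, h⟩ := h
  refine ⟨C.inl, (Circuit.size_inl C).le.trans hC, fun A x => ?_⟩
  rw [eval_inl, h]

theorem OImpl.comp {F : DetProver P → S → PMF T} {F' : DetProver P → T → PMF U} {N N' : ℕ}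
    (h : OImpl P F N) (h' : OImpl P F' N') :
    OImpl P (fun A x => (F A x).bind (F' A)) (N + N') := by
  obtain ⟨C, hC, h⟩ := h
  obtain ⟨C', hC', h'⟩ := h'
  refine ⟨Circuit.comp C C', add_le_add hC hC', fun A x => ?_⟩
  change (C.eval _ (enc x)).bind (C'.eval _) = _
  rw [h, PMF.bind_map, PMF.map_bind]
  congr 1
  funext y
  exact h' A y

theorem OImpl.pair {F : DetProver P → S → PMF T} {F' : DetProver P → S → PMF U} {N N' : ℕ}
    (h : OImpl P F N) (h' : OImpl P F' N') :
    OImpl P (fun A x => prodLaw (F A x) (F' A x)) (N + N') := by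
  obtain ⟨C, hC, h⟩ := h
  obtain ⟨C', hC', h'⟩ := h'
  refine ⟨Circuit.pair C C', add_le_add hC hC', fun A x => ?_⟩
  change (C.eval _ (enc x)).bind (fun y => (C'.eval _ (enc x)).bind fun z =>
    PMF.pure (Sum.elim y z)) = _
  rw [h, h', PMF.bind_map]
  simp only [prodLaw]
  rw [PMF.map_bind]
  congr 1
  funext y
  simp only [Function.comp, PMF.bind_map, PMF.map_bind, PMF.pure_map]
  rfl

theorem OImpl.bind {F : DetProver P → S → PMF T} {F' : DetProver P → S → T → PMF U} {N N' : ℕ}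
    (h : OImpl P F N) (h' : OImpl P (fun A (p : S × T) => F' A p.1 p.2) N') :
    OImpl P (fun A x => (F A x).bind fun y => F' A x y) (N + N') := by
  have h1 := (OImpl.pair (Impl.oracle (calc_id (P := P) (S := S))) h).comp h'
  rw [zero_add] at h1
  refine h1.congr fun A x => ?_
  simp only [prodLaw, PMF.pure_bind, PMF.bind_bind]

theorem oImpl_msg1 : OImpl P (fun A (_ : S) => PMF.pure A.msg1) 1 := by
  refine ⟨Circuit.comp (Circuit.wire Empty.elim) (Circuit.gate (Sum.inr Query.msg1)), le_rfl,
    fun A x => ?_⟩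
  rw [PMF.pure_map]
  exact PMF.pure_bind _ _

theorem oImpl_msg4 : OImpl P (fun A (t : Ch1 P × Ch2 P × P.Rq) =>
    PMF.pure (A.msg4 t.1 t.2.1 t.2.2)) 1 := by
  refine ⟨Circuit.gate (Sum.inr Query.msg4), le_rfl, fun A x => ?_⟩
  rw [PMF.pure_map]
  change PMF.pure (enc (A.msg4 (dec (enc x) : Ch1 P × Ch2 P × P.Rq).1
    (dec (enc x) : Ch1 P × Ch2 P × P.Rq).2.1 (dec (enc x) : Ch1 P × Ch2 P × P.Rq).2.2)) = _
  rw [LawfulWires.dec_enc]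

end Oracle

section EfficientOracle

variable {S T U : Params → Type} [∀ P, Wires P.Zq (S P)] [∀ P, Wires P.Zq (T P)]
  [∀ P, Wires P.Zq (U P)]

/-- A family of randomised functions that is computed by oracle circuits of polynomial size. -/
def OEff (F : ∀ P, DetProver P → S P → PMF (T P)) : Prop :=
  ∃ N, PolyBdd N ∧ ∀ P, OImpl P (F P) (N P)

/-- A family of functions that is computed by oracle circuits of polynomial size. -/
def OEffCalc (f : ∀ P, DetProver P → S P → T P) : Prop := OEff fun P A x => PMF.pure (f P A x)

theorem Eff.oracle {F : ∀ P, S P → PMF (T P)} (h : Eff F) : OEff fun P _ => F P :=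
  let ⟨_, hN, h⟩ := h
  ⟨_, hN, fun P => (h P).oracle⟩

theorem EffCalc.oracle {f : ∀ P, S P → T P} (h : EffCalc f) : OEffCalc fun P _ => f P :=
  Eff.oracle h

theorem OEff.bind {F : ∀ P, DetProver P → S P → PMF (T P)}
    {F' : ∀ P, DetProver P → S P → T P → PMF (U P)} (h : OEff F)
    (h' : OEff fun P A (p : S P × T P) => F' P A p.1 p.2) :
    OEff fun P A x => (F P A x).bind (F' P A x) :=
  let ⟨_, hN, h⟩ := h
  let ⟨_, hM, h'⟩ := h'
  ⟨_, hN.add hM, fun P => (h P).bind (h' P)⟩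

theorem OEffCalc.comp {f : ∀ P, DetProver P → S P → T P} {g : ∀ P, DetProver P → T P → U P}
    (hg : OEffCalc g) (hf : OEffCalc f) : OEffCalc fun P A x => g P A (f P A x) := by
  obtain ⟨N, hN, hf⟩ := hf
  obtain ⟨M, hM, hg⟩ := hg
  refine ⟨_, hN.add hM, fun P => ((hf P).comp (hg P)).congr fun A x => ?_⟩
  rw [PMF.pure_bind]

theorem OEffCalc.prodMk {f : ∀ P, DetProver P → S P → T P} {g : ∀ P, DetProver P → S P → U P}
    (hf : OEffCalc f) (hg : OEffCalc g) : OEffCalc fun P A x => (f P A x, g P A x) := by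
  obtain ⟨N, hN, hf⟩ := hf
  obtain ⟨M, hM, hg⟩ := hg
  refine ⟨_, hN.add hM, fun P => ((hf P).pair (hg P)).congr fun A x => ?_⟩
  rw [prodLaw, PMF.pure_bind, PMF.pure_bind]

theorem oEffCalc_msg1 : OEffCalc fun P A (_ : S P) => A.msg1 :=
  ⟨_, .const 1, fun _ => oImpl_msg1⟩

theorem oEffCalc_msg4 : OEffCalc (S := fun P => Ch1 P × Ch2 P × P.Rq) (T := Msg4)
    fun _ A t => A.msg4 t.1 t.2.1 t.2.2 :=
  ⟨_, .const 1, fun _ => oImpl_msg4⟩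

theorem OEffCalc.msg4 {R : ∀ P, S P → Ch1 P} {e : ∀ P, S P → Ch2 P} {c : ∀ P, S P → P.Rq}
    (hR : EffCalc R) (he : EffCalc e) (hc : EffCalc c) :
    OEffCalc fun P A s => A.msg4 (R P s) (e P s) (c P s) := by
  have h := OEffCalc.comp oEffCalc_msg4 (hR.prodMk (he.prodMk hc)).oracle
  exact h

end EfficientOracle

/-! ### The extractor -/

section Extractor

variable {P : Params}

/-- The challenges of two runs that differ only in the last challenge. -/
abbrev Fork (P : Params) : Type := Ch1 P × Ch2 P × P.Rq × P.Rq

def forkLaw (P : Params) : PMF (Fork P) :=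
  prodLaw ((ch1LawZ P).map redCh1) <| prodLaw (ch2Law P) <|
    prodLaw (P.chal.map (red P.q)) (P.chal.map (red P.q))

/-- The difference `c̄` of the last challenges. -/
def cbar (k : Fork P) : P.Rq := k.2.2.1 - k.2.2.2

/-- The differences of the last responses. -/
def zbar1 (A : DetProver P) (k : Fork P) : Fin P.n → P.Rq :=
  (A.msg4 k.1 k.2.1 k.2.2.1).z1 - (A.msg4 k.1 k.2.1 k.2.2.2).z1

def zbar2 (A : DetProver P) (k : Fork P) : Fin P.n → P.Rq :=
  (A.msg4 k.1 k.2.1 k.2.2.1).z2 - (A.msg4 k.1 k.2.1 k.2.2.2).z2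

/-- The candidate witness. -/
def openingOf (hk : AuxKey P) (m1 : Msg1 P) (c : P.Rq) (z1 z2 : Fin P.n → P.Rq) : Opening P where
  cbar := c
  r := Ring.inverse c • z1
  s := Ring.inverse c • z2
  m1 := m1.f1 - hk.B1 ⬝ᵥ (Ring.inverse c • z2)
  m2 := (P.sq : P.Rq) * (m1.f1 - hk.B1 ⬝ᵥ (Ring.inverse c • z2))
  m3 := m1.f1 - hk.B1 ⬝ᵥ (Ring.inverse c • z2)

/-- The candidate solution of module SIS. -/
def msisOf (c : P.Rq) (z1 z2 : Fin P.n → P.Rq) (c' : P.Rq) (z1' z2' : Fin P.n → P.Rq) :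
    Fin P.n ⊕ Fin P.n → P.Rq :=
  Sum.elim (c' • z1 - c • z1') (c' • z2 - c • z2')

/-- The extractor forks the prover twice. -/
def extRun (hk : AuxKey P) (A : DetProver P) : PMF (Opening P × (Fin P.n ⊕ Fin P.n → P.Rq)) :=
  (prodLaw (forkLaw P) (forkLaw P)).bind fun k => PMF.pure
    (openingOf hk A.msg1 (cbar k.1) (zbar1 A k.1) (zbar2 A k.1),
      msisOf (cbar k.1) (zbar1 A k.1) (zbar2 A k.1) (cbar k.2) (zbar1 A k.2) (zbar2 A k.2))

open Wires

variable {S : Params → Type} [∀ P, Wires P.Zq (S P)]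

theorem EffCalc.openingOf {hk : ∀ P, S P → AuxKey P} {m1 : ∀ P, S P → Msg1 P}
    {c : ∀ P, S P → P.Rq} {z1 z2 : ∀ P, S P → Fin P.n → P.Rq} (hhk : EffCalc hk) (hm1 : EffCalc m1)
    (hc : EffCalc c) (hz1 : EffCalc z1) (hz2 : EffCalc z2) :
    EffCalc fun P s => PoC.openingOf (hk P s) (m1 P s) (c P s) (z1 P s) (z2 P s) := by
  have hB1 := hhk.wire (fun _ => AuxKey.B1) (fun _ b => Sum.inr (Sum.inr (Sum.inl b)))
    fun _ _ _ => rfl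
  have hf1 := hm1.wire (fun _ => Msg1.f1) (fun _ b => Sum.inr (Sum.inl b)) fun _ _ _ => rfl
  have hs := hc.inverse.smulVec PolyBdd.n hz2
  have hm := hf1.subRq (hB1.dotProduct PolyBdd.n hs)
  exact (hc.prodMk ((hc.inverse.smulVec PolyBdd.n hz1).prodMk (hs.prodMk (hm.prodMk
    (((effCalc_const fun P => (P.sq : P.Rq)).mulRq hm).prodMk hm))))).wire (U := Opening)
    (fun P (t : P.Rq × (Fin P.n → P.Rq) × (Fin P.n → P.Rq) × P.Rq × P.Rq × P.Rq) =>
      ⟨t.1, t.2.1, t.2.2.1, t.2.2.2.1, t.2.2.2.2.1, t.2.2.2.2.2⟩) (fun _ b => b) fun _ _ _ => rfl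

theorem EffCalc.msisOf {c c' : ∀ P, S P → P.Rq} {z1 z2 z1' z2' : ∀ P, S P → Fin P.n → P.Rq}
    (hc : EffCalc c) (hz1 : EffCalc z1) (hz2 : EffCalc z2) (hc' : EffCalc c') (hz1' : EffCalc z1')
    (hz2' : EffCalc z2') : EffCalc fun P s =>
      PoC.msisOf (c P s) (z1 P s) (z2 P s) (c' P s) (z1' P s) (z2' P s) := by
  have h1 := (hc'.smulVec PolyBdd.n hz1).subVec PolyBdd.n (hc.smulVec PolyBdd.n hz1')
  have h2 := (hc'.smulVec PolyBdd.n hz2).subVec PolyBdd.n (hc.smulVec PolyBdd.n hz2')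
  exact (h1.prodMk h2).wire (U := fun P => Fin P.n ⊕ Fin P.n → P.Rq)
    (fun P (t : (Fin P.n → P.Rq) × (Fin P.n → P.Rq)) => Sum.elim t.1 t.2)
    (fun P (b : (Fin P.n ⊕ Fin P.n) × Fin P.d) =>
      Sum.elim (fun i => Sum.inl (i, b.2)) (fun i => Sum.inr (i, b.2)) b.1)
    fun _ _ b => by
      obtain ⟨i | i, b⟩ := b <;> rfl

theorem eff_forkLaw : Eff fun P (_ : S P) => forkLaw P :=
  eff_ch1.pair (eff_ch2.pair (eff_chal.pair eff_chal))

theorem oEff_extRun : OEff (S := fun P => Stmt P × AuxKey P)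
    (T := fun P => Opening P × (Fin P.n ⊕ Fin P.n → P.Rq)) fun _ A s => extRun s.2 A := by
  have h := effCalc_id (S := fun P => (Stmt P × AuxKey P) × Fork P × Fork P)
  have hs : Eff fun P (_ : Stmt P × AuxKey P) => prodLaw (forkLaw P) (forkLaw P) :=
    eff_forkLaw.pair eff_forkLaw
  have q1 := OEffCalc.msg4 h.snd.fst.fst h.snd.fst.snd.fst h.snd.fst.snd.snd.fst
  have q2 := OEffCalc.msg4 h.snd.fst.fst h.snd.fst.snd.fst h.snd.fst.snd.snd.snd
  have q3 := OEffCalc.msg4 h.snd.snd.fst h.snd.snd.snd.fst h.snd.snd.snd.snd.fst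
  have q4 := OEffCalc.msg4 h.snd.snd.fst h.snd.snd.snd.fst h.snd.snd.snd.snd.snd
  have g := effCalc_id (S := fun P => ((Stmt P × AuxKey P) × Fork P × Fork P) × Msg1 P ×
    Msg4 P × Msg4 P × Msg4 P × Msg4 P)
  have z1 : ∀ {f : ∀ P, ((Stmt P × AuxKey P) × Fork P × Fork P) × Msg1 P ×
      Msg4 P × Msg4 P × Msg4 P × Msg4 P → Msg4 P}, EffCalc f → EffCalc fun P s => (f P s).z1 :=
    fun hf => hf.wire (fun _ => Msg4.z1) (fun _ => Sum.inl) fun _ _ _ => rfl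
  have z2 : ∀ {f : ∀ P, ((Stmt P × AuxKey P) × Fork P × Fork P) × Msg1 P ×
      Msg4 P × Msg4 P × Msg4 P × Msg4 P → Msg4 P}, EffCalc f → EffCalc fun P s => (f P s).z2 :=
    fun hf => hf.wire (fun _ => Msg4.z2) (fun _ => Sum.inr) fun _ _ _ => rfl
  have m1 := g.snd.snd.fst
  have m2 := g.snd.snd.snd.fst
  have m3 := g.snd.snd.snd.snd.fst
  have m4 := g.snd.snd.snd.snd.snd
  have c1 := g.fst.snd.fst.snd.snd.fst.subRq g.fst.snd.fst.snd.snd.snd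
  have c2 := g.fst.snd.snd.snd.snd.fst.subRq g.fst.snd.snd.snd.snd.snd
  have za1 := (z1 m1).subVec PolyBdd.n (z1 m2)
  have zb1 := (z2 m1).subVec PolyBdd.n (z2 m2)
  have za2 := (z1 m3).subVec PolyBdd.n (z1 m4)
  have zb2 := (z2 m3).subVec PolyBdd.n (z2 m4)
  have post := (g.fst.fst.snd.openingOf g.snd.fst c1 za1 zb1).prodMk
    (c1.msisOf za1 zb1 c2 za2 zb2)
  have all := OEffCalc.comp post.oracle
    (h.oracle.prodMk (oEffCalc_msg1.prodMk (q1.prodMk (q2.prodMk (q3.prodMk q4)))))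
  exact OEff.bind hs.oracle all

end Extractor

end

end PoC

namespace PoC
noncomputable section

set_option linter.unusedSectionVars false

variable {P : Params}

/-! ### Extraction from forks -/

section Extraction

/-- Both runs of the fork are accepted and the challenges are short with invertible difference. -/
structure Opens (x : Stmt P) (hk : AuxKey P) (A : DetProver P) (k : Fork P) : Prop where
  acc : Accepts x hk (A.transcript k.1 k.2.1 k.2.2.1)
  acc' : Accepts x hk (A.transcript k.1 k.2.1 k.2.2.2)
  unit : IsUnit (cbar k)
  short : l1 k.2.2.1 ≤ P.ω
  short' : l1 k.2.2.2 ≤ P.ω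

/-- The extracted commitment randomness. -/
def extRand (A : DetProver P) (k : Fork P) : (Fin P.n → P.Rq) × (Fin P.n → P.Rq) :=
  (Ring.inverse (cbar k) • zbar1 A k, Ring.inverse (cbar k) • zbar2 A k)

/-- The message opened by `s`. -/
def openMsg (hk : AuxKey P) (m1 : Msg1 P) (s : Fin P.n → P.Rq) : P.Rq := m1.f1 - hk.B1 ⬝ᵥ s

/-- The mask opened by `s`. -/
def openMask (hk : AuxKey P) (m1 : Msg1 P) (s : Fin P.n → P.Rq) : Fin P.δ → P.Rq :=
  m1.u1 - hk.Bc.mulVec s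

/-- The randomness is short and opens to a message in `ℤ_q`. -/
def GoodRand (hk : AuxKey P) (m1 : Msg1 P) (y : (Fin P.n → P.Rq) × (Fin P.n → P.Rq)) : Prop :=
  (normInf y.1 : ℝ) ≤ 2 * P.bound3 ∧ ∃ v, openMsg hk m1 y.2 = AdjoinRoot.of _ v

/-- The relation that accepting provers with randomness `(r, s)` satisfy for their first two
challenges. -/
def Consistent (hk : AuxKey P) (A : DetProver P) (y : (Fin P.n → P.Rq) × (Fin P.n → P.Rq))
    (R : Ch1 P) (e : Ch2 P) : Prop :=
  (normInf (A.msg2 R) : ℝ) ≤ P.bound3 ∧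
    (∑ a, ∑ i, e.d1 a i * (coeff (matQ R y.1 a) i + coeff (openMask hk A.msg1 y.2 a) i
        - coeff (A.msg2 R a) i))
      + ∑ j, e.d2 j * coeff (openMsg hk A.msg1 y.2) (succIdx j)
      + coeff (A.msg1.u2 - hk.Bc' ⬝ᵥ y.2) 0 = 0

theorem combR_sub (R : Ch1 P) (e : Ch2 P) (r s : Fin P.n → P.Rq) :
    combR R e (r - s) = combR R e r - combR R e s := by
  have := combR_smul R e (-1) s
  rw [neg_one_smul, neg_one_mul] at this
  rw [sub_eq_add_neg, combR_add, this, sub_eq_add_neg]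

variable {x : Stmt P} {hk : AuxKey P} {A : DetProver P} {k k' : Fork P}

theorem Opens.inverse_mul (h : Opens x hk A k) :
    Ring.inverse (cbar k) * (k.2.2.1 - k.2.2.2) = 1 := Ring.inverse_mul_cancel _ h.unit

theorem Opens.smul_extRand (h : Opens x hk A k) :
    cbar k • (extRand A k).1 = zbar1 A k ∧ cbar k • (extRand A k).2 = zbar2 A k := by
  simp only [extRand, smul_smul, Ring.mul_inverse_cancel _ h.unit, one_smul, and_self]

theorem Opens.consistent (h : Opens x hk A k) :
    Consistent hk A (extRand A k) k.1 k.2.1 := by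
  refine ⟨h.acc.norm_z3, ?_⟩
  have hu := h.inverse_mul
  have E := h.acc.v4
  have E' := h.acc'.v4
  simp only [DetProver.transcript, relT, combV_sub, combV_mul, combE_sub, combE_smul] at E E'
  set u := Ring.inverse (cbar k) with hu0
  set R := k.1
  set e := k.2.1
  have key : combR R e (extRand A k).1 + combV e (openMsg hk A.msg1 (extRand A k).2)
      + combE e (openMask hk A.msg1 (extRand A k).2) + (A.msg1.u2 - hk.Bc' ⬝ᵥ (extRand A k).2)
      - combE e (A.msg2 R) = (A.msg3 R e).h := by
    simp only [extRand, openMsg, openMask, zbar1, zbar2, ← hu0, combR_smul, combR_sub, combV_sub,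
      dotProduct_smul, dotProduct_sub, Matrix.mulVec_smul, Matrix.mulVec_sub, combE_sub,
      combE_smul, smul_eq_mul, combV_mul]
    linear_combination (-u) * E + u * E' - (combV e A.msg1.f1 + combE e A.msg1.u1 + A.msg1.u2
      - (A.msg3 R e).h - combE e (A.msg2 R)) * hu
  have h0 := congrArg (fun a : P.Rq => coeff a 0) key
  have hc : coeff (A.msg3 R e).h 0 = 0 := h.acc.const_h
  simp only [hc] at h0
  rw [coeff_sub, coeff_add, coeff_add, coeff_add] at h0
  simp only [Pi.sub_apply, Pi.add_apply, coeff_zero_combR, coeff_zero_combE, coeff_zero_combV] at h0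
  rw [← h0]
  simp only [mul_add, mul_sub, Finset.sum_add_distrib, Finset.sum_sub_distrib]
  ring

theorem Opens.open_f0 (h : Opens x hk A k) :
    A.msg1.f0 = hk.A1.mulVec (extRand A k).1 + hk.A2.mulVec (extRand A k).2 := by
  have hu := h.inverse_mul
  have E := h.acc.opening
  have E' := h.acc'.opening
  simp only [DetProver.transcript] at E E'
  ext i
  have Ei := congrFun E i
  have Ei' := congrFun E' i
  simp only [extRand, zbar1, zbar2, Matrix.mulVec_smul, Matrix.mulVec_sub, Pi.add_apply,
    Pi.sub_apply, Pi.smul_apply, smul_eq_mul] at Ei Ei' ⊢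
  linear_combination (-Ring.inverse (cbar k)) * Ei + Ring.inverse (cbar k) * Ei'
    - A.msg1.f0 i * hu

theorem Opens.open_com (h : Opens x hk A k) : x.2 = commit x.1 (openMsg hk A.msg1 (extRand A k).2)
    ((P.sq : P.Rq) * openMsg hk A.msg1 (extRand A k).2) (openMsg hk A.msg1 (extRand A k).2)
      (extRand A k).1 := by
  have hu := h.inverse_mul
  have e0 := h.acc.v0
  have e0' := h.acc'.v0
  have e1 := h.acc.v1
  have e1' := h.acc'.v1
  have e2 := h.acc.v2
  have e2' := h.acc'.v2
  have e3 := h.acc.v3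
  have e3' := h.acc'.v3
  simp only [DetProver.transcript, relT] at e0 e0' e1 e1' e2 e2' e3 e3'
  set u := Ring.inverse (cbar k) with hu0
  rw [show x.2 = ⟨x.2.com0, x.2.com1, x.2.com2, x.2.com3⟩ from rfl, commit, Com.mk.injEq]
  refine ⟨funext fun i => ?_, ?_, ?_, ?_⟩
  · have Ei := congrFun e0 i
    have Ei' := congrFun e0' i
    simp only [extRand, zbar1, ← hu0, Matrix.mulVec_smul, Matrix.mulVec_sub, Pi.sub_apply,
      Pi.smul_apply, smul_eq_mul] at Ei Ei' ⊢
    linear_combination u * Ei - u * Ei' - x.2.com0 i * hu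
  all_goals simp only [extRand, openMsg, zbar1, zbar2, ← hu0, dotProduct_smul,
    dotProduct_sub, smul_eq_mul]
  · linear_combination u * e1 - u * e1' - (x.2.com1 - A.msg1.f1) * hu
  · linear_combination u * e2 - u * e2' - (x.2.com2 - (P.sq : P.Rq) * A.msg1.f1) * hu
  · linear_combination u * e3 - u * e3' - (x.2.com3 - A.msg1.f1) * hu

theorem Opens.norm_zbar1 (h : Opens x hk A k) : norm2 (zbar1 A k) ≤ 2 * P.bound12 := by
  have h1 := norm2_sub_le (A.msg4 k.1 k.2.1 k.2.2.1).z1 (A.msg4 k.1 k.2.1 k.2.2.2).z1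
  have h2 : norm2 (A.msg4 k.1 k.2.1 k.2.2.1).z1 ≤ P.bound12 := h.acc.norm_z1
  have h3 : norm2 (A.msg4 k.1 k.2.1 k.2.2.2).z1 ≤ P.bound12 := h.acc'.norm_z1
  rw [zbar1]
  linarith

theorem Opens.norm_zbar2 (h : Opens x hk A k) : norm2 (zbar2 A k) ≤ 2 * P.bound12 := by
  have h1 := norm2_sub_le (A.msg4 k.1 k.2.1 k.2.2.1).z2 (A.msg4 k.1 k.2.1 k.2.2.2).z2
  have h2 : norm2 (A.msg4 k.1 k.2.1 k.2.2.1).z2 ≤ P.bound12 := h.acc.norm_z2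
  have h3 : norm2 (A.msg4 k.1 k.2.1 k.2.2.2).z2 ≤ P.bound12 := h.acc'.norm_z2
  rw [zbar2]
  linarith

theorem Opens.l1_cbar (h : Opens x hk A k) : l1 (cbar k) ≤ 2 * P.ω := by
  have := l1_sub_le k.2.2.1 k.2.2.2
  have h1 := h.short
  have h2 := h.short'
  rw [cbar]
  omega

/-- A fork with good randomness yields a witness. -/
theorem Opens.relPoC (h : Opens x hk A k) (hg : GoodRand hk A.msg1 (extRand A k)) :
    RelPoC x hk A.msg1 (openingOf hk A.msg1 (cbar k) (zbar1 A k) (zbar2 A k)) where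
  unit := h.unit
  norm_c := h.l1_cbar
  norm_r := h.smul_extRand.1.symm ▸ h.norm_zbar1
  norm_s := h.smul_extRand.2.symm ▸ h.norm_zbar2
  open_f0 := h.open_f0
  open_f1 := (add_sub_cancel _ _).symm
  short := hg.1
  open_com := h.open_com
  form := by
    obtain ⟨v, hv⟩ := hg.2
    exact ⟨v, hv, congrArg _ hv, hv⟩

theorem norm2_cross_le {c c' : P.Rq} {z z' : Fin P.n → P.Rq} (hc : l1 c ≤ 2 * P.ω)
    (hc' : l1 c' ≤ 2 * P.ω) (hz : norm2 z ≤ 2 * P.bound12) (hz' : norm2 z' ≤ 2 * P.bound12) :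
    norm2 (c' • z - c • z') ≤ 8 * P.ω * P.bound12 := by
  have hc1 : (l1 c : ℝ) ≤ 2 * P.ω := by exact_mod_cast hc
  have hc2 : (l1 c' : ℝ) ≤ 2 * P.ω := by exact_mod_cast hc'
  have h1 := (norm2_smul_le c' z).trans
    (mul_le_mul hc2 hz (norm2_nonneg z) (by positivity))
  have h2 := (norm2_smul_le c z').trans
    (mul_le_mul hc1 hz' (norm2_nonneg z') (by positivity))
  have h3 := norm2_sub_le (c' • z) (c • z')
  linarith

/-- Two forks with different randomness yield a solution of module SIS. -/
theorem Opens.isMSISSolution (h : Opens x hk A k) (h' : Opens x hk A k')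
    (hne : extRand A k ≠ extRand A k') :
    IsMSISSolution (Matrix.fromCols hk.A1 hk.A2) (msisBound P)
      (msisOf (cbar k) (zbar1 A k) (zbar2 A k) (cbar k') (zbar1 A k') (zbar2 A k')) := by
  obtain ⟨e1, e2⟩ := h.smul_extRand
  obtain ⟨e1', e2'⟩ := h'.smul_extRand
  have E1 : cbar k' • zbar1 A k - cbar k • zbar1 A k'
      = (cbar k * cbar k') • ((extRand A k).1 - (extRand A k').1) := by
    rw [← e1, ← e1', smul_smul, smul_smul, smul_sub, mul_comm]
  have E2 : cbar k' • zbar2 A k - cbar k • zbar2 A k'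
      = (cbar k * cbar k') • ((extRand A k).2 - (extRand A k').2) := by
    rw [← e2, ← e2', smul_smul, smul_smul, smul_sub, mul_comm]
  refine ⟨?_, ?_, ?_⟩
  · have hf := h.open_f0
    rw [h'.open_f0] at hf
    rw [msisOf, Matrix.fromCols_mulVec_sumElim, E1, E2, Matrix.mulVec_smul, Matrix.mulVec_smul,
      ← smul_add, Matrix.mulVec_sub, Matrix.mulVec_sub, sub_add_sub_comm, ← hf, sub_self,
      smul_zero]
  · refine lt_of_le_of_ne (norm2_nonneg _) fun h0 => hne ?_
    have h1 := (norm2_eq_zero_iff _).1 h0.symm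
    rw [msisOf, E1, E2] at h1
    have hcc := h.unit.mul h'.unit
    have hz : ∀ {v : Fin P.n → P.Rq}, (cbar k * cbar k') • v = 0 → v = 0 := fun {v} hv => by
      have := congrArg (fun w => Ring.inverse (cbar k * cbar k') • w) hv
      simpa only [smul_smul, Ring.inverse_mul_cancel _ hcc, one_smul, smul_zero] using this
    refine Prod.ext (sub_eq_zero.1 (hz ?_)) (sub_eq_zero.1 (hz ?_))
    · ext i : 1
      exact congrFun h1 (Sum.inl i)
    · ext i : 1
      exact congrFun h1 (Sum.inr i)
  · rw [msisOf, norm2_sum_elim, msisBound]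
    have h1 := norm2_cross_le h.l1_cbar h'.l1_cbar h.norm_zbar1 h'.norm_zbar1
    have h2 := norm2_cross_le h.l1_cbar h'.l1_cbar h.norm_zbar2 h'.norm_zbar2
    have h3 : (0 : ℝ) ≤ 8 * P.ω := by positivity
    rw [← Real.sqrt_sq h3, ← Real.sqrt_mul (sq_nonneg _)]
    refine Real.sqrt_le_sqrt ?_
    have h4 := pow_le_pow_left₀ (norm2_nonneg _) h1 2
    have h5 := pow_le_pow_left₀ (norm2_nonneg _) h2 2
    calc _ ≤ _ := add_le_add h4 h5
      _ = _ := by ring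

end Extraction

end

end PoC

namespace PoC
noncomputable section

set_option linter.unusedSectionVars false

open ENNReal

variable {P : Params}

/-! ### Random linear tests -/

section Tests

open Classical in
theorem ex_unif_linear_le {w : P.Zq} (hw : w ≠ 0) (b : P.Zq) :
    (ex (PMF.uniformOfFintype P.Zq) fun a => if a * w + b = 0 then 1 else 0)
      ≤ ENNReal.ofReal (1 / P.q) := by
  have hq : (0 : ℝ) < P.q := by exact_mod_cast P.q_prime.pos
  rw [ex_uniform, ZMod.card, ENNReal.ofReal_div_of_pos hq, ENNReal.ofReal_one,
    ENNReal.ofReal_natCast]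
  refine ENNReal.div_le_div_right ?_ _
  rw [Finset.sum_eq_single (-b / w)]
  · split_ifs <;> simp
  · intro a _ ha
    refine if_neg fun h => ha ?_
    rw [eq_div_iff hw]
    exact eq_neg_of_add_eq_zero_left h
  · simp

theorem sum_update {ι α M : Type} [Fintype ι] [DecidableEq ι] [AddCommMonoid M] (v : ι → α) (i : ι)
    (a : α) (g : ι → α → M) : ∑ k, g k (Function.update v i a k)
      = g i a + ∑ k ∈ Finset.univ.erase i, g k (v k) := by
  rw [← Finset.add_sum_erase _ _ (Finset.mem_univ i), Function.update_self]
  congr 1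
  exact Finset.sum_congr rfl fun k hk => by rw [Function.update_of_ne (Finset.ne_of_mem_erase hk)]

open Classical in
theorem ex_iid_unif_linear_le {ι : Type} [Fintype ι] {w : ι → P.Zq} {i : ι} (hw : w i ≠ 0)
    (b : P.Zq) : (ex (iid ι (PMF.uniformOfFintype P.Zq)) fun v =>
      if ∑ k, v k * w k + b = 0 then 1 else 0) ≤ ENNReal.ofReal (1 / P.q) := by
  refine ex_iid_le i fun v => ?_
  refine le_trans (le_of_eq ?_) (ex_unif_linear_le hw
    (∑ k ∈ Finset.univ.erase i, v k * w k + b))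
  congr 1
  ext a
  rw [sum_update v i a fun k x => x * w k, add_assoc]

open Classical in
theorem ex_iid_iid_unif_linear_le {ι ι' : Type} [Fintype ι] [Fintype ι'] {w : ι → ι' → P.Zq}
    {i : ι} {i' : ι'} (hw : w i i' ≠ 0) (b : P.Zq) :
    (ex (iid ι (iid ι' (PMF.uniformOfFintype P.Zq))) fun v =>
      if ∑ k, ∑ k', v k k' * w k k' + b = 0 then 1 else 0) ≤ ENNReal.ofReal (1 / P.q) := by
  refine ex_iid_le i fun v => ?_
  refine le_trans (le_of_eq ?_) (ex_iid_unif_linear_le hw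
    (∑ k ∈ Finset.univ.erase i, ∑ k', v k k' * w k k' + b))
  congr 1
  ext a
  rw [sum_update v i a fun k x => ∑ k', x k' * w k k', add_assoc]

theorem natAbs_valMinAbs_sub_le (a b : P.Zq) :
    (a - b).valMinAbs.natAbs ≤ a.valMinAbs.natAbs + b.valMinAbs.natAbs := by
  rw [sub_eq_add_neg]
  refine (ZMod.natAbs_valMinAbs_add_le _ _).trans ((Int.natAbs_add_le _ _).trans ?_)
  rw [ZMod.natAbs_valMinAbs_neg]

open Classical in
/-- A random multiple of a large residue is rarely small. -/
theorem ex_bin1_small_le {β : ℝ} {ρ : P.Zq} (hρ : 2 * β < (ρ.valMinAbs.natAbs : ℝ)) (b : P.Zq) :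
    (ex bin1 fun a => if (((((a : ℤ) : P.Zq) * ρ + b).valMinAbs.natAbs : ℕ) : ℝ) ≤ β then 1 else 0)
      ≤ 1 / 2 := by
  rw [ex_bin1]
  have h4 : ENNReal.ofReal (1 / 4) + ENNReal.ofReal (1 / 4) = 1 / 2 := by
    rw [← ENNReal.ofReal_add (by norm_num) (by norm_num), show (1 / 4 + 1 / 4 : ℝ) = 1 / 2 by norm_num,
      ENNReal.ofReal_div_of_pos (by norm_num)]
    simp
  have hd : ∀ y z : P.Zq, y - z = ρ → (y.valMinAbs.natAbs : ℝ) ≤ β → ¬ (z.valMinAbs.natAbs : ℝ) ≤ β := by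
    intro y z h hy hz
    have h1 := natAbs_valMinAbs_sub_le y z
    rw [h] at h1
    have h2 : (ρ.valMinAbs.natAbs : ℝ) ≤ y.valMinAbs.natAbs + z.valMinAbs.natAbs := by
      exact_mod_cast h1
    linarith
  by_cases h0 : ((((((0 : ℤ) : P.Zq) * ρ + b).valMinAbs.natAbs : ℕ)) : ℝ) ≤ β
  · have h1 : ¬ ((((((1 : ℤ) : P.Zq) * ρ + b).valMinAbs.natAbs : ℕ)) : ℝ) ≤ β := fun h =>
      hd _ _ (by push_cast; ring) h h0
    have h2 : ¬ ((((((-1 : ℤ) : P.Zq) * ρ + b).valMinAbs.natAbs : ℕ)) : ℝ) ≤ β :=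
      hd _ _ (by push_cast; ring) h0
    rw [if_pos h0, if_neg h1, if_neg h2]
    simp
  · rw [if_neg h0, mul_zero, zero_add]
    refine le_trans (add_le_add ?_ ?_) h4.le
    all_goals
      refine (mul_le_mul_right ?_ _).trans (mul_one _).le
      split_ifs <;> simp

open Classical in
theorem ex_iid_bin1_small_le {ι : Type} [Fintype ι] {β : ℝ} {ρ : ι → P.Zq} {i : ι}
    (hρ : 2 * β < ((ρ i).valMinAbs.natAbs : ℝ)) (b : P.Zq) :
    (ex (iid ι bin1) fun v =>
      if (((∑ k, ((v k : ℤ) : P.Zq) * ρ k + b).valMinAbs.natAbs : ℕ) : ℝ) ≤ β then 1 else 0)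
      ≤ 1 / 2 := by
  refine ex_iid_le i fun v => ?_
  refine le_trans (le_of_eq ?_) (ex_bin1_small_le hρ
    (∑ k ∈ Finset.univ.erase i, ((v k : ℤ) : P.Zq) * ρ k + b))
  congr 1
  ext a
  rw [sum_update v i a fun k x => ((x : ℤ) : P.Zq) * ρ k, add_assoc]

open Classical in
theorem ex_row_small_le {ι : Type} [Fintype ι] {β : ℝ} {r : ι → P.Rq} {m : ι} {j : Fin P.d}
    (hr : 2 * β < ((coeff (r m) j).valMinAbs.natAbs : ℝ)) (b : P.Zq) :
    (ex (iid ι (polyOf P.d bin1)) fun u =>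
      if (((∑ k, ∑ i, coeff (red P.q (u k)) i * coeff (r k) i + b).valMinAbs.natAbs : ℕ) : ℝ) ≤ β
        then 1 else 0) ≤ 1 / 2 := by
  refine ex_iid_le m fun u => ?_
  rw [polyOf, ex_map]
  refine le_trans (le_of_eq ?_) (ex_iid_bin1_small_le (ρ := coeff (r m)) hr
    (∑ k ∈ Finset.univ.erase m, ∑ i, coeff (red P.q (u k)) i * coeff (r k) i + b))
  congr 1
  ext w
  rw [sum_update u m (ofCoeffs w) fun k x => ∑ i, coeff (red P.q x) i * coeff (r k) i, add_assoc]
  simp only [coeff_red, coeff_ofCoeffs]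

theorem normInf_le_iff {ι : Type} [Fintype ι] {u : ι → P.Rq} {β : ℝ} (hβ : 0 ≤ β) :
    (normInf u : ℝ) ≤ β ↔ ∀ i j, ((coeff (u i) j).valMinAbs.natAbs : ℝ) ≤ β := by
  simp only [← Nat.le_floor_iff hβ, normInf, Finset.sup_le_iff, Finset.mem_univ, true_imp_iff]

theorem bound3_nonneg (P : Params) : 0 ≤ P.bound3 :=
  mul_nonneg (Real.sqrt_nonneg _) (s3_pos P).le

open Classical in
/-- A vector with a large coefficient rarely has a small random projection. -/
theorem ex_projection_small_le {r : Fin P.n → P.Rq} (hr : ¬ (normInf r : ℝ) ≤ 2 * P.bound3)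
    (y : Fin P.δ → P.Rq) : (ex ((ch1LawZ P).map redCh1) fun R =>
      if (normInf (matQ R r + y) : ℝ) ≤ P.bound3 then 1 else 0)
      ≤ ENNReal.ofReal (1 / 2 ^ 256) := by
  have hb := bound3_nonneg P
  rw [normInf_le_iff (by positivity)] at hr
  push Not at hr
  obtain ⟨m, j, hmj⟩ := hr
  rw [ex_map, ch1LawZ]
  set g : Fin P.δ → Fin P.d → (Fin P.n → P.RZ) → ℝ≥0∞ := fun a i u =>
    if (((∑ k, ∑ j, coeff (red P.q (u k)) j * coeff (r k) j + coeff (y a) i).valMinAbs.natAbs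
      : ℕ) : ℝ) ≤ P.bound3 then 1 else 0 with hg
  have h1 : ∀ R : Fin P.δ → Fin P.d → Fin P.n → P.RZ,
      (if (normInf (matQ (redCh1 R) r + y) : ℝ) ≤ P.bound3 then 1 else 0 : ℝ≥0∞)
      ≤ ∏ a, ∏ i, g a i (R a i) := by
    intro R
    split_ifs with h
    · rw [normInf_le_iff hb] at h
      refine le_of_eq (Finset.prod_eq_one fun a _ => Finset.prod_eq_one fun i _ => ?_).symm
      refine if_pos ?_
      have := h a i
      rwa [Pi.add_apply, coeff_add, Pi.add_apply, matQ, coeff_ofCoeffs] at this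
    · exact zero_le
  refine (ex_mono h1).trans ?_
  rw [ex_iid_prod (iid (Fin P.d) (iid (Fin P.n) (polyOf P.d bin1))) fun a (Ra : Fin P.d → _) =>
      ∏ i, g a i (Ra i)]
  have h2 : ∀ a : Fin P.δ, ex (iid (Fin P.d) (iid (Fin P.n) (polyOf P.d bin1)))
      (fun Ra => ∏ i, g a i (Ra i)) ≤ ∏ _i : Fin P.d, (1 / 2 : ℝ≥0∞) := by
    intro a
    rw [ex_iid_prod (iid (Fin P.n) (polyOf P.d bin1)) fun i u => g a i u]
    exact Finset.prod_le_prod' fun i _ => ex_row_small_le hmj _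
  refine (Finset.prod_le_prod' fun a _ => h2 a).trans (le_of_eq ?_)
  simp only [Finset.prod_const, Finset.card_univ, Fintype.card_fin]
  rw [← pow_mul, mul_comm P.d, δ_mul_d, ENNReal.ofReal_div_of_pos (by positivity),
    ENNReal.ofReal_one, ENNReal.ofReal_pow (by norm_num), one_div, one_div, ENNReal.inv_pow]
  simp

open Classical in
/-- A fixed bad opening is rarely consistent with the first two challenges. -/
theorem ex_consistent_le {hk : AuxKey P} {A : DetProver P}
    {y : (Fin P.n → P.Rq) × (Fin P.n → P.Rq)} (hy : ¬ GoodRand hk A.msg1 y) :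
    (ex (prodLaw ((ch1LawZ P).map redCh1) (ch2Law P)) fun t =>
      if Consistent hk A y t.1 t.2 then 1 else 0)
      ≤ ENNReal.ofReal (1 / P.q) + ENNReal.ofReal (1 / 2 ^ 256) := by
  rw [ex_prodLaw]
  by_cases hform : ∃ v, openMsg hk A.msg1 y.2 = AdjoinRoot.of _ v
  · have hshort : ¬ (normInf y.1 : ℝ) ≤ 2 * P.bound3 := fun h => hy ⟨h, hform⟩
    refine le_trans (ex_mono fun R => ?_) (((ex_add _ (fun _ => ENNReal.ofReal (1 / P.q)) fun R =>
      if (normInf (matQ R y.1 + openMask hk A.msg1 y.2) : ℝ) ≤ P.bound3 then 1 else 0).trans_le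
      (add_le_add (ex_const _ _).le (ex_projection_small_le hshort _))))
    by_cases hR : A.msg2 R = matQ R y.1 + openMask hk A.msg1 y.2
    · rw [← hR]
      refine le_add_left (ex_le_const fun e => ?_)
      by_cases h : (normInf (A.msg2 R) : ℝ) ≤ P.bound3
      · rw [if_pos h]
        split_ifs <;> simp
      · rw [if_neg h, if_neg fun hc : Consistent hk A y R e => h hc.1]
    · refine le_add_right ?_
      have hne : ∃ a i, coeff (matQ R y.1 a) i + coeff (openMask hk A.msg1 y.2 a) i
          - coeff (A.msg2 R a) i ≠ 0 := by
        by_contra! h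
        refine hR (funext fun a => coeff_injective ?_)
        ext i
        rw [Pi.add_apply, coeff_add, Pi.add_apply]
        exact (sub_eq_zero.1 (h a i)).symm
      obtain ⟨a, i, hai⟩ := hne
      rw [ch2Law, ex_bind]
      simp only [ex_bind, ex_pure]
      rw [ex_comm]
      refine ex_le_const fun d2 => le_trans (ex_mono fun d1 => ?_) (ex_iid_iid_unif_linear_le
        (w := fun a i => coeff (matQ R y.1 a) i + coeff (openMask hk A.msg1 y.2 a) i
          - coeff (A.msg2 R a) i) hai (∑ j, d2 j * coeff (openMsg hk A.msg1 y.2) (succIdx j)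
            + coeff (A.msg1.u2 - hk.Bc' ⬝ᵥ y.2) 0))
      split_ifs with h h'
      · exact le_rfl
      · refine absurd ?_ h'
        rw [← add_assoc]
        exact h.2
      all_goals exact zero_le
  · refine le_trans (ex_le_const fun R => ?_) le_self_add
    rw [eq_of_iff] at hform
    push Not at hform
    obtain ⟨j, hj, hmj⟩ := hform
    have hj0 : (j : ℕ) ≠ 0 := fun h => hj (Fin.ext (by simpa using h))
    have hj' : succIdx (P := P) ⟨j - 1, by have := j.2; omega⟩ = j :=
      Fin.ext (Nat.sub_add_cancel (Nat.pos_of_ne_zero hj0))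
    rw [ch2Law, ex_bind]
    simp only [ex_bind, ex_pure]
    refine ex_le_const fun d1 => le_trans (ex_mono fun d2 => ?_) (ex_iid_unif_linear_le
      (w := fun j => coeff (openMsg hk A.msg1 y.2) (succIdx j)) (i := ⟨j - 1, by have := j.2; omega⟩)
      (by rwa [hj']) ((∑ a, ∑ i, d1 a i * (coeff (matQ R y.1 a) i
        + coeff (openMask hk A.msg1 y.2 a) i - coeff (A.msg2 R a) i))
        + coeff (A.msg1.u2 - hk.Bc' ⬝ᵥ y.2) 0))
    split_ifs with h h'
    · exact le_rfl
    · refine absurd ?_ h'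
      rw [← h.2]
      ring
    all_goals exact zero_le

end Tests

end

end PoC

namespace PoC
noncomputable section

set_option linter.unusedSectionVars false

open ENNReal

variable {P : Params}

/-! ### Knowledge soundness -/

section Soundness

theorem l1_le_of_mem_chal {c : P.Rq} (hc : c ∈ (P.chal.map (red P.q)).support) : l1 c ≤ P.ω := by
  obtain ⟨a, ha, rfl⟩ := (PMF.mem_support_map_iff _ _ _).1 hc
  exact (l1_red_le a).trans (l1Z_le_of_mem_chal ha)

open Classical in
/-- The probability that the last challenge is answered. -/
def accProb (x : Stmt P) (hk : AuxKey P) (A : DetProver P) (R : Ch1 P) (e : Ch2 P) : ℝ≥0∞ :=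
  ex (P.chal.map (red P.q)) fun c => if Accepts x hk (A.transcript R e c) then 1 else 0

open Classical in
/-- The probability that a fork opens. -/
def forkProb (x : Stmt P) (hk : AuxKey P) (A : DetProver P) (R : Ch1 P) (e : Ch2 P) : ℝ≥0∞ :=
  ex (P.chal.map (red P.q)) fun c => ex (P.chal.map (red P.q)) fun c' =>
    if Opens x hk A (R, e, c, c') then 1 else 0

theorem accProb_le_one (x : Stmt P) (hk : AuxKey P) (A : DetProver P) (R : Ch1 P) (e : Ch2 P) :
    accProb x hk A R e ≤ 1 := ex_le_const fun c => by split_ifs <;> simp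

open Classical in
theorem sq_le_forkProb {κ : ℝ≥0∞}
    (hκ : ∀ c' : P.Rq, (ex (P.chal.map (red P.q)) fun c => if IsUnit (c - c') then 0 else 1) ≤ κ)
    (x : Stmt P) (hk : AuxKey P) (A : DetProver P) (R : Ch1 P) (e : Ch2 P) :
    (accProb x hk A R e - κ) ^ 2 ≤ forkProb x hk A R e := by
  have h1 : ∀ c ∈ (P.chal.map (red P.q)).support,
      (if Accepts x hk (A.transcript R e c) then 1 else 0) * (accProb x hk A R e - κ)
      ≤ ex (P.chal.map (red P.q)) fun c' => if Opens x hk A (R, e, c, c') then 1 else 0 := by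
    intro c hc
    split_ifs with hacc
    · rw [one_mul, tsub_le_iff_right]
      refine le_trans ?_ (add_le_add le_rfl (hκ c))
      rw [accProb, ← ex_add]
      refine ex_mono_support fun c' hc' => ?_
      by_cases hu : IsUnit (c' - c)
      · split_ifs with h1 h2
        · simp
        · refine absurd ⟨hacc, h1, ?_, l1_le_of_mem_chal hc, l1_le_of_mem_chal hc'⟩ h2
          have : cbar (R, e, c, c') = -(c' - c) := (neg_sub c' c).symm
          rw [this]
          exact hu.neg
        all_goals exact zero_le
      · rw [if_neg hu]
        refine le_add_left ?_
        split_ifs <;> simp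
    · rw [zero_mul]
      exact zero_le
  refine le_trans ?_ (ex_mono_support h1)
  rw [ex_mul_const, sq]
  exact mul_le_mul_left tsub_le_self _

/-- The law of the first two challenges. -/
abbrev earlyLaw (P : Params) : PMF (Ch1 P × Ch2 P) :=
  prodLaw ((ch1LawZ P).map redCh1) (ch2Law P)

theorem ex_forkLaw (f : Fork P → ℝ≥0∞) : ex (forkLaw P) f = ex (earlyLaw P) fun t =>
    ex (P.chal.map (red P.q)) fun c => ex (P.chal.map (red P.q)) fun c' => f (t.1, t.2, c, c') := by
  simp only [forkLaw, ex_prodLaw]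

/-- Success of the extractor. -/
def Wins (x : Stmt P) (hk : AuxKey P) (m1 : Msg1 P)
    (o : Opening P × (Fin P.n ⊕ Fin P.n → P.Rq)) : Prop :=
  RelPoC x hk m1 o.1 ∨ IsMSISSolution (Matrix.fromCols hk.A1 hk.A2) (msisBound P) o.2

open Classical in
theorem pow_four_le_ex_extRun {κ : ℝ≥0∞}
    (hκ : ∀ c' : P.Rq, (ex (P.chal.map (red P.q)) fun c => if IsUnit (c - c') then 0 else 1) ≤ κ)
    (x : Stmt P) (hk : AuxKey P) (A : DetProver P) :
    ((ex (earlyLaw P) fun t => accProb x hk A t.1 t.2)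
      - (κ + (ENNReal.ofReal (1 / P.q) + ENNReal.ofReal (1 / 2 ^ 256)))) ^ 4
      ≤ ex (extRun hk A) fun o => if Wins x hk A.msg1 o then 1 else 0 := by
  set ℓ := ENNReal.ofReal (1 / P.q) + ENNReal.ofReal (1 / 2 ^ 256) with hℓ
  set w : Ch1 P × Ch2 P → ℝ≥0∞ := fun t => accProb x hk A t.1 t.2 - κ with hw
  have hw1 : ∀ t, w t ≤ 1 := fun t => tsub_le_self.trans (accProb_le_one x hk A t.1 t.2)
  have hE : (ex (earlyLaw P) fun t => accProb x hk A t.1 t.2) - κ ≤ ex (earlyLaw P) w := by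
    rw [tsub_le_iff_right, ← ex_const (earlyLaw P) κ, ← ex_add]
    exact ex_mono fun t => le_tsub_add
  set δ := ex (earlyLaw P) w - ℓ with hδ
  have hδ1 : δ ≤ 1 := tsub_le_self.trans (ex_le_const hw1)
  have hstep : ∀ k, Opens x hk A k → δ ^ 2 ≤ ex (forkLaw P) fun k' =>
      if Wins x hk A.msg1 (openingOf hk A.msg1 (cbar k) (zbar1 A k) (zbar2 A k),
        msisOf (cbar k) (zbar1 A k) (zbar2 A k) (cbar k') (zbar1 A k') (zbar2 A k'))
      then 1 else 0 := by
    intro k hk1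
    by_cases hg : GoodRand hk A.msg1 (extRand A k)
    · have hwin := hk1.relPoC hg
      simp only [Wins, hwin, true_or, if_true, ex_const]
      exact pow_le_one₀ zero_le hδ1
    · have hC := ex_consistent_le hg
      set L : Ch1 P × Ch2 P → Prop := fun t => Consistent hk A (extRand A k) t.1 t.2 with hL
      have h1 : δ ≤ ex (earlyLaw P) fun t => if L t then 0 else w t := by
        rw [hδ, tsub_le_iff_right]
        refine le_trans ?_ (add_le_add le_rfl hC)
        rw [← ex_add]
        refine ex_mono fun t => ?_
        by_cases ht : Consistent hk A (extRand A k) t.1 t.2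
        · rw [if_pos ht, if_pos ht, zero_add]
          exact hw1 t
        · rw [if_neg ht, if_neg ht, add_zero]
      refine (pow_le_pow_left₀ zero_le h1 2).trans ((ex_sq_le fun t => ?_).trans ?_)
      · split_ifs
        · exact zero_le
        · exact hw1 t
      rw [ex_forkLaw]
      refine ex_mono fun t => ?_
      split_ifs with ht
      · rw [zero_pow two_ne_zero]
        exact zero_le
      · refine (sq_le_forkProb hκ x hk A t.1 t.2).trans ?_
        refine ex_mono fun c => ex_mono fun c' => ?_
        by_cases ho : Opens x hk A (t.1, t.2, c, c')
        · rw [if_pos ho, if_pos]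
          refine Or.inr (hk1.isMSISSolution ho fun he => ht ?_)
          rw [hL]
          simp only [he]
          exact ho.consistent
        · rw [if_neg ho]
          exact zero_le
  have hfinal : δ ^ 4 ≤ ex (extRun hk A) fun o => if Wins x hk A.msg1 o then 1 else 0 := by
    rw [extRun, ex_bind, ex_prodLaw]
    simp only [ex_pure]
    calc δ ^ 4 = δ ^ 2 * δ ^ 2 := by ring
      _ ≤ (ex (earlyLaw P) fun t => w t ^ 2) * δ ^ 2 := by
        refine mul_le_mul_left ?_ _
        exact (pow_le_pow_left₀ zero_le tsub_le_self 2).trans (ex_sq_le hw1)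
      _ ≤ (ex (forkLaw P) fun k => if Opens x hk A k then 1 else 0) * δ ^ 2 := by
        refine mul_le_mul_left ?_ _
        rw [ex_forkLaw]
        exact ex_mono fun t => sq_le_forkProb hκ x hk A t.1 t.2
      _ ≤ _ := by
        rw [← ex_mul_const]
        refine ex_mono fun k => ?_
        split_ifs with ho
        · rw [one_mul]
          exact hstep k ho
        · rw [zero_mul]
          exact zero_le
  refine le_trans (pow_le_pow_left₀ zero_le ?_ 4) hfinal
  rw [← tsub_tsub]
  exact tsub_le_tsub_right hE _

theorem exists_isKnowledgeSound : ∃ a, ∀ P b, a ≤ b → IsKnowledgeSound P 4 b := by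
  classical
  obtain ⟨N, ⟨a, hN⟩, hExt⟩ := oEff_extRun
  refine ⟨max a 1, fun P b hb => ?_⟩
  obtain ⟨Ext, hsize, hrun⟩ := (hExt P).run_eq
  refine ⟨Ext, hsize.trans ((hN P).trans (poly_mono P (le_of_max_le_left hb))),
    fun x hk 𝒜 K err hK herr hε => ?_⟩
  have hπ := Pr_small_pos P
  have hK0 : 0 ≤ K := by
    have h0 : (0 : ℝ) ≤ (P.q * P.maxProb) ^ (P.d / P.l) :=
      pow_nonneg (mul_nonneg (Nat.cast_nonneg _) (maxProb_nonneg P)) _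
    by_contra! h
    nlinarith
  have hκ := ex_chal_not_isUnit_le hK
  set κ := ENNReal.ofReal (K * (P.l / (P.q : ℝ) ^ (P.d / P.l))) with hκ0
  set E := κ + (ENNReal.ofReal (1 / P.q) + ENNReal.ofReal (1 / 2 ^ 256)) with hE
  have hE1 : ENNReal.ofReal err = E := by
    rw [herr, ENNReal.ofReal_add (by positivity) (by positivity),
      ENNReal.ofReal_add (by positivity) (by positivity), add_assoc]
  have hacc : ENNReal.ofReal (acceptProb x hk 𝒜)
      = ex 𝒜 fun A => ex (earlyLaw P) fun t => accProb x hk A t.1 t.2 := by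
    rw [acceptProb, ofReal_Pr]
    simp only [monad_bind_eq, ex_bind, ex_prodLaw, accProb]
    congr! 9
    exact ex_pure _ _
  have hext : ENNReal.ofReal (extractProb x hk 𝒜 Ext)
      = ex 𝒜 fun A => ex (extRun hk A) fun o => if Wins x hk A.msg1 o then 1 else 0 := by
    rw [extractProb, ofReal_Pr]
    simp only [monad_bind_eq, ex_bind, hrun]
    congr! 4
    exact ex_pure _ _
  have hle1 : ∀ A : DetProver P,
      ((ex (earlyLaw P) fun t => accProb x hk A t.1 t.2) - E) ≤ 1 := fun A =>
    tsub_le_self.trans (ex_le_const fun t => accProb_le_one x hk A t.1 t.2)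
  have hmain : ENNReal.ofReal (acceptProb x hk 𝒜 - err) ^ 4
      ≤ ENNReal.ofReal (extractProb x hk 𝒜 Ext) := by
    rw [ENNReal.ofReal_sub _ (by rw [herr]; positivity), hE1, hacc, hext]
    have h1 : (ex 𝒜 fun A => ex (earlyLaw P) fun t => accProb x hk A t.1 t.2) - E
        ≤ ex 𝒜 fun A => (ex (earlyLaw P) fun t => accProb x hk A t.1 t.2) - E := by
      rw [tsub_le_iff_right]
      refine le_trans ?_ (add_le_add le_rfl (ex_const 𝒜 E).le)
      rw [← ex_add]
      exact ex_mono fun A => le_tsub_add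
    calc _ ≤ (ex 𝒜 fun A => (ex (earlyLaw P) fun t => accProb x hk A t.1 t.2) - E) ^ 4 :=
          pow_le_pow_left₀ zero_le h1 4
      _ = ((ex 𝒜 fun A => (ex (earlyLaw P) fun t => accProb x hk A t.1 t.2) - E) ^ 2) ^ 2 := by
          ring
      _ ≤ (ex 𝒜 fun A => ((ex (earlyLaw P) fun t => accProb x hk A t.1 t.2) - E) ^ 2) ^ 2 :=
          pow_le_pow_left₀ zero_le (ex_sq_le hle1) 2
      _ ≤ ex 𝒜 fun A => (((ex (earlyLaw P) fun t => accProb x hk A t.1 t.2) - E) ^ 2) ^ 2 :=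
          ex_sq_le fun A => pow_le_one₀ zero_le (hle1 A)
      _ ≤ _ := by
          refine ex_mono fun A => ?_
          rw [← pow_mul]
          exact pow_four_le_ex_extRun hκ x hk A
  have hnn : 0 ≤ extractProb x hk 𝒜 Ext := Pr_nonneg _ _
  rw [← ENNReal.ofReal_pow (by linarith), ENNReal.ofReal_le_ofReal_iff hnn] at hmain
  have hb1 : (1 : ℝ) ≤ b * (P.secPar : ℝ) ^ b := by
    have : 0 < b * P.secPar ^ b :=
      Nat.mul_pos (le_of_max_le_right hb) (Nat.pow_pos (secPar_pos P))
    exact_mod_cast this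
  exact hmain.trans (le_mul_of_one_le_left hnn hb1)

end Soundness

end

end PoC

theorem mainTheorem7 :
    ∃ D a : ℕ, 0 < D ∧ ∀ P : PoC.Params,
      PoC.IsComplete P ∧ PoC.IsKnowledgeSound P D a ∧ PoC.IsHVZK P a := by
  obtain ⟨a, ha⟩ := PoC.exists_isKnowledgeSound
  obtain ⟨b, hb⟩ := PoC.exists_isHVZK
  exact ⟨4, max a b, four_pos, fun P => ⟨PoC.isComplete P, ha P _ (le_max_left a b),
    hb P _ (le_max_right a b)⟩⟩
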